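/- **Setting.** All random variables live on one probability space; $\|W\|_q=(\mathbb E|W|^q)^{1/q}$. Let $X_{t,n}$ be a triangular array of real random variables ($t=1,\dots,n$; where lagged values are used below, $X_{t,n}$ with $t\le 0$ are arbitrary further random variables), and for each $u\in[0,1]$ let $(\tilde X_t(u))_{t\in\mathbb Z}$ be a stationary and ergodic real process. Let $(\varepsilon_t)_{t\in\mathbb Z}$ be i.i.d. real random variables and, for each $s$, let $\varepsilon_s^*$ have the distribution of $\varepsilon_1$ and be independent of $(\varepsilon_t)_{t\in\mathbb Z}$. Put $\mathcal F_t=(\varepsilon_t,\varepsilon_{t-1},\dots)$, and let $\mathcal F_t^{*(t-k)}$ be $\mathcal F_t$ with $\varepsilon_{t-k}$ replaced by $\varepsilon_{t-k}^*$. For $q>0$ and $0<\alpha\le 1$ consider the conditions * (S1) $\sup_{u\in[0,1]}\|\tilde X_t(u)\|_q<\infty$, and there is $C_B>0$ such that for all $n$, all $t=1,\dots,n$ and all $u,v\in[0,1]$: $\|\tilde X_t(u)-\tilde X_t(v)\|_q\le C_B|u-v|^\alpha$ and $\|X_{t,n}-\tilde X_t(t/n)\|_q\le C_Bn^{-\alpha}$.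 * (S2) For all $t\in\mathbb Z$, $u\mapsto\tilde X_t(u)$ is almost surely continuous on $[0,1]$ and $\big\|\sup_{u\in[0,1]}|\tilde X_t(u)|\big\|_q<\infty$. * (M1) For each $u\in[0,1]$ there is a measurable $H(u,\cdot):\mathbb R^{\mathbb N}\to\mathbb R$ with $\tilde X_t(u)=H(u,\mathcal F_t)$ a.s. for all $t\in\mathbb Z$, and $\sum_{k=0}^\infty\sup_{u\in[0,1]}\sup_{t\in\mathbb Z}\|H(u,\mathcal F_t)-H(u,\mathcal F_t^{*(t-k)})\|_q<\infty$. Let $K:\mathbb R\to\mathbb R$ be bounded and of bounded variation, vanish outside $[-\tfrac12,\tfrac12]$, and satisfy $\int K\,dx=1$. **Theorem 2.10 (Central limit theorem, local version).** Let $q\ge 2$, $0<\alpha\le1$, and let $b=b_n$ satisfy $b\to0$, $nb\to\infty$ and $\sqrt{nb}\,n^{-\alpha}\to0$. Let $u\in(0,1)$. (a) If (S1), (S2) and (M1) hold with $q$ and $\alpha$, then the series $$\sigma^2(u)=\sum_{k\in\mathbb Z}\operatorname{Cov}(\tilde X_0(u),\tilde X_k(u))$$ converges absolutely, $\sigma^2(u)\ge0$,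 and $$\frac1{\sqrt{nb}}\sum_{t=1}^nK\Big(\frac{t/n-u}{b}\Big)\big\{X_{t,n}-\mathbb EX_{t,n}\big\}\ \xrightarrow{d}\ N\Big(0,\int K(x)^2\,dx\cdot\sigma^2(u)\Big).$$ (b) Let $r\in\mathbb N$, $M\ge0$, $C\in\mathbb R$, and let $g:\mathbb R^r\to\mathbb R$ satisfy $$|g(y)-g(y')|\le C\,|y-y'|_1\,(1+|y|_1^M+|y'|_1^M)\quad\text{for all }y\ne y',\qquad |y|_1=\sum_{i=1}^r|y_i|.$$ If (S1), (S2) and (M1) hold for $X_{t,n}$, $\tilde X_t(u)$ with $q(M+1)$ in place of $q$ and with $\alpha$, then the conclusion of (a) holds with $X_{t,n}$ replaced by $g(X_{t,n},\dots,X_{t-r+1,n})$ and $\tilde X_t(u)$ replaced by $g(\tilde X_t(u),\dots,\tilde X_{t-r+1}(u))$, in particular in the definition of $\sigma^2(u)$. -/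

import Mathlib

open MeasureTheory ProbabilityTheory Filter Topology
open scoped ENNReal NNReal

noncomputable section

namespace LocStat

/-- Localizing kernel: bounded, of bounded variation on `ℝ`, vanishing outside `[-1/2, 1/2]`,
with integral one. -/
structure LocalizingKernel (K : ℝ → ℝ) : Prop where
  bounded : ∃ B : ℝ, ∀ x, |K x| ≤ B
  boundedVariation : BoundedVariationOn K Set.univ
  support_subset : Function.support K ⊆ Set.Icc (-(1 / 2)) (1 / 2)
  integral_eq_one : ∫ x, K x = 1

variable {Ω : Type*} [MeasurableSpace Ω]

/-- `‖W‖_q = (E |W|^q)^{1/q}`, with values in `[0, ∞]`. -/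
def lqNorm (P : Measure Ω) (q : ℝ) (W : Ω → ℝ) : ℝ≥0∞ :=
  eLpNorm W (ENNReal.ofReal q) P

/-- The real process `(Y t)`, `t ∈ ℤ`, is stationary and ergodic: the left shift on `ℝ^ℤ`
preserves the law of the process and is ergodic for it. -/
def StationaryErgodic (P : Measure Ω) (Y : ℤ → Ω → ℝ) : Prop :=
  Ergodic (fun (x : ℤ → ℝ) (t : ℤ) => x (t + 1)) (P.map (fun ω t => Y t ω))

/-- Condition (S1) with moment order `q` and exponent `α`, for the array `X t n` (constrained for
`1 ≤ t ≤ n` only) and the stationary approximation `Xs t u`, `u ∈ [0, 1]`. -/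
structure CondS1 (P : Measure Ω) (X : ℤ → ℕ → Ω → ℝ) (Xs : ℤ → ℝ → Ω → ℝ) (q α : ℝ) : Prop where
  moment : ∀ t, (⨆ u ∈ Set.Icc (0 : ℝ) 1, lqNorm P q (Xs t u)) < ∞
  approx : ∃ CB : ℝ, 0 < CB ∧ ∀ (n : ℕ) (t : ℤ), 1 ≤ t → t ≤ n →
    (∀ u ∈ Set.Icc (0 : ℝ) 1, ∀ v ∈ Set.Icc (0 : ℝ) 1,
      lqNorm P q (fun ω => Xs t u ω - Xs t v ω) ≤ ENNReal.ofReal (CB * |u - v| ^ α)) ∧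
    lqNorm P q (fun ω => X t n ω - Xs t ((t : ℝ) / n) ω) ≤ ENNReal.ofReal (CB * (n : ℝ) ^ (-α))

/-- Condition (S2): almost surely continuous paths in `u`, and
`‖ sup_{u ∈ [0,1]} |Xs t u| ‖_q < ∞`. -/
structure CondS2 (P : Measure Ω) (Xs : ℤ → ℝ → Ω → ℝ) (q : ℝ) : Prop where
  continuous : ∀ t, ∀ᵐ ω ∂P, ContinuousOn (fun u => Xs t u ω) (Set.Icc 0 1)
  moment : ∀ t, eLpNorm (fun ω => ⨆ u ∈ Set.Icc (0 : ℝ) 1, ‖Xs t u ω‖ₑ) (ENNReal.ofReal q) P < ∞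

/-- `ε t`, `t ∈ ℤ`, are i.i.d. real random variables; each `ε' s` has the same distribution and
is independent of the whole sequence `ε`. -/
structure Innovations (P : Measure Ω) (ε ε' : ℤ → Ω → ℝ) : Prop where
  measurable : ∀ t, Measurable (ε t)
  measurable_copy : ∀ s, Measurable (ε' s)
  indep : iIndepFun ε P
  identDistrib : ∀ t, IdentDistrib (ε t) (ε 1) P P
  identDistrib_copy : ∀ s, IdentDistrib (ε' s) (ε 1) P P
  indep_copy : ∀ s, IndepFun (ε' s) (fun ω t => ε t ω) P

/-- The past `F_t = (ε_t, ε_{t-1}, …)`. -/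
def past (ε : ℤ → Ω → ℝ) (t : ℤ) (ω : Ω) : ℕ → ℝ :=
  fun j => ε (t - j) ω

/-- The past `F_t^{*s}`, in which the innovation at time `s` is replaced by its copy `ε' s`. -/
def coupledPast (ε ε' : ℤ → Ω → ℝ) (t s : ℤ) (ω : Ω) : ℕ → ℝ :=
  fun j => if t - j = s then ε' s ω else ε (t - j) ω

/-- The functional dependence measure `δ_q(k) = sup_t ‖W_t - W_t^{*(t-k)}‖_q` of the process
`W_t = H(F_t)`. -/
def depMeasure (P : Measure Ω) (ε ε' : ℤ → Ω → ℝ) (H : (ℕ → ℝ) → ℝ) (q : ℝ) (k : ℕ) : ℝ≥0∞ :=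
  ⨆ t : ℤ, lqNorm P q (fun ω => H (past ε t ω) - H (coupledPast ε ε' t (t - k) ω))

/-- Condition (M1): `Xs t u = H(u, F_t)` almost surely with `H(u, ·)` measurable, and the uniform
dependence measure `sup_{u ∈ [0,1]} δ_q^{Xs(u)}(k)` is summable over `k ≥ 0`. -/
def CondM1 (P : Measure Ω) (ε ε' : ℤ → Ω → ℝ) (Xs : ℤ → ℝ → Ω → ℝ) (q : ℝ) : Prop :=
  ∃ H : ℝ → (ℕ → ℝ) → ℝ,
    (∀ u ∈ Set.Icc (0 : ℝ) 1, Measurable (H u)) ∧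
    (∀ u ∈ Set.Icc (0 : ℝ) 1, ∀ t, Xs t u =ᵐ[P] fun ω => H u (past ε t ω)) ∧
    (∑' k : ℕ, (⨆ u ∈ Set.Icc (0 : ℝ) 1, depMeasure P ε ε' (H u) q k)) < ∞

/-- The class `L_r(M, C)` of functions on `ℝ^r` that are locally Lipschitz with polynomially
growing constant, with respect to `|y|_1 = ∑ i, |y i|`. -/
def ClassL (r : ℕ) (M C : ℝ) (g : (Fin r → ℝ) → ℝ) : Prop :=
  0 ≤ M ∧ ∀ y y' : Fin r → ℝ, y ≠ y' →
    |g y - g y'| / ((∑ i, |y i - y' i|) * (1 + (∑ i, |y i|) ^ M + (∑ i, |y' i|) ^ M)) ≤ C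

/-- The autocovariance `Cov(Xs_0(u), Xs_k(u))`. -/
def autocov (P : Measure Ω) (Xs : ℤ → ℝ → Ω → ℝ) (u : ℝ) (k : ℤ) : ℝ :=
  covariance (Xs 0 u) (Xs k u) P

/-- The long-run variance `σ²(u) = ∑_{k ∈ ℤ} Cov(Xs_0(u), Xs_k(u))`. -/
def longRunVar (P : Measure Ω) (Xs : ℤ → ℝ → Ω → ℝ) (u : ℝ) : ℝ :=
  ∑' k : ℤ, autocov P Xs u k

/-- `(n b)^{-1/2} ∑_{t=1}^n K((t/n - u)/b) (X_{t,n} - E X_{t,n})`. -/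
def localSum (P : Measure Ω) (K : ℝ → ℝ) (X : ℤ → ℕ → Ω → ℝ) (b u : ℝ) (n : ℕ) (ω : Ω) : ℝ :=
  (√(n * b))⁻¹ * ∑ t ∈ Finset.Icc (1 : ℤ) n,
    K (((t : ℝ) / n - u) / b) * (X t n ω - ∫ ω', X t n ω' ∂P)

/-- The local central limit theorem for `X` with stationary approximation `Xs` at `u`: the series
`σ²(u)` converges, its value is nonnegative, and the local sums with bandwidths `b n` converge in
distribution to `N(0, ∫ K² · σ²(u))`. -/
def LocalCLT (P : Measure Ω) [IsProbabilityMeasure P] (K : ℝ → ℝ) (X : ℤ → ℕ → Ω → ℝ)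
    (Xs : ℤ → ℝ → Ω → ℝ) (b : ℕ → ℝ) (u : ℝ) : Prop :=
  Summable (autocov P Xs u) ∧ 0 ≤ longRunVar P Xs u ∧
  TendstoInDistribution (fun n : ℕ => localSum P K X (b n) u n) atTop (id : ℝ → ℝ) (fun _ => P)
    (gaussianReal 0 ((∫ x, K x ^ 2) * longRunVar P Xs u).toNNReal)

/-- `g(Z_{t,n})` with `Z_{t,n} = (X_{t,n}, …, X_{t-r+1,n})`. The second index is either the sample
size `n` or the rescaled time `u`. -/
def lagTransform {ι : Type*} {r : ℕ} (g : (Fin r → ℝ) → ℝ) (X : ℤ → ι → Ω → ℝ) : ℤ → ι → Ω → ℝ :=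
  fun t i ω => g (fun j : Fin r => X (t - (j : ℕ)) i ω)

end LocStat

end

/-! Write the row as a weighted sum `∑ t, w t * Y t` with `w t = K ((t/n - u)/b) / √(n b)`.
Decompose `H(v, F_t)` into increments of conditional expectations given the innovations
from time `t - k` on. By coupling, the increment of lag `k` has `L²` norm at most the dependence
measure `δ k`, and increments of equal lag at different times are orthogonal. Hence the norm of a
weighted centred sum is at most `√(∑ t, w t ^ 2) * ∑ k, δ k`, uniformly in `n`. This bound lets one
replace `X̃_t(t/n)` by `X̃_t(u)` (the lag-`k` increments of the difference are dominated both by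
`2 δ k` and by a power of the bandwidth), and then `H(u, ·)` by a bounded functional of finitely
many innovations. Sums of the latter over separated blocks are independent, so characteristic
functions can be compared with the Gaussian ones; the kernel autocorrelations `∑ t, w t * w (t + h)`
tend to `∫ K²`, which identifies the variance. A Hölder estimate transfers the hypotheses from `X`
with exponent `q (M + 1)` to the lagged transform `g(X_t, …, X_{t-r+1})` with exponent `q`. -/

open scoped RealInnerProductSpace

noncomputable section

namespace LocStat

/-! ### Martingale-type decompositions in a Hilbert space -/

lemma summable_prod_mul_add {d : ℕ → ℝ} (hd0 : ∀ k, 0 ≤ d k) (hd : Summable d) :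
    Summable fun p : ℕ × ℕ => d p.2 * d (p.2 + p.1) :=
  (hd.mul_of_nonneg hd hd0 hd0).comp_injective (i := fun p : ℕ × ℕ => (p.2, p.2 + p.1))
    fun p p' h => by
      simp only [Prod.mk.injEq] at h
      exact Prod.ext (by lia) h.1

section Hilbert

variable {E : Type*} [NormedAddCommGroup E] [InnerProductSpace ℝ E]

/-- A decreasing family of orthogonal projections indexed by `ℤ`. -/
structure DecreasingProjections (Pr : ℤ → E →L[ℝ] E) : Prop where
  symm : ∀ a x y, ⟪Pr a x, y⟫ = ⟪x, Pr a y⟫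
  comp : ∀ a b x, Pr a (Pr b x) = Pr (max a b) x

/-- The increment `Pr a - Pr (a + 1)` of a family of projections. -/
def increment (Pr : ℤ → E →L[ℝ] E) (a : ℤ) : E →L[ℝ] E := Pr a - Pr (a + 1)

/-- The part of a vector that is orthogonal to the range of `Pr (t + 1)`. For the projections on
the innovations after a given time and a functional of the innovations up to time `t`, this
subtracts the mean. -/
def center (Pr : ℤ → E →L[ℝ] E) (t : ℤ) : E →L[ℝ] E := ContinuousLinearMap.id ℝ E - Pr (t + 1)

/-- A vector recovered from its projections as the index tends to `-∞`. -/
def Exhausted (Pr : ℤ → E →L[ℝ] E) (y : E) : Prop :=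
  ∀ t : ℤ, Tendsto (fun m : ℕ => Pr (t - m) y) atTop (𝓝 y)

variable {Pr : ℤ → E →L[ℝ] E}

lemma increment_apply (a : ℤ) (x : E) : increment Pr a x = Pr a x - Pr (a + 1) x := rfl

lemma center_apply (t : ℤ) (x : E) : center Pr t x = x - Pr (t + 1) x := rfl

lemma Exhausted.sub {x y : E} (hx : Exhausted Pr x) (hy : Exhausted Pr y) :
    Exhausted Pr (x - y) := fun t => by
  simpa only [map_sub] using (hx t).sub (hy t)

lemma sum_range_increment (t : ℤ) (x : E) (m : ℕ) :
    ∑ k ∈ Finset.range m, increment Pr (t - k) x = Pr (t + 1 - m) x - Pr (t + 1) x := by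
  induction m with
  | zero => simp
  | succ m ih =>
    have e : t + 1 - ((m + 1 : ℕ) : ℤ) = t - m := by push_cast; ring
    rw [Finset.sum_range_succ, ih, increment_apply, e, show t - (m : ℤ) + 1 = t + 1 - m by ring]
    abel

lemma Exhausted.tendsto_sum_increment {x : E} (hx : Exhausted Pr x) (t : ℤ) :
    Tendsto (fun m : ℕ => ∑ k ∈ Finset.range m, increment Pr (t - k) x) atTop
      (𝓝 (center Pr t x)) := by
  simpa only [sum_range_increment, center_apply] using (hx (t + 1)).sub_const _

namespace DecreasingProjections

lemma inner_increment_left (h : DecreasingProjections Pr) (a : ℤ) (x y : E) :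
    ⟪increment Pr a x, y⟫ = ⟪x, increment Pr a y⟫ := by
  simp only [increment_apply, inner_sub_left, inner_sub_right, h.symm]

lemma increment_proj_of_le (h : DecreasingProjections Pr) {a b : ℤ} (hab : b ≤ a) (x : E) :
    increment Pr a (Pr b x) = increment Pr a x := by
  simp only [increment_apply, h.comp, max_eq_left hab,
    max_eq_left (hab.trans (Int.le_add_one le_rfl))]

lemma increment_proj_of_lt (h : DecreasingProjections Pr) {a b : ℤ} (hab : a < b) (x : E) :
    increment Pr a (Pr b x) = 0 := by
  simp only [increment_apply, h.comp, max_eq_right hab.le, max_eq_right (Int.add_one_le_of_lt hab),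
    sub_self]

lemma increment_increment_of_ne (h : DecreasingProjections Pr) {a b : ℤ} (hab : a ≠ b) (x : E) :
    increment Pr a (increment Pr b x) = 0 := by
  rw [increment_apply b, map_sub]
  rcases lt_or_gt_of_ne hab with hab | hab
  · rw [h.increment_proj_of_lt hab, h.increment_proj_of_lt (by lia), sub_zero]
  · rw [h.increment_proj_of_le hab.le, h.increment_proj_of_le (by lia), sub_self]

lemma increment_increment_self (h : DecreasingProjections Pr) (a : ℤ) (x : E) :
    increment Pr a (increment Pr a x) = increment Pr a x := by
  conv_lhs => rw [increment_apply (x := x), map_sub, h.increment_proj_of_le le_rfl,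
    h.increment_proj_of_lt (lt_add_one a), sub_zero]

lemma increment_center (h : DecreasingProjections Pr) (t : ℤ) (k : ℕ) (x : E) :
    increment Pr (t - k) (center Pr t x) = increment Pr (t - k) x := by
  rw [center_apply, map_sub, h.increment_proj_of_lt (by lia), sub_zero]

lemma center_proj (h : DecreasingProjections Pr) {s t : ℤ} (hst : s ≤ t + 1) (x : E) :
    center Pr t (Pr s x) = Pr s x - Pr (t + 1) x := by
  rw [center_apply, h.comp, max_eq_left hst]

lemma exhausted_proj (h : DecreasingProjections Pr) (s : ℤ) (x : E) : Exhausted Pr (Pr s x) := by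
  intro t
  refine tendsto_const_nhds.congr' ?_
  filter_upwards [eventually_ge_atTop (t - s).toNat] with m hm
  rw [h.comp, max_eq_right (by lia)]

lemma inner_increment_eq (h : DecreasingProjections Pr) (a : ℤ) (x y : E) :
    ⟪increment Pr a x, y⟫ = ⟪increment Pr a x, increment Pr a y⟫ := by
  rw [← h.inner_increment_left, h.increment_increment_self]

lemma inner_increment_increment_of_ne (h : DecreasingProjections Pr) {a b : ℤ} (hab : a ≠ b)
    (x y : E) : ⟪increment Pr a x, increment Pr b y⟫ = 0 := by
  rw [h.inner_increment_left, h.increment_increment_of_ne hab, inner_zero_right]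

lemma proj_increment (h : DecreasingProjections Pr) (a : ℤ) (x : E) :
    Pr a (increment Pr a x) = increment Pr a x := by
  rw [increment_apply, map_sub, h.comp, h.comp, max_self, max_eq_right (Int.le_add_one le_rfl)]

lemma proj_succ_increment (h : DecreasingProjections Pr) (a : ℤ) (x : E) :
    Pr (a + 1) (increment Pr a x) = 0 := by
  rw [increment_apply, map_sub, h.comp, h.comp, max_self, max_eq_left (Int.le_add_one le_rfl),
    sub_self]

lemma norm_increment_le_of_inner_eq_zero (h : DecreasingProjections Pr) {a : ℤ} {x y : E}
    (hy : ⟪increment Pr a x, y⟫ = 0) : ‖increment Pr a x‖ ≤ ‖x - y‖ := by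
  have hle : ‖increment Pr a x‖ * ‖increment Pr a x‖ ≤ ‖increment Pr a x‖ * ‖x - y‖ := by
    calc ‖increment Pr a x‖ * ‖increment Pr a x‖ = ⟪increment Pr a x, x - y⟫ := by
          rw [inner_sub_right, hy, sub_zero, h.inner_increment_eq,
            real_inner_self_eq_norm_mul_norm]
      _ ≤ ‖increment Pr a x‖ * ‖x - y‖ := real_inner_le_norm _ _
  rcases (norm_nonneg (increment Pr a x)).eq_or_lt with h0 | h0
  · exact h0 ▸ norm_nonneg _
  · exact le_of_mul_le_mul_left hle h0

lemma norm_increment_le (h : DecreasingProjections Pr) (a : ℤ) (x : E) :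
    ‖increment Pr a x‖ ≤ ‖x‖ := by
  simpa using h.norm_increment_le_of_inner_eq_zero (inner_zero_right (increment Pr a x))

lemma norm_sq_sum_increment (h : DecreasingProjections Pr) (T : Finset ℤ) (w : ℤ → ℝ) (x : ℤ → E)
    (k : ℤ) :
    ‖∑ t ∈ T, w t • increment Pr (t - k) (x t)‖ ^ 2
      = ∑ t ∈ T, w t ^ 2 * ‖increment Pr (t - k) (x t)‖ ^ 2 := by
  rw [← real_inner_self_eq_norm_sq, sum_inner]
  refine Finset.sum_congr rfl fun s hs => ?_
  rw [inner_sum, Finset.sum_eq_single_of_mem s hs]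
  · rw [real_inner_smul_left, real_inner_smul_right, real_inner_self_eq_norm_sq]; ring
  · intro t _ hts
    rw [real_inner_smul_left, real_inner_smul_right,
      h.inner_increment_increment_of_ne (by lia), mul_zero, mul_zero]

/- The increments with the same lag `k` are orthogonal for different times, so the triangle
inequality is needed only over the lags. -/
lemma norm_sum_smul_center_le (h : DecreasingProjections Pr) {T : Finset ℤ} {w : ℤ → ℝ}
    {x : ℤ → E} (hx : ∀ t ∈ T, Exhausted Pr (x t)) {B : ℕ → ℝ} (hB0 : ∀ k, 0 ≤ B k)
    (hB : Summable B)
    (hle : ∀ k : ℕ, ∑ t ∈ T, w t ^ 2 * ‖increment Pr (t - k) (x t)‖ ^ 2 ≤ B k ^ 2) :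
    ‖∑ t ∈ T, w t • center Pr t (x t)‖ ≤ ∑' k, B k := by
  have hlim : Tendsto
      (fun m : ℕ => ∑ t ∈ T, w t • ∑ k ∈ Finset.range m, increment Pr (t - k) (x t))
      atTop (𝓝 (∑ t ∈ T, w t • center Pr t (x t))) :=
    tendsto_finsetSum _ fun t ht => ((hx t ht).tendsto_sum_increment t).const_smul _
  refine le_of_tendsto hlim.norm (Eventually.of_forall fun m => ?_)
  simp_rw [Finset.smul_sum]
  rw [Finset.sum_comm]
  refine (norm_sum_le _ _).trans ((Finset.sum_le_sum fun k _ => ?_).trans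
    (hB.sum_le_tsum _ fun k _ => hB0 k))
  refine le_of_sq_le_sq ?_ (hB0 k)
  rw [h.norm_sq_sum_increment T w x k]
  exact hle k

lemma norm_sum_smul_center_le_sqrt_mul_tsum (h : DecreasingProjections Pr) {T : Finset ℤ}
    {w : ℤ → ℝ} {x : ℤ → E} (hx : ∀ t ∈ T, Exhausted Pr (x t)) {C : ℝ} (hC : ∑ t ∈ T, w t ^ 2 ≤ C)
    {c : ℕ → ℝ} (hc0 : ∀ k, 0 ≤ c k) (hc : Summable c)
    (hle : ∀ t ∈ T, w t ≠ 0 → ∀ k : ℕ, ‖increment Pr (t - k) (x t)‖ ≤ c k) :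
    ‖∑ t ∈ T, w t • center Pr t (x t)‖ ≤ √C * ∑' k, c k := by
  have hC0 : 0 ≤ C := (Finset.sum_nonneg fun t _ => sq_nonneg (w t)).trans hC
  rw [← tsum_mul_left]
  refine h.norm_sum_smul_center_le hx (fun k => mul_nonneg (Real.sqrt_nonneg _) (hc0 k))
    (hc.mul_left _) fun k => ?_
  calc ∑ t ∈ T, w t ^ 2 * ‖increment Pr (t - k) (x t)‖ ^ 2
      ≤ ∑ t ∈ T, w t ^ 2 * c k ^ 2 := Finset.sum_le_sum fun t ht => by
        rcases eq_or_ne (w t) 0 with h0 | h0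
        · simp [h0]
        · gcongr
          exact hle t ht h0 k
    _ = (∑ t ∈ T, w t ^ 2) * c k ^ 2 := (Finset.sum_mul ..).symm
    _ ≤ C * c k ^ 2 := by gcongr
    _ = (√C * c k) ^ 2 := by rw [mul_pow, Real.sq_sqrt hC0]

lemma abs_inner_center_le (h : DecreasingProjections Pr) {d : ℕ → ℝ} (hd : Summable d) {s : ℤ}
    {j : ℕ} {x y : E} (hx : Exhausted Pr x) (hdx : ∀ k : ℕ, ‖increment Pr (s - k) x‖ ≤ d k)
    (hdy : ∀ k : ℕ, ‖increment Pr (s + j - k) y‖ ≤ d k) :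
    |⟪center Pr s x, center Pr (s + j) y⟫| ≤ ∑' k, d k * d (k + j) := by
  have hd0 : ∀ k, 0 ≤ d k := fun k => (norm_nonneg _).trans (hdx k)
  refine le_of_tendsto ((hx.tendsto_sum_increment s).inner (𝕜 := ℝ)
    (tendsto_const_nhds (x := center Pr (s + j) y))).abs (Eventually.of_forall fun m => ?_)
  rw [sum_inner]
  refine (Finset.abs_sum_le_sum_abs _ _).trans ((Finset.sum_le_sum fun k _ => ?_).trans
    (((summable_prod_mul_add hd0 hd).prod_factor j).sum_le_tsum _
      fun k _ => mul_nonneg (hd0 _) (hd0 _)))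
  have e : s - (k : ℤ) = s + j - ((k + j : ℕ) : ℤ) := by push_cast; ring
  calc |⟪increment Pr (s - k) x, center Pr (s + j) y⟫|
      = |⟪increment Pr (s - k) x, increment Pr (s + j - ((k + j : ℕ) : ℤ)) y⟫| := by
        rw [h.inner_increment_eq, e, h.increment_center]
    _ ≤ ‖increment Pr (s - k) x‖ * ‖increment Pr (s + j - ((k + j : ℕ) : ℤ)) y‖ :=
        abs_real_inner_le_norm _ _
    _ ≤ d k * d (k + j) := mul_le_mul (hdx k) (hdy _) (norm_nonneg _) (hd0 k)

lemma summable_inner_center (h : DecreasingProjections Pr) {d : ℕ → ℝ} (hd : Summable d)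
    {x : ℤ → E} (hx : ∀ t, Exhausted Pr (x t))
    (hdx : ∀ t (k : ℕ), ‖increment Pr (t - k) (x t)‖ ≤ d k) :
    Summable fun t : ℤ => ⟪center Pr 0 (x 0), center Pr t (x t)⟫ := by
  have hsum := (summable_prod_mul_add (fun k => (norm_nonneg _).trans (hdx 0 k)) hd).prod
  refine Summable.of_nat_of_neg ?_ ?_ <;> refine .of_norm_bounded hsum fun n => ?_
  · simpa using h.abs_inner_center_le hd (hx 0) (hdx 0) (j := n) (hdy := by simpa using hdx n)
  · rw [real_inner_comm]
    simpa using h.abs_inner_center_le hd (hx (-n)) (hdx (-n)) (j := n)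
      (hdy := by simpa using hdx 0)

end DecreasingProjections

end Hilbert

/-! ### Conditional expectations and independent σ-algebras -/

section SigmaAlgebra

lemma sup_eq_generateFrom_inter {Ω : Type*} (m₁ m₂ : MeasurableSpace Ω) :
    m₁ ⊔ m₂ = MeasurableSpace.generateFrom
      {s | ∃ A B, MeasurableSet[m₁] A ∧ MeasurableSet[m₂] B ∧ s = A ∩ B} := by
  apply le_antisymm
  · refine sup_le ?_ ?_
    · exact fun A hA => MeasurableSpace.measurableSet_generateFrom
        ⟨A, Set.univ, hA, MeasurableSet.univ, (Set.inter_univ A).symm⟩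
    · exact fun B hB => MeasurableSpace.measurableSet_generateFrom
        ⟨Set.univ, B, MeasurableSet.univ, hB, (Set.univ_inter B).symm⟩
  · refine MeasurableSpace.generateFrom_le ?_
    rintro s ⟨A, B, hA, hB, rfl⟩
    exact MeasurableSet.inter ((le_sup_left : m₁ ≤ m₁ ⊔ m₂) A hA)
      ((le_sup_right : m₂ ≤ m₁ ⊔ m₂) B hB)

lemma isPiSystem_inter {Ω : Type*} (m₁ m₂ : MeasurableSpace Ω) :
    IsPiSystem {s | ∃ A B, MeasurableSet[m₁] A ∧ MeasurableSet[m₂] B ∧ s = A ∩ B} := by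
  rintro s ⟨A, B, hA, hB, rfl⟩ s' ⟨A', B', hA', hB', rfl⟩ _
  exact ⟨A ∩ A', B ∩ B', hA.inter hA', hB.inter hB', Set.inter_inter_inter_comm A B A' B'⟩

variable {Ω : Type*} {m₁ m₂ m₃ m₀ : MeasurableSpace Ω} {P : Measure Ω} [IsProbabilityMeasure P]

lemma indep_sup_of_indep_sup (h₁ : m₁ ≤ m₀) (h₂ : m₂ ≤ m₀) (h₃ : m₃ ≤ m₀)
    (h : Indep m₁ m₂ P) (h' : Indep (m₁ ⊔ m₂) m₃ P) : Indep m₁ (m₂ ⊔ m₃) P := by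
  refine IndepSets.indep h₁ (sup_le h₂ h₃) m₁.isPiSystem_measurableSet (isPiSystem_inter m₂ m₃)
    (@MeasurableSpace.generateFrom_measurableSet _ m₁).symm (sup_eq_generateFrom_inter m₂ m₃) ?_
  rw [IndepSets_iff]
  rintro A _ (hA : MeasurableSet[m₁] A) ⟨B, C, hB, hC, rfl⟩
  rw [Indep_iff] at h h'
  have hB' : MeasurableSet[m₁ ⊔ m₂] B := (le_sup_right : m₂ ≤ m₁ ⊔ m₂) B hB
  have hAB : MeasurableSet[m₁ ⊔ m₂] (A ∩ B) :=
    MeasurableSet.inter ((le_sup_left : m₁ ≤ m₁ ⊔ m₂) A hA) hB'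
  rw [← Set.inter_assoc, h' _ _ hAB hC, h' _ _ hB' hC, h _ _ hA hB, mul_assoc]

variable {F : Type*} [NormedAddCommGroup F] [NormedSpace ℝ F] [CompleteSpace F]

lemma setIntegral_inter_of_indep (h₁ : m₁ ≤ m₀) (h₂ : m₂ ≤ m₀) (hind : Indep m₁ m₂ P)
    {f : Ω → F} (hf : StronglyMeasurable[m₁] f) (hint : Integrable f P) {A B : Set Ω}
    (hA : MeasurableSet[m₁] A) (hB : MeasurableSet[m₂] B) :
    ∫ ω in A ∩ B, f ω ∂P = P.real B • ∫ ω in A, f ω ∂P := by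
  have hcond : ∫ ω in B, (P[A.indicator f | m₂]) ω ∂P = ∫ ω in B, A.indicator f ω ∂P :=
    setIntegral_condExp h₂ (hint.indicator (h₁ A hA)) hB
  rw [setIntegral_congr_ae (h₂ B hB)
      ((condExp_indep_eq h₁ h₂ (hf.indicator hA) hind).mono fun ω hω _ => hω), setIntegral_const,
    integral_indicator (h₁ A hA), setIntegral_indicator (h₁ A hA)] at hcond
  rw [Set.inter_comm, ← hcond]

lemma condExp_sup_eq_of_indep {mf : MeasurableSpace Ω} (h₁ : m₁ ≤ mf) (hmf : mf ≤ m₀)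
    (h₂ : m₂ ≤ m₀) (hind : Indep mf m₂ P) {f : Ω → F} (hf : StronglyMeasurable[mf] f)
    (hint : Integrable f P) : P[f | m₁ ⊔ m₂] =ᵐ[P] P[f | m₁] := by
  have hle : m₁ ⊔ m₂ ≤ m₀ := sup_le (h₁.trans hmf) h₂
  have hg : Integrable (P[f | m₁]) P := integrable_condExp
  have hgm : StronglyMeasurable[m₁ ⊔ m₂] (P[f | m₁]) := stronglyMeasurable_condExp.mono le_sup_left
  symm
  refine ae_eq_condExp_of_forall_setIntegral_eq hle hint (fun s _ _ => hg.integrableOn) ?_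
    hgm.aestronglyMeasurable
  intro s hs _
  induction s, hs using MeasurableSpace.induction_on_inter (sup_eq_generateFrom_inter m₁ m₂)
    (isPiSystem_inter m₁ m₂) with
  | empty => simp
  | basic s hs =>
    obtain ⟨A, B, hA, hB, rfl⟩ := hs
    rw [setIntegral_inter_of_indep (h₁.trans hmf) h₂ (indep_of_indep_of_le_left hind h₁)
        stronglyMeasurable_condExp hg hA hB,
      setIntegral_inter_of_indep hmf h₂ hind hf hint (h₁ A hA) hB,
      setIntegral_condExp (h₁.trans hmf) hint hA]
  | compl s hs ih =>
    rw [setIntegral_compl (hle s hs) hg, setIntegral_compl (hle s hs) hint,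
      ih (measure_lt_top _ _), integral_condExp (h₁.trans hmf)]
  | iUnion s hd hs ih =>
    rw [integral_iUnion (fun n => hle _ (hs n)) hd hg.integrableOn,
      integral_iUnion (fun n => hle _ (hs n)) hd hint.integrableOn]
    exact tsum_congr fun n => ih n (measure_lt_top _ _)

end SigmaAlgebra

section L2Projection

variable {Ω : Type*} {m m' m₀ : MeasurableSpace Ω} {P : Measure Ω}

/-- Conditional expectation with respect to `m` as an operator on `L²(P)`. -/
def condProj (P : Measure Ω) (hm : m ≤ m₀) : Lp ℝ 2 P →L[ℝ] Lp ℝ 2 P :=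
  (lpMeas ℝ ℝ m 2 P).subtypeL ∘L condExpL2 ℝ ℝ hm

lemma inner_condProj_left (hm : m ≤ m₀) (x y : Lp ℝ 2 P) :
    ⟪condProj P hm x, y⟫ = ⟪x, condProj P hm y⟫ :=
  inner_condExpL2_left_eq_right hm

lemma aestronglyMeasurable_condProj (hm : m ≤ m₀) (x : Lp ℝ 2 P) :
    AEStronglyMeasurable[m] (condProj P hm x) P :=
  aestronglyMeasurable_condExpL2 hm x

variable [IsFiniteMeasure P]

lemma condProj_toLp_ae_eq (hm : m ≤ m₀) {f : Ω → ℝ} (hf : MemLp f 2 P) :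
    (condProj P hm (hf.toLp f) : Ω → ℝ) =ᵐ[P] P[f | m] :=
  hf.condExpL2_ae_eq_condExp (𝕜 := ℝ) hm

lemma condProj_ae_eq (hm : m ≤ m₀) (x : Lp ℝ 2 P) :
    (condProj P hm x : Ω → ℝ) =ᵐ[P] P[(x : Ω → ℝ) | m] := by
  have := condProj_toLp_ae_eq hm (Lp.memLp x)
  rwa [Lp.toLp_coeFn] at this

lemma condProj_eq_self (hm : m ≤ m₀) {x : Lp ℝ 2 P} (hx : AEStronglyMeasurable[m] x P) :
    condProj P hm x = x :=
  Lp.ext ((condProj_ae_eq hm x).trans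
    (condExp_of_aestronglyMeasurable' hm hx ((Lp.memLp x).integrable one_le_two)))

lemma condProj_condProj_of_le (hm : m ≤ m') (hm' : m' ≤ m₀) (x : Lp ℝ 2 P) :
    condProj P hm' (condProj P (hm.trans hm') x) = condProj P (hm.trans hm') x :=
  condProj_eq_self hm' ((aestronglyMeasurable_condProj _ x).mono hm)

lemma condProj_condProj_of_ge (hm : m ≤ m') (hm' : m' ≤ m₀) (x : Lp ℝ 2 P) :
    condProj P (hm.trans hm') (condProj P hm' x) = condProj P (hm.trans hm') x := by
  refine ext_inner_right ℝ fun y => ?_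
  rw [inner_condProj_left, inner_condProj_left, condProj_condProj_of_le hm hm',
    ← inner_condProj_left]

lemma condProj_sup_eq_of_indep [IsProbabilityMeasure P] {m₁ m₂ mf : MeasurableSpace Ω}
    (h₁ : m₁ ≤ mf) (hmf : mf ≤ m₀) (h₂ : m₂ ≤ m₀) (hind : Indep mf m₂ P) {x : Lp ℝ 2 P}
    (hx : AEStronglyMeasurable[mf] x P) :
    condProj P (sup_le (h₁.trans hmf) h₂) x = condProj P (h₁.trans hmf) x := by
  obtain ⟨g, hg, hxg⟩ := hx
  refine Lp.ext ?_
  calc (condProj P (sup_le (h₁.trans hmf) h₂) x : Ω → ℝ)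
      =ᵐ[P] P[x | m₁ ⊔ m₂] := condProj_ae_eq _ x
    _ =ᵐ[P] P[g | m₁ ⊔ m₂] := condExp_congr_ae hxg
    _ =ᵐ[P] P[g | m₁] := condExp_sup_eq_of_indep h₁ hmf h₂ hind hg
        (((Lp.memLp x).integrable one_le_two).congr hxg)
    _ =ᵐ[P] P[x | m₁] := condExp_congr_ae hxg.symm
    _ =ᵐ[P] condProj P (h₁.trans hmf) x := (condProj_ae_eq _ x).symm

/- The orthogonal projections onto an increasing sequence of subspaces converge in norm; the
almost sure convergence in Lévy's upward theorem identifies the limit. -/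
lemma tendsto_condProj_of_measurable_iSup {ℱ : Filtration ℕ m₀} {f : Ω → ℝ} (hf : MemLp f 2 P)
    (hmeas : StronglyMeasurable[⨆ n, ℱ n] f) :
    Tendsto (fun n => condProj P (ℱ.le n) (hf.toLp f)) atTop (𝓝 (hf.toLp f)) := by
  have : ∀ n, Fact (ℱ n ≤ m₀) := fun n => ⟨ℱ.le n⟩
  have hmono : Monotone fun n => lpMeas ℝ ℝ (ℱ n) 2 P := by
    intro i j hij x hx
    rw [mem_lpMeas_iff_aestronglyMeasurable] at hx ⊢
    exact hx.mono (ℱ.mono hij)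
  have : (⨆ n, lpMeas ℝ ℝ (ℱ n) 2 P).topologicalClosure.HasOrthogonalProjection :=
    have : CompleteSpace (⨆ n, lpMeas ℝ ℝ (ℱ n) 2 P).topologicalClosure :=
      (Submodule.isClosed_topologicalClosure _).completeSpace_coe
    inferInstance
  obtain ⟨y, hy⟩ : ∃ y, Tendsto (fun n => condProj P (ℱ.le n) (hf.toLp f)) atTop (𝓝 y) :=
    ⟨_, Submodule.starProjection_tendsto_closure_iSup (fun n => lpMeas ℝ ℝ (ℱ n) 2 P) hmono
      (hf.toLp f)⟩
  have hlim : TendstoInMeasure P (fun n => (condProj P (ℱ.le n) (hf.toLp f) : Ω → ℝ)) atTop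
      (hf.toLp f) :=
    (tendstoInMeasure_of_tendsto_ae
      (fun n => (stronglyMeasurable_condExp.mono (ℱ.le n)).aestronglyMeasurable)
      ((hf.integrable one_le_two).tendsto_ae_condExp hmeas)).congr
        (fun n => (condProj_toLp_ae_eq (ℱ.le n) hf).symm) hf.coeFn_toLp.symm
  rwa [Lp.ext (tendstoInMeasure_ae_unique (tendstoInMeasure_of_tendsto_Lp hy) hlim)] at hy

end L2Projection

section Innovation

variable {Ω : Type*} {ε ε' : ℤ → Ω → ℝ}

/-- The σ-algebra generated by the innovations with index in `S`. -/
@[reducible] def sigmaOf (ε : ℤ → Ω → ℝ) (S : Set ℤ) : MeasurableSpace Ω :=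
  ⨆ i ∈ S, MeasurableSpace.comap (ε i) inferInstance

lemma sigmaOf_mono {S T : Set ℤ} (h : S ⊆ T) : sigmaOf ε S ≤ sigmaOf ε T :=
  biSup_mono fun _ hi => h hi

lemma sigmaOf_union (S T : Set ℤ) : sigmaOf ε (S ∪ T) = sigmaOf ε S ⊔ sigmaOf ε T :=
  iSup_union

lemma measurable_sigmaOf {S : Set ℤ} {i : ℤ} (hi : i ∈ S) : Measurable[sigmaOf ε S] (ε i) :=
  (comap_measurable (ε i)).mono
    (le_iSup₂_of_le (f := fun i (_ : i ∈ S) => MeasurableSpace.comap (ε i) inferInstance)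
      i hi le_rfl) le_rfl

lemma measurable_past (t : ℤ) : Measurable[sigmaOf ε (Set.Iic t)] (past ε t) :=
  @measurable_pi_lambda _ _ _ (sigmaOf ε (Set.Iic t)) _ _ fun _ => measurable_sigmaOf (by simp)

lemma measurable_coupledPast (t a : ℤ) :
    Measurable[sigmaOf ε (Set.Ici (a + 1)) ⊔ (sigmaOf ε (Set.Iio a) ⊔
      MeasurableSpace.comap (ε' a) inferInstance)] (coupledPast ε ε' t a) := by
  refine @measurable_pi_lambda _ _ _ (_) _ _ fun j => ?_
  rcases lt_trichotomy (t - j) a with h | h | h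
  · simp only [coupledPast, h.ne, if_false]
    exact (measurable_sigmaOf (S := Set.Iio a) h).mono (le_sup_of_le_right le_sup_left) le_rfl
  · simp only [coupledPast, h, if_true]
    exact (comap_measurable (ε' a)).mono (le_sup_of_le_right le_sup_right) le_rfl
  · simp only [coupledPast, h.ne', if_false]
    exact (measurable_sigmaOf (S := Set.Ici (a + 1)) (Int.add_one_le_of_lt h)).mono
      le_sup_left le_rfl

variable [m₀ : MeasurableSpace Ω] {P : Measure Ω}

lemma sigmaOf_le (hε : ∀ t, Measurable (ε t)) (S : Set ℤ) : sigmaOf ε S ≤ m₀ :=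
  iSup₂_le fun i _ => (hε i).comap_le

namespace Innovations

lemma indep_sigmaOf (hε : Innovations P ε ε') {S T : Set ℤ} (h : Disjoint S T) :
    Indep (sigmaOf ε S) (sigmaOf ε T) P :=
  indep_iSup_of_disjoint (fun i => (hε.measurable i).comap_le) hε.indep.iIndep h

lemma sigmaOf_sup_copy_le (hε : Innovations P ε ε') (S : Set ℤ) (a : ℤ) :
    sigmaOf ε S ⊔ MeasurableSpace.comap (ε' a) inferInstance ≤ m₀ :=
  sup_le (sigmaOf_le hε.measurable S) (hε.measurable_copy a).comap_le

lemma indep_sigmaOf_sup_copy [IsProbabilityMeasure P] (hε : Innovations P ε ε') {S T : Set ℤ}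
    (h : Disjoint S T) (a : ℤ) :
    Indep (sigmaOf ε S) (sigmaOf ε T ⊔ MeasurableSpace.comap (ε' a) inferInstance) P := by
  refine indep_sup_of_indep_sup (sigmaOf_le hε.measurable S) (sigmaOf_le hε.measurable T)
    (hε.measurable_copy a).comap_le (hε.indep_sigmaOf h) ?_
  rw [← sigmaOf_union]
  have hcopy : Indep (MeasurableSpace.comap (ε' a) inferInstance)
      (MeasurableSpace.comap (fun ω t => ε t ω) inferInstance) P := hε.indep_copy a
  refine (indep_of_indep_of_le_right hcopy (iSup₂_le fun i _ => ?_)).symm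
  have hi : ε i = (fun x : ℤ → ℝ => x i) ∘ fun ω t => ε t ω := rfl
  rw [hi, ← MeasurableSpace.comap_comp]
  exact MeasurableSpace.comap_mono (measurable_pi_apply i).comap_le

end Innovations

/-- The projection onto the square integrable functionals of the innovations from time `a` on. -/
def futureProj (P : Measure Ω) (hε : ∀ t, Measurable (ε t)) (a : ℤ) :
    Lp ℝ 2 P →L[ℝ] Lp ℝ 2 P :=
  condProj P (sigmaOf_le hε (Set.Ici a))

lemma decreasingProjections_futureProj [IsFiniteMeasure P] (hε : ∀ t, Measurable (ε t)) :
    DecreasingProjections (futureProj P hε) where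
  symm a x y := inner_condProj_left _ x y
  comp a b x := by
    rcases le_total a b with h | h
    · rw [max_eq_right h]
      exact condProj_condProj_of_le (sigmaOf_mono (Set.Ici_subset_Ici.2 h)) _ x
    · rw [max_eq_left h]
      exact condProj_condProj_of_ge (sigmaOf_mono (Set.Ici_subset_Ici.2 h)) _ x

lemma exhausted_futureProj [IsFiniteMeasure P] (hε : ∀ t, Measurable (ε t)) {S : Set ℤ}
    {f : Ω → ℝ} (hf : Measurable[sigmaOf ε S] f) (hf2 : MemLp f 2 P) :
    Exhausted (futureProj P hε) (hf2.toLp f) := by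
  intro t
  let ℱ : Filtration ℕ m₀ :=
    { seq := fun m => sigmaOf ε (Set.Ici (t - m))
      mono' := fun i j hij => sigmaOf_mono (Set.Ici_subset_Ici.2 (by lia))
      le' := fun m => sigmaOf_le hε _ }
  have hle : sigmaOf ε S ≤ ⨆ m, ℱ m := iSup₂_le fun i _ => by
    have hi : i ∈ Set.Ici (t - ((t - i).toNat : ℤ)) := by rw [Set.mem_Ici]; lia
    exact (measurable_sigmaOf hi).comap_le.trans (le_iSup (fun m => ℱ m) (t - i).toNat)
  exact tendsto_condProj_of_measurable_iSup (ℱ := ℱ) hf2 (hf.mono hle le_rfl).stronglyMeasurable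

variable [IsProbabilityMeasure P]

namespace Innovations

lemma futureProj_succ_ae_eq (hε : Innovations P ε ε') {t : ℤ} {f : Ω → ℝ}
    (hf : Measurable[sigmaOf ε (Set.Iic t)] f) (hf2 : MemLp f 2 P) :
    (futureProj P hε.measurable (t + 1) (hf2.toLp f) : Ω → ℝ) =ᵐ[P] fun _ => ∫ ω, f ω ∂P :=
  (condProj_toLp_ae_eq _ hf2).trans (condExp_indep_eq (sigmaOf_le hε.measurable (Set.Iic t))
    (sigmaOf_le hε.measurable _) hf.stronglyMeasurable
    (hε.indep_sigmaOf ((Set.Iic_disjoint_Ioi le_rfl).mono_right fun _ hi =>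
      Int.lt_of_add_one_le hi)))

lemma center_toLp_ae_eq (hε : Innovations P ε ε') {t : ℤ} {f : Ω → ℝ}
    (hf : Measurable[sigmaOf ε (Set.Iic t)] f) (hf2 : MemLp f 2 P) :
    (center (futureProj P hε.measurable) t (hf2.toLp f) : Ω → ℝ)
      =ᵐ[P] fun ω => f ω - ∫ ω', f ω' ∂P := by
  rw [center_apply]
  filter_upwards [Lp.coeFn_sub (hf2.toLp f) (futureProj P hε.measurable (t + 1) (hf2.toLp f)),
    hf2.coeFn_toLp, hε.futureProj_succ_ae_eq hf hf2] with ω h1 h2 h3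
  rw [h1, Pi.sub_apply, h2, h3]

lemma condExp_Ici_eq_Icc (hε : Innovations P ε ε') {s t : ℤ} (hst : s ≤ t + 1) {f : Ω → ℝ}
    (hf : Measurable[sigmaOf ε (Set.Iic t)] f) (hint : Integrable f P) :
    P[f | sigmaOf ε (Set.Ici s)] =ᵐ[P] P[f | sigmaOf ε (Set.Icc s t)] := by
  have hunion : Set.Ici s = Set.Icc s t ∪ Set.Ioi t := by
    ext i; simp only [Set.mem_Ici, Set.mem_union, Set.mem_Icc, Set.mem_Ioi]; lia
  rw [hunion, sigmaOf_union]
  exact condExp_sup_eq_of_indep (sigmaOf_mono Set.Icc_subset_Iic_self)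
    (sigmaOf_le hε.measurable _) (sigmaOf_le hε.measurable _)
    (hε.indep_sigmaOf (Set.Iic_disjoint_Ioi le_rfl)) hf.stronglyMeasurable hint

lemma center_futureProj_toLp_ae_eq (hε : Innovations P ε ε') {s t : ℤ} (hst : s ≤ t + 1)
    {f : Ω → ℝ} (hf : Measurable[sigmaOf ε (Set.Iic t)] f) (hf2 : MemLp f 2 P) :
    (center (futureProj P hε.measurable) t (futureProj P hε.measurable s (hf2.toLp f)) : Ω → ℝ)
      =ᵐ[P] fun ω => (P[f | sigmaOf ε (Set.Icc s t)]) ω - ∫ ω', f ω' ∂P := by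
  rw [(decreasingProjections_futureProj hε.measurable).center_proj hst]
  filter_upwards [Lp.coeFn_sub (futureProj P hε.measurable s (hf2.toLp f))
      (futureProj P hε.measurable (t + 1) (hf2.toLp f)),
    condProj_toLp_ae_eq (sigmaOf_le hε.measurable (Set.Ici s)) hf2,
    hε.condExp_Ici_eq_Icc hst hf (hf2.integrable one_le_two),
    hε.futureProj_succ_ae_eq hf hf2] with ω h1 h2 h3 h4
  rw [h1, Pi.sub_apply, h4, ← h3, ← h2]
  rfl

lemma condProj_sup_copy_increment (hε : Innovations P ε ε') (a : ℤ) (x : Lp ℝ 2 P) :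
    condProj P (sup_le (sigmaOf_le hε.measurable (Set.Ici (a + 1)))
      (hε.sigmaOf_sup_copy_le (Set.Iio a) a)) (increment (futureProj P hε.measurable) a x) = 0 := by
  have hD := decreasingProjections_futureProj (P := P) hε.measurable
  have hmeas : AEStronglyMeasurable[sigmaOf ε (Set.Ici a)]
      (increment (futureProj P hε.measurable) a x) P := by
    rw [← hD.proj_increment]
    exact aestronglyMeasurable_condProj _ _
  exact (condProj_sup_eq_of_indep (sigmaOf_mono (Set.Ici_subset_Ici.2 (Int.le_add_one le_rfl)))
    (sigmaOf_le hε.measurable (Set.Ici a)) (hε.sigmaOf_sup_copy_le (Set.Iio a) a)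
    (hε.indep_sigmaOf_sup_copy (Set.Iio_disjoint_Ici le_rfl).symm a) hmeas).trans
    (hD.proj_succ_increment a x)

lemma inner_increment_coupledPast (hε : Innovations P ε ε') {H : (ℕ → ℝ) → ℝ} (hH : Measurable H)
    (t a : ℤ) (x : Lp ℝ 2 P) (hc : MemLp (fun ω => H (coupledPast ε ε' t a ω)) 2 P) :
    ⟪increment (futureProj P hε.measurable) a x, hc.toLp _⟫ = 0 := by
  have hle := sup_le (sigmaOf_le hε.measurable (Set.Ici (a + 1)))
    (hε.sigmaOf_sup_copy_le (Set.Iio a) a)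
  have hself : condProj P hle (hc.toLp _) = hc.toLp _ :=
    condProj_eq_self hle ((hH.comp (measurable_coupledPast t a)).stronglyMeasurable
      |>.aestronglyMeasurable.congr hc.coeFn_toLp.symm)
  rw [← hself, ← inner_condProj_left, hε.condProj_sup_copy_increment, inner_zero_left]

lemma norm_increment_le_of_coupled (hε : Innovations P ε ε') {H : (ℕ → ℝ) → ℝ} (hH : Measurable H)
    {t a : ℤ} (hf : MemLp (fun ω => H (past ε t ω)) 2 P)
    (hfc : MemLp (fun ω => H (past ε t ω) - H (coupledPast ε ε' t a ω)) 2 P) :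
    ‖increment (futureProj P hε.measurable) a (hf.toLp _)‖
      ≤ (eLpNorm (fun ω => H (past ε t ω) - H (coupledPast ε ε' t a ω)) 2 P).toReal := by
  have hc : MemLp (fun ω => H (coupledPast ε ε' t a ω)) 2 P :=
    (hf.sub hfc).ae_eq (.of_forall fun ω => sub_sub_cancel _ _)
  calc ‖increment (futureProj P hε.measurable) a (hf.toLp _)‖ ≤ ‖hf.toLp _ - hc.toLp _‖ :=
        (decreasingProjections_futureProj hε.measurable).norm_increment_le_of_inner_eq_zero
          (hε.inner_increment_coupledPast hH t a _ hc)
    _ = (eLpNorm (fun ω => H (past ε t ω) - H (coupledPast ε ε' t a ω)) 2 P).toReal := by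
        rw [← MemLp.toLp_sub, Lp.norm_toLp]
        rfl

end Innovations

end Innovation

/-! ### Quantitative comparison of characteristic functions -/

section CharFun

variable {Ω : Type*} [MeasurableSpace Ω] {P : Measure Ω}

lemma charFun_map_eq {S : Ω → ℝ} (hS : AEMeasurable S P) (s : ℝ) :
    charFun (P.map S) s = ∫ ω, Complex.exp ((s * S ω : ℝ) * Complex.I) ∂P := by
  rw [charFun_apply_real, integral_map hS (by fun_prop)]
  simp

lemma integrable_exp_mul_I [IsFiniteMeasure P] {S : Ω → ℝ} (hS : AEMeasurable S P) (s : ℝ) :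
    Integrable (fun ω => Complex.exp ((s * S ω : ℝ) * Complex.I)) P :=
  Integrable.of_bound (AEMeasurable.aestronglyMeasurable (by fun_prop)) 1
    (.of_forall fun ω => (Complex.norm_exp_ofReal_mul_I _).le)

lemma norm_exp_mul_I_sub_exp_mul_I_le (x y : ℝ) :
    ‖Complex.exp (x * Complex.I) - Complex.exp (y * Complex.I)‖ ≤ |x - y| := by
  have e : Complex.exp (x * Complex.I) - Complex.exp (y * Complex.I)
      = Complex.exp (y * Complex.I) * (Complex.exp (Complex.I * (x - y : ℝ)) - 1) := by
    rw [mul_sub, ← Complex.exp_add, mul_one]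
    congr 2
    push_cast; ring
  rw [e, norm_mul, Complex.norm_exp_ofReal_mul_I, one_mul]
  exact Real.norm_exp_I_mul_ofReal_sub_one_le

lemma norm_exp_mul_I_sub_taylor_le {x : ℝ} (hx : |x| ≤ 1) :
    ‖Complex.exp (x * Complex.I) - (1 + x * Complex.I - (x : ℂ) ^ 2 / 2)‖ ≤ |x| ^ 3 / 2 := by
  have hn : ‖(x * Complex.I : ℂ)‖ = |x| := by simp
  have h := Complex.exp_bound (x := x * Complex.I) (by rw [hn]; exact hx) (n := 3) (by norm_num)
  have e : ∑ m ∈ Finset.range 3, (x * Complex.I : ℂ) ^ m / (m.factorial : ℂ)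
      = 1 + x * Complex.I - (x : ℂ) ^ 2 / 2 := by
    simp [Finset.sum_range_succ, mul_pow, Nat.factorial]
    ring
  rw [hn, e] at h
  refine h.trans ?_
  have h3 : 0 ≤ |x| ^ 3 := by positivity
  norm_num [Nat.factorial]
  nlinarith

lemma integral_add_sq_of_indepFun {S U : Ω → ℝ} (hS : MemLp S 2 P) (hU : MemLp U 2 P)
    (hSU : IndepFun S U P) (h0 : ∫ ω, U ω ∂P = 0) :
    ∫ ω, (S ω + U ω) ^ 2 ∂P = ∫ ω, S ω ^ 2 ∂P + ∫ ω, U ω ^ 2 ∂P := by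
  have hmul : ∫ ω, S ω * U ω ∂P = 0 := by
    have := hSU.integral_mul_eq_mul_integral hS.aestronglyMeasurable hU.aestronglyMeasurable
    rwa [h0, mul_zero] at this
  have hint : Integrable (fun ω => 2 * (S ω * U ω)) P := (hS.integrable_mul hU).const_mul 2
  have hint' : Integrable (fun ω => S ω ^ 2 + 2 * (S ω * U ω)) P := hS.integrable_sq.add hint
  simp_rw [add_sq, mul_assoc]
  rw [integral_add hint' hU.integrable_sq, integral_add hS.integrable_sq hint,
    integral_const_mul, hmul]
  ring

lemma norm_mul_sub_mul_le {R : Type*} [NormedRing R] {a b a' b' : R} (ha' : ‖a'‖ ≤ 1)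
    (hb : ‖b‖ ≤ 1) : ‖a * b - a' * b'‖ ≤ ‖a - a'‖ + ‖b - b'‖ := by
  calc ‖a * b - a' * b'‖ = ‖(a - a') * b + a' * (b - b')‖ := by congr 1; noncomm_ring
    _ ≤ ‖a - a'‖ * ‖b‖ + ‖a'‖ * ‖b - b'‖ :=
        (norm_add_le _ _).trans (add_le_add (norm_mul_le _ _) (norm_mul_le _ _))
    _ ≤ ‖a - a'‖ * 1 + 1 * ‖b - b'‖ := by gcongr
    _ = _ := by rw [mul_one, one_mul]

variable [IsProbabilityMeasure P]

lemma norm_charFun_map_sub_le {S T : Ω → ℝ} (hS : MemLp S 2 P) (hT : MemLp T 2 P) (s : ℝ) :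
    ‖charFun (P.map S) s - charFun (P.map T) s‖ ≤ |s| * ‖hS.toLp S - hT.toLp T‖ := by
  have hSm := hS.aestronglyMeasurable.aemeasurable
  have hTm := hT.aestronglyMeasurable.aemeasurable
  have hd : MemLp (S - T) 2 P := hS.sub hT
  have hpt : ∀ ω, ‖Complex.exp ((s * S ω : ℝ) * Complex.I)
      - Complex.exp ((s * T ω : ℝ) * Complex.I)‖ ≤ |s| * ‖(S - T) ω‖ := fun ω => by
    refine (norm_exp_mul_I_sub_exp_mul_I_le _ _).trans_eq ?_
    rw [← mul_sub, abs_mul, Pi.sub_apply, Real.norm_eq_abs]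
  have hL1 : ∫ ω, ‖(S - T) ω‖ ∂P ≤ ‖hS.toLp S - hT.toLp T‖ := by
    rw [← MemLp.toLp_sub, Lp.norm_toLp, integral_norm_eq_lintegral_enorm hd.aestronglyMeasurable,
      ← eLpNorm_one_eq_lintegral_enorm]
    exact ENNReal.toReal_mono hd.eLpNorm_ne_top
      (eLpNorm_le_eLpNorm_of_exponent_le one_le_two hd.aestronglyMeasurable)
  rw [charFun_map_eq hSm, charFun_map_eq hTm,
    ← integral_sub (integrable_exp_mul_I hSm s) (integrable_exp_mul_I hTm s)]
  calc _ ≤ ∫ ω, |s| * ‖(S - T) ω‖ ∂P := norm_integral_le_of_norm_le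
          ((hd.integrable one_le_two).norm.const_mul _) (.of_forall hpt)
    _ = |s| * ∫ ω, ‖(S - T) ω‖ ∂P := integral_const_mul _ _
    _ ≤ _ := by gcongr

lemma norm_charFun_map_sub_taylor_le {U : Ω → ℝ} (hU : AEMeasurable U P) {η s : ℝ}
    (hb : ∀ᵐ ω ∂P, |U ω| ≤ η) (h0 : ∫ ω, U ω ∂P = 0) (hs : |s| * η ≤ 1) :
    ‖charFun (P.map U) s - (1 - s ^ 2 / 2 * ∫ ω, U ω ^ 2 ∂P : ℝ)‖
      ≤ |s| ^ 3 * η / 2 * ∫ ω, U ω ^ 2 ∂P := by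
  have hU2 : MemLp U 2 P := MemLp.of_bound hU.aestronglyMeasurable η hb
  have hlin : Integrable (fun ω => 1 + ((s * U ω : ℝ) : ℂ) * Complex.I) P :=
    (integrable_const _).add (((hU2.integrable one_le_two).const_mul s).ofReal.mul_const _)
  have hquad : Integrable (fun ω => ((s * U ω : ℝ) : ℂ) ^ 2 / 2) P := by
    refine (((hU2.integrable_sq.const_mul (s ^ 2)).ofReal (𝕜 := ℂ)).div_const 2).congr
      (.of_forall fun ω => ?_)
    simp [mul_pow]
  have htaylor : ((1 - s ^ 2 / 2 * ∫ ω, U ω ^ 2 ∂P : ℝ) : ℂ)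
      = ∫ ω, (1 + (s * U ω : ℝ) * Complex.I - ((s * U ω : ℝ) : ℂ) ^ 2 / 2) ∂P := by
    have hsq : ∫ ω, ((s * U ω : ℝ) : ℂ) ^ 2 ∂P = ((s ^ 2 * ∫ ω, U ω ^ 2 ∂P : ℝ) : ℂ) := by
      rw [← integral_const_mul, ← integral_complex_ofReal]
      simp only [mul_pow, Complex.ofReal_mul, Complex.ofReal_pow]
    rw [integral_sub hlin hquad, integral_add (integrable_const _)
      (((hU2.integrable one_le_two).const_mul s).ofReal.mul_const _), integral_mul_const,
      integral_div, integral_complex_ofReal, integral_const_mul, h0, hsq]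
    simp
    ring
  have hpoly : Integrable
      (fun ω => 1 + ((s * U ω : ℝ) : ℂ) * Complex.I - ((s * U ω : ℝ) : ℂ) ^ 2 / 2) P :=
    hlin.sub hquad
  rw [charFun_map_eq hU, htaylor, ← integral_sub (integrable_exp_mul_I hU s) hpoly]
  refine (norm_integral_le_of_norm_le (hU2.integrable_sq.const_mul (|s| ^ 3 * η / 2)) ?_).trans_eq
    (integral_const_mul _ _)
  filter_upwards [hb] with ω hω
  have hx : |s * U ω| ≤ 1 := by
    rw [abs_mul]
    exact (mul_le_mul_of_nonneg_left hω (abs_nonneg s)).trans hs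
  calc _ ≤ |s * U ω| ^ 3 / 2 := norm_exp_mul_I_sub_taylor_le hx
    _ = |s| ^ 3 / 2 * U ω ^ 2 * |U ω| := by rw [abs_mul, mul_pow, pow_succ |U ω| 2, sq_abs]; ring
    _ ≤ |s| ^ 3 / 2 * U ω ^ 2 * η := by gcongr
    _ = _ := by ring

lemma norm_charFun_map_sub_exp_le {U : Ω → ℝ} (hU : AEMeasurable U P) {η s : ℝ}
    (hb : ∀ᵐ ω ∂P, |U ω| ≤ η) (h0 : ∫ ω, U ω ∂P = 0) (hs : |s| * η ≤ 1) :
    ‖charFun (P.map U) s - Real.exp (-(s ^ 2 / 2 * ∫ ω, U ω ^ 2 ∂P))‖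
      ≤ |s| ^ 3 * η * ∫ ω, U ω ^ 2 ∂P := by
  set v := ∫ ω, U ω ^ 2 ∂P
  have hη : 0 ≤ η := by
    obtain ⟨ω, hω⟩ := hb.exists
    exact (abs_nonneg _).trans hω
  have hvη : v ≤ η ^ 2 := by
    have hint := (MemLp.of_bound hU.aestronglyMeasurable η hb).integrable_sq
    simpa using integral_mono_ae hint (integrable_const (η ^ 2)) (hb.mono fun ω hω => by
      simpa using pow_le_pow_left₀ (abs_nonneg _) hω 2)
  have hsη : 0 ≤ |s| * η := by positivity
  have hsv : s ^ 2 * v ≤ |s| * η := by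
    calc s ^ 2 * v ≤ s ^ 2 * η ^ 2 := by gcongr
      _ = (|s| * η) ^ 2 := by rw [mul_pow, sq_abs]
      _ ≤ |s| * η := pow_le_of_le_one hsη hs two_ne_zero
  have hsv0 : 0 ≤ s ^ 2 * v := mul_nonneg (sq_nonneg s) (integral_nonneg fun ω => sq_nonneg _)
  have hexp : ‖((1 - s ^ 2 / 2 * v : ℝ) : ℂ) - Real.exp (-(s ^ 2 / 2 * v))‖
      ≤ |s| ^ 3 * η / 2 * v := by
    rw [← Complex.ofReal_sub, Complex.norm_real, Real.norm_eq_abs, abs_sub_comm]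
    calc _ = |Real.exp (-(s ^ 2 / 2 * v)) - 1 - -(s ^ 2 / 2 * v)| := by congr 1; ring
      _ ≤ (-(s ^ 2 / 2 * v)) ^ 2 :=
          Real.abs_exp_sub_one_sub_id_le (by rw [abs_neg, abs_of_nonneg] <;> linarith)
      _ = s ^ 2 * v / 4 * (s ^ 2 * v) := by ring
      _ ≤ s ^ 2 * v / 2 * (|s| * η) := by gcongr; norm_num
      _ = _ := by rw [pow_succ |s| 2, sq_abs]; ring
  calc _ ≤ ‖charFun (P.map U) s - (1 - s ^ 2 / 2 * v : ℝ)‖ +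
        ‖((1 - s ^ 2 / 2 * v : ℝ) : ℂ) - Real.exp (-(s ^ 2 / 2 * v))‖ :=
        norm_sub_le_norm_sub_add_norm_sub _ _ _
    _ ≤ |s| ^ 3 * η / 2 * v + |s| ^ 3 * η / 2 * v :=
        add_le_add (norm_charFun_map_sub_taylor_le hU hb h0 hs) hexp
    _ = _ := by ring

lemma norm_charFun_sum_sub_exp_le {ι : Type*} (J : Finset ι) {U : ι → Ω → ℝ}
    (hU : ∀ j, AEMeasurable (U j) P) {η s : ℝ}
    (hb : ∀ j, ∀ᵐ ω ∂P, |U j ω| ≤ η) (h0 : ∀ j, ∫ ω, U j ω ∂P = 0) (hs : |s| * η ≤ 1)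
    (hind : ∀ (I : Finset ι) (j : ι), j ∉ I → IndepFun (fun ω => ∑ i ∈ I, U i ω) (U j) P) :
    ‖charFun (P.map fun ω => ∑ j ∈ J, U j ω) s
        - Real.exp (-(s ^ 2 / 2 * ∫ ω, (∑ j ∈ J, U j ω) ^ 2 ∂P))‖
      ≤ |s| ^ 3 * η * ∫ ω, (∑ j ∈ J, U j ω) ^ 2 ∂P := by
  classical
  induction J using Finset.induction_on with
  | empty => simp
  | insert j J hj ih =>
    have hU2 : ∀ j, MemLp (U j) 2 P := fun j =>
      MemLp.of_bound (hU j).aestronglyMeasurable η (hb j)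
    set S : Ω → ℝ := fun ω => ∑ i ∈ J, U i ω
    have hS2 : MemLp S 2 P := memLp_finsetSum J fun i _ => hU2 i
    have hi : IndepFun S (U j) P := hind J j hj
    have hsum : (fun ω => ∑ i ∈ insert j J, U i ω) = S + U j := by
      ext ω; rw [Finset.sum_insert hj, add_comm, Pi.add_apply]
    have hvar : ∫ ω, (∑ i ∈ insert j J, U i ω) ^ 2 ∂P
        = ∫ ω, S ω ^ 2 ∂P + ∫ ω, U j ω ^ 2 ∂P := by
      rw [← integral_add_sq_of_indepFun hS2 (hU2 j) hi (h0 j)]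
      exact congrArg (fun f : Ω → ℝ => ∫ ω, f ω ^ 2 ∂P) hsum
    rw [hvar, hsum, hi.charFun_map_add_eq_mul hS2.aestronglyMeasurable.aemeasurable (hU j),
      Pi.mul_apply, mul_add (s ^ 2 / 2), neg_add, Real.exp_add, Complex.ofReal_mul]
    refine (norm_mul_sub_mul_le ?_ ?_).trans ((add_le_add ih
      (norm_charFun_map_sub_exp_le (hU j) (hb j) (h0 j) hs)).trans_eq (mul_add _ _ _).symm)
    · rw [Complex.norm_real, Real.norm_eq_abs, Real.abs_exp, Real.exp_le_one_iff, neg_nonpos]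
      have : 0 ≤ ∫ ω, S ω ^ 2 ∂P := integral_nonneg fun ω => sq_nonneg _
      positivity
    · have := Measure.isProbabilityMeasure_map (hU j)
      exact norm_charFun_le_one s

end CharFun

section Block

variable {Ω : Type*} [m₀ : MeasurableSpace Ω] {P : Measure Ω}

lemma norm_sq_eq_integral (x : Lp ℝ 2 P) : ‖x‖ ^ 2 = ∫ ω, x ω ^ 2 ∂P := by
  rw [← real_inner_self_eq_norm_sq, L2.inner_def]
  refine integral_congr_ae (.of_forall fun ω => ?_)
  simp

lemma coeFn_sum_smul {ι : Type*} (T : Finset ι) (w : ι → ℝ) (x : ι → Lp ℝ 2 P) {g : ι → Ω → ℝ}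
    (hg : ∀ t ∈ T, x t =ᵐ[P] g t) :
    (∑ t ∈ T, w t • x t : Lp ℝ 2 P) =ᵐ[P] fun ω => ∑ t ∈ T, w t * g t ω := by
  have hsmul : ∀ᵐ ω ∂P, ∀ t ∈ T, (w t • x t : Lp ℝ 2 P) ω = w t * g t ω :=
    (ae_ball_iff T.countable_toSet).2 fun t ht => by
      filter_upwards [Lp.coeFn_smul (w t) (x t), hg t ht] with ω h₁ h₂
      rw [h₁, Pi.smul_apply, h₂, smul_eq_mul]
  filter_upwards [Lp.coeFn_finsetSum T fun t => w t • x t, hsmul] with ω h₁ h₂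
  rw [h₁, Finset.sum_apply]
  exact Finset.sum_congr rfl h₂

variable {ε ε' : ℤ → Ω → ℝ} {W : ℤ → Ω → ℝ} {L : ℕ}

/-- The centered projection of `W t` on the innovations up to time `t` of the block of length `L`
that contains `t`. Block `j` consists of the times `i` with `i / L = j`. -/
def blockTerm (P : Measure Ω) (ε W : ℤ → Ω → ℝ) (L : ℕ) (t : ℤ) (ω : Ω) : ℝ :=
  (P[W t | sigmaOf ε (Set.Icc (L * (t / L)) t)]) ω - ∫ ω', W t ω' ∂P

/-- The weighted sum of the terms `blockTerm P ε W L t` over the times `t ∈ T` in block `j`. -/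
def blockSum (P : Measure Ω) (ε W : ℤ → Ω → ℝ) (L : ℕ) (T : Finset ℤ) (w : ℤ → ℝ) (j : ℤ)
    (ω : Ω) : ℝ :=
  ∑ t ∈ T with t / L = j, w t * blockTerm P ε W L t ω

lemma measurable_blockTerm (hL : 0 < L) (t : ℤ) :
    Measurable[sigmaOf ε {i | i / L = t / L}] (blockTerm P ε W L t) := by
  have hL' : (0 : ℤ) < L := by exact_mod_cast hL
  have hsub : Set.Icc (L * (t / L) : ℤ) t ⊆ {i | i / L = t / L} := fun i hi =>
    (Int.ediv_le_ediv hL' hi.2).antisymm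
      ((Int.le_ediv_iff_mul_le hL').2 ((mul_comm _ _).trans_le hi.1))
  exact (stronglyMeasurable_condExp.measurable.sub_const _).mono (sigmaOf_mono hsub) le_rfl

lemma measurable_blockSum (hL : 0 < L) (T : Finset ℤ) (w : ℤ → ℝ) (j : ℤ) :
    Measurable[sigmaOf ε {i | i / L = j}] (blockSum P ε W L T w j) := by
  refine Finset.measurable_sum _ fun t ht => ?_
  rw [← (Finset.mem_filter.1 ht).2]
  exact (measurable_blockTerm hL t).const_mul _

lemma card_filter_ediv_eq_le (hL : 0 < L) (T : Finset ℤ) (j : ℤ) :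
    (T.filter fun t => t / (L : ℤ) = j).card ≤ L := by
  have hL' : (0 : ℤ) < L := by exact_mod_cast hL
  have hsub : (T.filter fun t => t / (L : ℤ) = j) ⊆ Finset.Ico (L * j) (L * j + L) := by
    intro t ht
    rw [Finset.mem_Ico, ← (Finset.mem_filter.1 ht).2]
    exact ⟨Int.mul_ediv_self_le hL'.ne', Int.lt_mul_ediv_self_add hL'⟩
  simpa using Finset.card_le_card hsub

lemma indepFun_sum_blockSum (hε : Innovations P ε ε') (hL : 0 < L) (T : Finset ℤ) (w : ℤ → ℝ)
    {I : Finset ℤ} {j : ℤ} (hj : j ∉ I) :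
    IndepFun (fun ω => ∑ i ∈ I, blockSum P ε W L T w i ω) (blockSum P ε W L T w j) P := by
  have hsum : Measurable[sigmaOf ε {k | k / L ∈ I}]
      fun ω => ∑ i ∈ I, blockSum P ε W L T w i ω := by
    refine Finset.measurable_sum _ fun i hi => ?_
    refine (measurable_blockSum hL T w i).mono (sigmaOf_mono ?_) le_rfl
    rintro k rfl
    exact hi
  have hdisj : Disjoint {k : ℤ | k / L ∈ I} {k : ℤ | k / L = j} :=
    Set.disjoint_left.2 fun k hk hkj => hj (hkj ▸ hk)
  exact indep_of_indep_of_le (hε.indep_sigmaOf hdisj) hsum.comap_le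
    (measurable_blockSum hL T w j).comap_le

variable [IsProbabilityMeasure P]

lemma abs_blockTerm_le {c : ℝ} (hc : ∀ t ω, |W t ω| ≤ c) (t : ℤ) :
    ∀ᵐ ω ∂P, |blockTerm P ε W L t ω| ≤ 2 * c := by
  have hmean : |∫ ω, W t ω ∂P| ≤ c := by
    simpa using norm_integral_le_of_norm_le_const (μ := P) (f := W t) (C := c)
      (.of_forall fun ω => hc t ω)
  filter_upwards [ae_bdd_abs_condExp_of_ae_bdd_abs (m := sigmaOf ε (Set.Icc (L * (t / L)) t))
    (f := W t) (μ := P) (.of_forall fun ω => hc t ω)] with ω hω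
  linarith [abs_sub ((P[W t | sigmaOf ε (Set.Icc (L * (t / L)) t)]) ω) (∫ ω, W t ω ∂P),
    show |(P[W t | sigmaOf ε (Set.Icc (L * (t / L)) t)]) ω| ≤ c from hω,
    show |blockTerm P ε W L t ω| = |(P[W t | sigmaOf ε (Set.Icc (L * (t / L)) t)]) ω
      - ∫ ω, W t ω ∂P| from rfl]

lemma abs_blockSum_le (hL : 0 < L) {c : ℝ} (hc : ∀ t ω, |W t ω| ≤ c) (T : Finset ℤ) {w : ℤ → ℝ}
    {e : ℝ} (hw : ∀ t, |w t| ≤ e) (j : ℤ) :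
    ∀ᵐ ω ∂P, |blockSum P ε W L T w j ω| ≤ L * (e * (2 * c)) := by
  have he : 0 ≤ e := (abs_nonneg _).trans (hw 0)
  filter_upwards [ae_all_iff.2 fun t => abs_blockTerm_le (P := P) (ε := ε) (L := L) hc t] with ω hω
  have hc0 : 0 ≤ 2 * c := (abs_nonneg _).trans (hω 0)
  calc |blockSum P ε W L T w j ω|
      ≤ ∑ t ∈ T with t / L = j, |w t * blockTerm P ε W L t ω| := Finset.abs_sum_le_sum_abs _ _
    _ ≤ (T.filter fun t => t / (L : ℤ) = j).card • (e * (2 * c)) := by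
        refine Finset.sum_le_card_nsmul _ _ _ fun t _ => ?_
        rw [abs_mul]
        exact mul_le_mul (hw t) (hω t) (abs_nonneg _) he
    _ ≤ L * (e * (2 * c)) := by
        rw [nsmul_eq_mul]
        gcongr
        exact card_filter_ediv_eq_le hL T j

lemma integral_blockSum (hε : ∀ t, Measurable (ε t)) (T : Finset ℤ) (w : ℤ → ℝ) (j : ℤ) :
    ∫ ω, blockSum P ε W L T w j ω ∂P = 0 := by
  have hint : ∀ t, Integrable (blockTerm P ε W L t) P := fun t =>
    integrable_condExp.sub (integrable_const _)
  have hmean : ∀ t, ∫ ω, blockTerm P ε W L t ω ∂P = 0 := fun t => by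
    unfold blockTerm
    rw [integral_sub integrable_condExp (integrable_const _), integral_condExp (sigmaOf_le hε _)]
    simp
  unfold blockSum
  rw [integral_finsetSum _ fun t _ => (hint t).const_mul _]
  exact Finset.sum_eq_zero fun t _ => by rw [integral_const_mul, hmean, mul_zero]

lemma sum_smul_center_block_ae_eq (hε : Innovations P ε ε')
    (hW : ∀ t, Measurable[sigmaOf ε (Set.Iic t)] (W t)) (hW2 : ∀ t, MemLp (W t) 2 P) (hL : 0 < L)
    (T : Finset ℤ) (w : ℤ → ℝ) :
    (∑ t ∈ T, w t • center (futureProj P hε.measurable) t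
      (futureProj P hε.measurable (L * (t / L)) ((hW2 t).toLp (W t))) : Lp ℝ 2 P) =ᵐ[P]
      fun ω => ∑ j ∈ T.image (fun t => t / (L : ℤ)), blockSum P ε W L T w j ω := by
  have hle : ∀ t : ℤ, (L : ℤ) * (t / L) ≤ t + 1 := fun t =>
    (Int.mul_ediv_self_le (by lia)).trans (by lia)
  refine (coeFn_sum_smul T w _ (g := blockTerm P ε W L) fun t _ =>
    hε.center_futureProj_toLp_ae_eq (hle t) (hW t) (hW2 t)).trans (.of_forall fun ω => ?_)
  exact (Finset.sum_fiberwise_of_maps_to (fun t ht => Finset.mem_image_of_mem _ ht) _).symm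

lemma norm_charFun_block_sub_exp_le (hε : Innovations P ε ε')
    (hW : ∀ t, Measurable[sigmaOf ε (Set.Iic t)] (W t)) {c : ℝ} (hc : ∀ t ω, |W t ω| ≤ c)
    (hW2 : ∀ t, MemLp (W t) 2 P) (hL : 0 < L) (T : Finset ℤ) {w : ℤ → ℝ} {e : ℝ}
    (hw : ∀ t, |w t| ≤ e) {s : ℝ} (hs : |s| * (L * (e * (2 * c))) ≤ 1) {S : Lp ℝ 2 P}
    (hS : S = ∑ t ∈ T, w t • center (futureProj P hε.measurable) t
      (futureProj P hε.measurable (L * (t / L)) ((hW2 t).toLp (W t)))) :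
    ‖charFun (P.map S) s - Real.exp (-(s ^ 2 / 2 * ‖S‖ ^ 2))‖
      ≤ |s| ^ 3 * (L * (e * (2 * c))) * ‖S‖ ^ 2 := by
  have hSae := sum_smul_center_block_ae_eq hε hW hW2 hL T w
  rw [← hS] at hSae
  have hnorm : ‖S‖ ^ 2 =
      ∫ ω, (∑ j ∈ T.image (fun t => t / (L : ℤ)), blockSum P ε W L T w j ω) ^ 2 ∂P := by
    rw [norm_sq_eq_integral]
    exact integral_congr_ae (hSae.mono fun ω hω => by simp only [hω])
  rw [hnorm, Measure.map_congr hSae]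
  exact norm_charFun_sum_sub_exp_le _
    (fun j => ((measurable_blockSum hL T w j).mono (sigmaOf_le hε.measurable _)
      le_rfl).aemeasurable)
    (abs_blockSum_le hL hc T hw) (integral_blockSum hε.measurable T w) hs
    fun _ _ => indepFun_sum_blockSum hε hL T w

end Block

/-! ### Kernel weights -/

section Kernel

lemma sum_Icc_one_int {M : Type*} [AddCommMonoid M] (f : ℤ → M) (n : ℕ) :
    ∑ t ∈ Finset.Icc (1 : ℤ) n, f t = ∑ i ∈ Finset.range n, f (i + 1) := by
  induction n with
  | zero => simp
  | succ n ih =>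
    have hinsert : Finset.Icc (1 : ℤ) ((n + 1 : ℕ) : ℤ)
        = insert ((n : ℤ) + 1) (Finset.Icc (1 : ℤ) n) := by
      ext t; simp only [Finset.mem_insert, Finset.mem_Icc]; lia
    rw [hinsert, Finset.sum_insert (by simp), ih, Finset.sum_range_succ, add_comm]

lemma sum_shift_sub_le {g : ℤ → ℝ} {V : ℝ} (hV : ∀ t, |g t| ≤ V) (n m : ℕ) :
    ∑ t ∈ Finset.Icc (1 : ℤ) n, (g (t + m) - g t) ≤ 2 * V * m := by
  induction m with
  | zero => simp
  | succ m ih =>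
    have htelescope : ∑ t ∈ Finset.Icc (1 : ℤ) n, (g (t + m + 1) - g (t + m)) ≤ 2 * V := by
      have hsum := Finset.sum_range_sub (fun i : ℕ => g (i + m + 1)) n
      calc _ = g (n + m + 1) - g ((0 : ℕ) + m + 1) := by
            rw [sum_Icc_one_int, ← hsum]
            refine Finset.sum_congr rfl fun i _ => ?_
            congr 2
            ring
        _ ≤ 2 * V := by
            linarith [(abs_le.1 (hV (n + m + 1))).2, (abs_le.1 (hV ((0 : ℕ) + m + 1))).1]
    calc _ = ∑ t ∈ Finset.Icc (1 : ℤ) n, (g (t + m + 1) - g (t + m))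
          + ∑ t ∈ Finset.Icc (1 : ℤ) n, (g (t + m) - g t) := by
          rw [← Finset.sum_add_distrib]
          refine Finset.sum_congr rfl fun t _ => ?_
          rw [Nat.cast_succ, ← add_assoc]; ring
      _ ≤ 2 * V + 2 * V * m := add_le_add htelescope ih
      _ = _ := by push_cast; ring

lemma sum_abs_shift_sub_le {g : ℤ → ℝ} (hg : Monotone g) {V : ℝ} (hV : ∀ t, |g t| ≤ V) (n : ℕ)
    (h : ℤ) : ∑ t ∈ Finset.Icc (1 : ℤ) n, |g (t + h) - g t| ≤ 2 * V * |(h : ℝ)| := by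
  obtain ⟨m, rfl | rfl⟩ := h.eq_nat_or_neg
  · refine (Finset.sum_congr rfl fun t _ => abs_of_nonneg (sub_nonneg.2 (hg (by lia)))).trans_le ?_
    simpa using sum_shift_sub_le hV n m
  · have hle := sum_shift_sub_le (g := fun t => g (t - m)) (fun t => hV _) n m
    simp only [add_sub_cancel_right] at hle
    refine (Finset.sum_congr rfl fun t _ => ?_).trans_le (hle.trans_eq (by simp))
    rw [abs_of_nonpos (sub_nonpos.2 (hg (by lia))), neg_sub]
    rfl

lemma exists_variation_bound {f : ℝ → ℝ} (hf : BoundedVariationOn f Set.univ) :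
    ∃ (v : ℝ → ℝ) (V : ℝ), (∀ x, |v x| ≤ V) ∧ ∀ x y, x ≤ y → |f y - f x| ≤ v y - v x := by
  have hfin : ∀ s, eVariationOn f s ≠ ∞ := fun s => hf.mono (Set.subset_univ s)
  refine ⟨fun x => (eVariationOn f (Set.Iic x)).toReal, (eVariationOn f Set.univ).toReal,
    fun x => ?_, fun x y hxy => ?_⟩
  · rw [abs_of_nonneg ENNReal.toReal_nonneg]
    exact ENNReal.toReal_mono (hfin _) (eVariationOn.mono f (Set.subset_univ _))
  · have hunion := eVariationOn.union f (isGreatest_Iic (a := x)) (isLeast_Icc hxy)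
    rw [Set.Iic_union_Icc_eq_Iic hxy] at hunion
    simp only [hunion]
    rw [ENNReal.toReal_add (hfin _) (hfin _), add_sub_cancel_left, ← Real.dist_eq, dist_edist]
    exact ENNReal.toReal_mono (hfin _)
      (eVariationOn.edist_le f (Set.right_mem_Icc.2 hxy) (Set.left_mem_Icc.2 hxy))

section Oscillation

variable {f v : ℝ → ℝ}

lemma monotone_of_abs_sub_le (h : ∀ x y, x ≤ y → |f y - f x| ≤ v y - v x) : Monotone v :=
  fun x y hxy => sub_nonneg.1 ((abs_nonneg _).trans (h x y hxy))

lemma monotone_sub_of_abs_sub_le (h : ∀ x y, x ≤ y → |f y - f x| ≤ v y - v x) :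
    Monotone fun x => v x - f x := fun x y hxy => by
  have := (abs_le.1 (h x y hxy)).2
  simp only
  linarith

lemma measurable_of_abs_sub_le (h : ∀ x y, x ≤ y → |f y - f x| ≤ v y - v x) : Measurable f := by
  have e : f = v - fun x => v x - f x := by ext x; simp
  rw [e]
  exact (monotone_of_abs_sub_le h).measurable.sub (monotone_sub_of_abs_sub_le h).measurable

lemma intervalIntegrable_of_abs_sub_le (h : ∀ x y, x ≤ y → |f y - f x| ≤ v y - v x) (a b : ℝ) :
    IntervalIntegrable f volume a b := by
  simpa only [sub_sub_cancel] using
    (monotone_of_abs_sub_le h).intervalIntegrable.sub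
      (monotone_sub_of_abs_sub_le h).intervalIntegrable

lemma abs_mul_sub_intervalIntegral_le (hf : ∀ x y, x ≤ y → |f y - f x| ≤ v y - v x) {a b : ℝ}
    (hab : a ≤ b) : |(b - a) * f b - ∫ x in a..b, f x| ≤ (b - a) * (v b - v a) := by
  have e : (b - a) * f b - ∫ x in a..b, f x = ∫ x in a..b, (f b - f x) := by
    rw [intervalIntegral.integral_sub intervalIntegrable_const
      (intervalIntegrable_of_abs_sub_le hf a b), intervalIntegral.integral_const, smul_eq_mul]
  rw [e, ← Real.norm_eq_abs]
  refine (intervalIntegral.norm_integral_le_of_norm_le_const (C := v b - v a)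
    fun x hx => ?_).trans_eq (by rw [abs_of_nonneg (sub_nonneg.2 hab), mul_comm])
  rw [Set.uIoc_of_le hab] at hx
  rw [Real.norm_eq_abs]
  linarith [hf x b hx.2, monotone_of_abs_sub_le hf hx.1.le]

lemma abs_riemann_sum_sub_integral_le {V : ℝ} (hV : ∀ x, |v x| ≤ V)
    (hf : ∀ x y, x ≤ y → |f y - f x| ≤ v y - v x) {x₀ h : ℝ} (hh : 0 ≤ h) {N : ℕ}
    (hsupp : Function.support f ⊆ Set.Ioc x₀ (x₀ + N * h)) :
    |h * ∑ i ∈ Finset.range N, f (x₀ + (i + 1 : ℕ) * h) - ∫ x, f x| ≤ h * (2 * V) := by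
  let p : ℕ → ℝ := fun i => x₀ + i * h
  have hp : ∀ i, p (i + 1) - p i = h := fun i => by simp only [p]; push_cast; ring
  have hint : ∫ x, f x = ∑ i ∈ Finset.range N, ∫ x in p i..p (i + 1), f x := by
    rw [intervalIntegral.sum_integral_adjacent_intervals
      fun i _ => intervalIntegrable_of_abs_sub_le hf _ _,
      intervalIntegral.integral_eq_integral_of_support_subset]
    simpa [p] using hsupp
  rw [hint, Finset.mul_sum, ← Finset.sum_sub_distrib]
  calc _ ≤ ∑ i ∈ Finset.range N, |h * f (p (i + 1)) - ∫ x in p i..p (i + 1), f x| :=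
        Finset.abs_sum_le_sum_abs _ _
    _ ≤ ∑ i ∈ Finset.range N, h * (v (p (i + 1)) - v (p i)) := Finset.sum_le_sum fun i _ => by
        have := abs_mul_sub_intervalIntegral_le hf (sub_nonneg.1 (hh.trans_eq (hp i).symm))
        rwa [hp] at this
    _ = h * (v (p N) - v (p 0)) := by rw [← Finset.mul_sum, Finset.sum_range_sub (fun i => v (p i))]
    _ ≤ h * (2 * V) := by
        gcongr
        linarith [(abs_le.1 (hV (p N))).2, (abs_le.1 (hV (p 0))).1]

end Oscillation

lemma card_filter_emod_lt_le_mul {L : ℕ} (hL : 0 < L) (k : ℕ) {a b : ℤ} {s : Finset ℤ}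
    (hs : s ⊆ Finset.Icc a b) :
    (s.filter fun t : ℤ => t % L < k).card ≤ (b / L + 1 - a / L).toNat * min k L := by
  have hL' : (0 : ℤ) < L := by exact_mod_cast hL
  have hinj : Set.InjOn (fun t : ℤ => (t / (L : ℤ), t % (L : ℤ)))
      (s.filter fun t : ℤ => t % L < k) := by
    intro t _ t' _ h
    simp only [Prod.mk.injEq] at h
    rw [← Int.mul_ediv_add_emod t L, ← Int.mul_ediv_add_emod t' L, h.1, h.2]
  have hmap : Set.MapsTo (fun t : ℤ => (t / (L : ℤ), t % (L : ℤ)))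
      (s.filter fun t : ℤ => t % L < k)
      ((Finset.Icc (a / L) (b / L) ×ˢ Finset.Ico (0 : ℤ) (min k L : ℕ) : Finset (ℤ × ℤ))) := by
    intro t ht
    obtain ⟨hts, htk⟩ := Finset.mem_filter.1 ht
    obtain ⟨hat, htb⟩ := Finset.mem_Icc.1 (hs hts)
    rw [Finset.mem_coe, Finset.mem_product, Finset.mem_Icc, Finset.mem_Ico, Nat.cast_min]
    exact ⟨⟨Int.ediv_le_ediv hL' hat, Int.ediv_le_ediv hL' htb⟩, Int.emod_nonneg _ hL'.ne',
      lt_min htk (Int.emod_lt_of_pos t hL')⟩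
  have hcard := Finset.card_le_card_of_injOn _ hmap hinj
  rwa [Finset.card_product, Int.card_Icc, Int.card_Ico, sub_zero, Int.toNat_natCast] at hcard

lemma card_filter_emod_lt_le {L : ℕ} (hL : 0 < L) (k : ℕ) {x y : ℝ} (hxy : x ≤ y) {s : Finset ℤ}
    (hs : ∀ t ∈ s, x ≤ t ∧ (t : ℝ) ≤ y) :
    ((s.filter fun t : ℤ => t % L < k).card : ℝ) ≤ ((y - x) / L + 2) * (min k L : ℕ) := by
  have hL' : (0 : ℤ) < L := by exact_mod_cast hL
  have hLr : (0 : ℝ) < L := by exact_mod_cast hL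
  have hsub : s ⊆ Finset.Icc ⌈x⌉ ⌊y⌋ := fun t ht =>
    Finset.mem_Icc.2 ⟨Int.ceil_le.2 (hs t ht).1, Int.le_floor.2 (hs t ht).2⟩
  have hy : ((⌊y⌋ / L : ℤ) : ℝ) ≤ y / L := by
    have h : (L : ℝ) * (⌊y⌋ / L : ℤ) ≤ ⌊y⌋ := by exact_mod_cast Int.mul_ediv_self_le hL'.ne'
    rw [le_div_iff₀ hLr]
    linarith [Int.floor_le y]
  have hx : x / L - 1 ≤ ((⌈x⌉ / L : ℤ) : ℝ) := by
    have h : (⌈x⌉ : ℝ) ≤ L * (⌈x⌉ / L : ℤ) + L := by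
      exact_mod_cast (Int.lt_mul_ediv_self_add hL').le
    rw [sub_le_iff_le_add, div_le_iff₀ hLr]
    linarith [Int.le_ceil x]
  have hblocks : (((⌊y⌋ / L + 1 - ⌈x⌉ / L : ℤ).toNat : ℤ) : ℝ) ≤ (y - x) / L + 2 := by
    rw [Int.toNat_eq_max, Int.cast_max, Int.cast_zero]
    refine max_le ?_ (by have := sub_nonneg.2 hxy; positivity)
    push_cast
    rw [sub_div]
    linarith
  calc _ ≤ ((⌊y⌋ / L + 1 - ⌈x⌉ / L : ℤ).toNat : ℝ) * (min k L : ℕ) := by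
        exact_mod_cast card_filter_emod_lt_le_mul hL k hsub
    _ ≤ _ := by
        gcongr
        exact_mod_cast hblocks

end Kernel

section Weights

/-- Weights on the observation times `1, …, n` that are uniformly small, concentrate around the
rescaled time `u`, and have all lagged correlations converging to `κ`. -/
structure LocalWeights (w : ℕ → ℤ → ℝ) (κ u α : ℝ) : Prop where
  sup_tendsto : ∃ e : ℕ → ℝ, Tendsto e atTop (𝓝 0) ∧ ∀ᶠ n in atTop, ∀ t, |w n t| ≤ e n
  support : ∀ t₀ : ℤ, ∀ᶠ n : ℕ in atTop, ∀ t, w n t ≠ 0 → t₀ ≤ t ∧ t ≤ n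
  localized : ∀ η : ℝ, 0 < η → ∀ᶠ n : ℕ in atTop, ∀ t : ℤ, w n t ≠ 0 → |(t : ℝ) / n - u| ≤ η
  corr : ∀ h : ℤ,
    Tendsto (fun n : ℕ => ∑ t ∈ Finset.Icc (1 : ℤ) n, w n t * w n (t + h)) atTop (𝓝 κ)
  residue : ∃ C : ℝ, 0 ≤ C ∧ ∀ L : ℕ, 0 < L → ∀ᶠ n : ℕ in atTop, ∀ k : ℕ,
    ∑ t ∈ (Finset.Icc (1 : ℤ) n).filter (fun t : ℤ => t % L < k), w n t ^ 2
      ≤ C * min 1 ((k : ℝ) / L)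
  sum_abs : Tendsto (fun n : ℕ => (∑ t ∈ Finset.Icc (1 : ℤ) n, |w n t|) * (n : ℝ) ^ (-α))
    atTop (𝓝 0)

/-- The weight `(n b)^{-1/2} K((t/n - u)/b)` of time `t` in the local sum. -/
def kernelWeight (K : ℝ → ℝ) (b : ℕ → ℝ) (u : ℝ) (n : ℕ) (t : ℤ) : ℝ :=
  (√(n * b n))⁻¹ * K (((t : ℝ) / n - u) / b n)

variable {K : ℝ → ℝ} {b : ℕ → ℝ} {u : ℝ} {n : ℕ}

lemma pos_and_pos_of_natCast_mul_pos (hnb : 0 < n * b n) : (0 : ℝ) < n ∧ 0 < b n := by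
  have hn : (0 : ℝ) < n := n.cast_nonneg.lt_of_ne' (left_ne_zero_of_mul hnb.ne')
  exact ⟨hn, pos_of_mul_pos_right hnb hn.le⟩

lemma kernelWeight_mul_kernelWeight (hnb : 0 < n * b n) (s t : ℤ) :
    kernelWeight K b u n s * kernelWeight K b u n t
      = (n * b n)⁻¹ * (K (((s : ℝ) / n - u) / b n) * K (((t : ℝ) / n - u) / b n)) := by
  rw [kernelWeight, kernelWeight, mul_mul_mul_comm, ← mul_inv, Real.mul_self_sqrt hnb.le]

lemma abs_kernelWeight_le {B : ℝ} (hB : ∀ x, |K x| ≤ B) (t : ℤ) :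
    |kernelWeight K b u n t| ≤ B * (√(n * b n))⁻¹ := by
  rw [kernelWeight, abs_mul, abs_of_nonneg (by positivity), mul_comm]
  gcongr
  exact hB _

lemma kernelWeight_sq_le {B : ℝ} (hB : ∀ x, |K x| ≤ B) (hnb : 0 < n * b n) (t : ℤ) :
    kernelWeight K b u n t ^ 2 ≤ B ^ 2 / (n * b n) := by
  calc kernelWeight K b u n t ^ 2 = |kernelWeight K b u n t| ^ 2 := (sq_abs _).symm
    _ ≤ (B * (√(n * b n))⁻¹) ^ 2 := by
        gcongr
        exact abs_kernelWeight_le hB t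
    _ = _ := by rw [mul_pow, inv_pow, Real.sq_sqrt hnb.le, div_eq_mul_inv]

lemma abs_sub_le_of_kernelWeight_ne_zero (hK : Function.support K ⊆ Set.Icc (-(1 / 2)) (1 / 2))
    (hb : 0 < b n) {t : ℤ} (ht : kernelWeight K b u n t ≠ 0) : |(t : ℝ) / n - u| ≤ b n / 2 := by
  have hmem := hK (right_ne_zero_of_mul ht)
  rw [Set.mem_Icc, ← abs_le, abs_div, abs_of_pos hb, div_le_iff₀ hb] at hmem
  linarith

lemma card_kernelWeight_ne_zero_le (hK : Function.support K ⊆ Set.Icc (-(1 / 2)) (1 / 2))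
    (hnb : 0 < n * b n) {L : ℕ} (hL : 0 < L) (k : ℕ) :
    ((((Finset.Icc (1 : ℤ) n).filter fun t => kernelWeight K b u n t ≠ 0).filter
      fun t : ℤ => t % L < k).card : ℝ) ≤ (n * b n / L + 2) * (min k L : ℕ) := by
  obtain ⟨hn, hb⟩ := pos_and_pos_of_natCast_mul_pos hnb
  have hcard := card_filter_emod_lt_le hL k (x := n * (u - b n / 2)) (y := n * (u + b n / 2))
    (s := (Finset.Icc (1 : ℤ) n).filter fun t => kernelWeight K b u n t ≠ 0) (by linarith)
    fun t ht => by
      have hloc := abs_le.1 (abs_sub_le_of_kernelWeight_ne_zero hK hb (Finset.mem_filter.1 ht).2)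
      rw [← le_div_iff₀' hn, ← div_le_iff₀' hn]
      constructor <;> linarith [hloc.1, hloc.2]
  have e : (n : ℝ) * (u + b n / 2) - n * (u - b n / 2) = n * b n := by ring
  rwa [e] at hcard

lemma sum_kernelWeight_sq_emod_lt_le (hK : Function.support K ⊆ Set.Icc (-(1 / 2)) (1 / 2)) {B : ℝ}
    (hB : ∀ x, |K x| ≤ B) {L : ℕ} (hL : 0 < L) (hnb : L ≤ n * b n) (k : ℕ) :
    ∑ t ∈ (Finset.Icc (1 : ℤ) n).filter (fun t : ℤ => t % L < k), kernelWeight K b u n t ^ 2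
      ≤ B ^ 2 * 3 * min 1 ((k : ℝ) / L) := by
  have hLr : (0 : ℝ) < L := by exact_mod_cast hL
  have hpos : 0 < n * b n := hLr.trans_le hnb
  have hone : 1 ≤ n * b n / L := (one_le_div hLr).2 hnb
  have hmin : ((min k L : ℕ) : ℝ) = L * min 1 ((k : ℝ) / L) := by
    rw [mul_min_of_nonneg _ _ hLr.le, mul_one, mul_div_cancel₀ _ hLr.ne', min_comm, Nat.cast_min]
  calc _ = ∑ t ∈ ((Finset.Icc (1 : ℤ) n).filter fun t => kernelWeight K b u n t ≠ 0).filter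
          (fun t : ℤ => t % L < k), kernelWeight K b u n t ^ 2 := by
        rw [Finset.filter_comm]
        exact (Finset.sum_filter_of_ne fun t _ ht => by simpa using ht).symm
    _ ≤ _ * (B ^ 2 / (n * b n)) :=
        (Finset.sum_le_card_nsmul _ _ _ fun t _ => kernelWeight_sq_le hB hpos t).trans_eq
          (nsmul_eq_mul _ _)
    _ ≤ (n * b n / L + 2) * (L * min 1 ((k : ℝ) / L)) * (B ^ 2 / (n * b n)) := by
        rw [← hmin]
        gcongr
        exact card_kernelWeight_ne_zero_le hK hpos hL k
    _ ≤ (3 * (n * b n / L)) * (L * min 1 ((k : ℝ) / L)) * (B ^ 2 / (n * b n)) := by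
        gcongr
        linarith
    _ = (n * b n * (n * b n)⁻¹) * (L * (L : ℝ)⁻¹) * (B ^ 2 * 3 * min 1 ((k : ℝ) / L)) := by ring
    _ = _ := by rw [mul_inv_cancel₀ hpos.ne', mul_inv_cancel₀ hLr.ne', one_mul, one_mul]

lemma sum_abs_kernelWeight_le (hK : Function.support K ⊆ Set.Icc (-(1 / 2)) (1 / 2)) {B : ℝ}
    (hB : ∀ x, |K x| ≤ B) (hnb : 1 ≤ n * b n) :
    ∑ t ∈ Finset.Icc (1 : ℤ) n, |kernelWeight K b u n t| ≤ 3 * B * √(n * b n) := by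
  have hB0 : 0 ≤ B := (abs_nonneg _).trans (hB 0)
  have hpos : 0 < n * b n := one_pos.trans_le hnb
  have hcard : (((Finset.Icc (1 : ℤ) n).filter fun t => kernelWeight K b u n t ≠ 0).card : ℝ)
      ≤ n * b n + 2 := by
    simpa using card_kernelWeight_ne_zero_le (u := u) hK hpos one_pos 1
  calc _ = ∑ t ∈ Finset.Icc (1 : ℤ) n with kernelWeight K b u n t ≠ 0, |kernelWeight K b u n t| :=
        (Finset.sum_filter_of_ne fun t _ ht => by simpa using ht).symm
    _ ≤ _ * (B * (√(n * b n))⁻¹) :=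
        (Finset.sum_le_card_nsmul _ _ _ fun t _ => abs_kernelWeight_le hB t).trans_eq
          (nsmul_eq_mul _ _)
    _ ≤ (3 * (n * b n)) * (B * (√(n * b n))⁻¹) := by
        gcongr
        linarith
    _ = 3 * B * (√(n * b n) * √(n * b n) * (√(n * b n))⁻¹) := by
        rw [Real.mul_self_sqrt hpos.le]; ring
    _ = _ := by rw [mul_assoc √(n * b n), mul_inv_cancel₀ (Real.sqrt_pos.2 hpos).ne', mul_one]

section Correlation

variable {v : ℝ → ℝ} {V B : ℝ}

lemma abs_sum_kernelWeight_sq_sub_integral_le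
    (hK : Function.support K ⊆ Set.Icc (-(1 / 2)) (1 / 2)) (hB : ∀ x, |K x| ≤ B)
    (hV : ∀ x, |v x| ≤ V) (hKv : ∀ x y, x ≤ y → |K y - K x| ≤ v y - v x) (hnb : 0 < n * b n)
    (hu₀ : b n < 2 * u) (hu₁ : b n < 2 * (1 - u)) :
    |∑ t ∈ Finset.Icc (1 : ℤ) n, kernelWeight K b u n t ^ 2 - ∫ x, K x ^ 2|
      ≤ (n * b n)⁻¹ * (2 * (2 * B * V)) := by
  obtain ⟨hn, hb⟩ := pos_and_pos_of_natCast_mul_pos hnb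
  have hB0 : 0 ≤ B := (abs_nonneg _).trans (hB 0)
  have hosc : ∀ x y, x ≤ y → |K y ^ 2 - K x ^ 2| ≤ 2 * B * v y - 2 * B * v x := by
    intro x y hxy
    rw [sq_sub_sq, abs_mul, ← mul_sub]
    gcongr
    · linarith [abs_add_le (K y) (K x), hB y, hB x]
    · exact hKv x y hxy
  have hend : -u / b n + n * (n * b n)⁻¹ = (1 - u) / b n := by field_simp; ring
  have hsupp : (Function.support fun x => K x ^ 2)
      ⊆ Set.Ioc (-u / b n) (-u / b n + n * (n * b n)⁻¹) := by
    intro x hx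
    have hmem := hK (fun h0 => hx (by simp [h0]) : K x ≠ 0)
    rw [hend]
    exact ⟨((div_lt_iff₀ hb).2 (by linarith)).trans_le hmem.1,
      hmem.2.trans ((le_div_iff₀ hb).2 (by linarith))⟩
  have hriemann := abs_riemann_sum_sub_integral_le (V := 2 * B * V)
    (fun x => by rw [abs_mul, abs_of_nonneg (by positivity)]; gcongr; exact hV x) hosc
    (inv_nonneg.2 hnb.le) hsupp
  convert hriemann using 3
  rw [sum_Icc_one_int, Finset.mul_sum]
  refine Finset.sum_congr rfl fun i _ => ?_
  rw [sq, kernelWeight_mul_kernelWeight hnb, ← sq]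
  congr 3
  push_cast
  field_simp
  ring

lemma abs_sum_kernelWeight_mul_shift_sub_le (hB : ∀ x, |K x| ≤ B) (hV : ∀ x, |v x| ≤ V)
    (hKv : ∀ x y, x ≤ y → |K y - K x| ≤ v y - v x) (hnb : 0 < n * b n) (h : ℤ) :
    |∑ t ∈ Finset.Icc (1 : ℤ) n, kernelWeight K b u n t * kernelWeight K b u n (t + h)
        - ∑ t ∈ Finset.Icc (1 : ℤ) n, kernelWeight K b u n t ^ 2|
      ≤ (n * b n)⁻¹ * (B * (2 * V * |(h : ℝ)|)) := by
  obtain ⟨hn, hb⟩ := pos_and_pos_of_natCast_mul_pos hnb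
  have hB0 : 0 ≤ B := (abs_nonneg _).trans (hB 0)
  let x : ℤ → ℝ := fun t => ((t : ℝ) / n - u) / b n
  have hx : Monotone x := fun s t hst => by
    have : (s : ℝ) ≤ t := by exact_mod_cast hst
    simp only [x]
    gcongr
  have hKx : ∀ s t, |K (x s) - K (x t)| ≤ |v (x s) - v (x t)| := fun s t => by
    rcases le_total s t with hst | hst
    · rw [abs_sub_comm, abs_sub_comm (v _)]
      exact (hKv _ _ (hx hst)).trans (le_abs_self _)
    · exact (hKv _ _ (hx hst)).trans (le_abs_self _)
  rw [← Finset.sum_sub_distrib]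
  calc _ ≤ ∑ t ∈ Finset.Icc (1 : ℤ) n, |kernelWeight K b u n t * kernelWeight K b u n (t + h)
          - kernelWeight K b u n t ^ 2| := Finset.abs_sum_le_sum_abs _ _
    _ ≤ ∑ t ∈ Finset.Icc (1 : ℤ) n, (n * b n)⁻¹ * (B * |v (x (t + h)) - v (x t)|) := by
        refine Finset.sum_le_sum fun t _ => ?_
        rw [sq, kernelWeight_mul_kernelWeight hnb, kernelWeight_mul_kernelWeight hnb, ← mul_sub,
          ← mul_sub, abs_mul, abs_mul, abs_of_pos (inv_pos.2 hnb)]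
        exact mul_le_mul_of_nonneg_left (mul_le_mul (hB _) (hKx _ _) (abs_nonneg _) hB0)
          (inv_pos.2 hnb).le
    _ ≤ _ := by
        rw [← Finset.mul_sum, ← Finset.mul_sum]
        gcongr
        exact sum_abs_shift_sub_le ((monotone_of_abs_sub_le hKv).comp hx) (fun t => hV _) n h

lemma tendsto_sum_kernelWeight_mul_shift (hK : LocalizingKernel K) (hb : Tendsto b atTop (𝓝 0))
    (hnb : Tendsto (fun n : ℕ => (n : ℝ) * b n) atTop atTop) (hu : u ∈ Set.Ioo (0 : ℝ) 1) (h : ℤ) :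
    Tendsto (fun n : ℕ => ∑ t ∈ Finset.Icc (1 : ℤ) n,
      kernelWeight K b u n t * kernelWeight K b u n (t + h)) atTop (𝓝 (∫ x, K x ^ 2)) := by
  obtain ⟨B, hB⟩ := hK.bounded
  obtain ⟨v, V, hV, hKv⟩ := exists_variation_bound hK.boundedVariation
  have hzero : ∀ c : ℝ, Tendsto (fun n : ℕ => (n * b n)⁻¹ * c) atTop (𝓝 0) := fun c => by
    simpa using hnb.inv_tendsto_atTop.mul_const c
  have hsq : Tendsto (fun n : ℕ => ∑ t ∈ Finset.Icc (1 : ℤ) n, kernelWeight K b u n t ^ 2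
      - ∫ x, K x ^ 2) atTop (𝓝 0) := by
    refine squeeze_zero_norm' ?_ (hzero (2 * (2 * B * V)))
    filter_upwards [hnb.eventually_gt_atTop 0, hb.eventually_lt_const (mul_pos two_pos hu.1),
      hb.eventually_lt_const (mul_pos two_pos (sub_pos.2 hu.2))] with n h₁ h₂ h₃
    exact abs_sum_kernelWeight_sq_sub_integral_le hK.support_subset hB hV hKv h₁ h₂ h₃
  have hshift := squeeze_zero_norm' ((hnb.eventually_gt_atTop 0).mono fun n hn =>
    (Real.norm_eq_abs _).trans_le (abs_sum_kernelWeight_mul_shift_sub_le (u := u) hB hV hKv hn h))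
    (hzero (B * (2 * V * |(h : ℝ)|)))
  have hsub := (hshift.add hsq).congr fun n => sub_add_sub_cancel _ _ (∫ x, K x ^ 2)
  rw [zero_add] at hsub
  exact tendsto_sub_nhds_zero_iff.1 hsub

end Correlation

lemma le_and_le_of_kernelWeight_ne_zero (hK : Function.support K ⊆ Set.Icc (-(1 / 2)) (1 / 2))
    (hnb : 0 < n * b n) (hu₀ : b n < u) (hu₁ : b n < 2 * (1 - u)) {t₀ : ℤ}
    (ht₀ : t₀ ≤ n * (u / 2)) {t : ℤ} (ht : kernelWeight K b u n t ≠ 0) : t₀ ≤ t ∧ t ≤ n := by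
  obtain ⟨hn, hb⟩ := pos_and_pos_of_natCast_mul_pos hnb
  have hloc := abs_le.1 (abs_sub_le_of_kernelWeight_ne_zero hK hb ht)
  have hlower : (t₀ : ℝ) ≤ t := ht₀.trans ((le_div_iff₀' hn).1 (by linarith [hloc.1]))
  have hupper : (t : ℝ) ≤ n := (div_le_one hn).1 (by linarith [hloc.2])
  exact ⟨by exact_mod_cast hlower, by exact_mod_cast hupper⟩

lemma localWeights_kernelWeight (hK : LocalizingKernel K) {α : ℝ} (hb : Tendsto b atTop (𝓝 0))
    (hnb : Tendsto (fun n : ℕ => (n : ℝ) * b n) atTop atTop)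
    (hbα : Tendsto (fun n : ℕ => √((n : ℝ) * b n) * (n : ℝ) ^ (-α)) atTop (𝓝 0))
    (hu : u ∈ Set.Ioo (0 : ℝ) 1) :
    LocalWeights (kernelWeight K b u) (∫ x, K x ^ 2) u α := by
  obtain ⟨B, hB⟩ := hK.bounded
  have hpos : ∀ᶠ n : ℕ in atTop, 0 < n * b n := hnb.eventually_gt_atTop 0
  constructor
  case sup_tendsto =>
    exact ⟨_, by simpa using (Real.tendsto_sqrt_atTop.comp hnb).inv_tendsto_atTop.const_mul B,
      .of_forall fun n => abs_kernelWeight_le hB⟩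
  case support =>
    intro t₀
    have hnu : Tendsto (fun n : ℕ => (n : ℝ) * (u / 2)) atTop atTop :=
      tendsto_natCast_atTop_atTop.atTop_mul_const (half_pos hu.1)
    filter_upwards [hpos, hb.eventually_lt_const hu.1, hb.eventually_lt_const
      (mul_pos two_pos (sub_pos.2 hu.2)), hnu.eventually_ge_atTop (t₀ : ℝ)] with n h₁ h₂ h₃ h₄ t
    exact le_and_le_of_kernelWeight_ne_zero hK.support_subset h₁ h₂ h₃ h₄
  case localized =>
    intro η hη
    filter_upwards [hpos, hb.eventually_lt_const hη] with n h₁ h₂ t ht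
    have hbn := (pos_and_pos_of_natCast_mul_pos h₁).2
    linarith [abs_sub_le_of_kernelWeight_ne_zero hK.support_subset hbn ht]
  case corr => exact tendsto_sum_kernelWeight_mul_shift hK hb hnb hu
  case residue =>
    exact ⟨B ^ 2 * 3, by positivity, fun L hL => (hnb.eventually_ge_atTop (L : ℝ)).mono
      fun n hn => sum_kernelWeight_sq_emod_lt_le hK.support_subset hB hL hn⟩
  case sum_abs =>
    have hlim : Tendsto (fun n : ℕ => 3 * B * (√(n * b n) * (n : ℝ) ^ (-α))) atTop (𝓝 0) := by
      simpa only [mul_zero] using hbα.const_mul (3 * B)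
    refine squeeze_zero' (.of_forall fun n => by positivity) ?_ hlim
    filter_upwards [hnb.eventually_ge_atTop 1] with n hn
    rw [← mul_assoc]
    gcongr
    exact sum_abs_kernelWeight_le hK.support_subset hB hn

end Weights

section WeightedSums

variable {E : Type*} [NormedAddCommGroup E] [InnerProductSpace ℝ E]

lemma tendsto_tsum_min_zero {d : ℕ → ℝ} (hd0 : ∀ k, 0 ≤ d k) (hd : Summable d) :
    Tendsto (fun ρ : ℝ => ∑' k, min (d k) ρ) (𝓝[≥] 0) (𝓝 0) := by
  have hlim := tendsto_tsum_of_dominated_convergence (𝓕 := 𝓝[≥] (0 : ℝ))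
    (f := fun ρ k => min (d k) ρ) (g := fun _ => (0 : ℝ)) hd (fun k => ?_) ?_
  · simpa using hlim
  · have hmin : Tendsto (fun ρ : ℝ => min (d k) ρ) (𝓝 0) (𝓝 (min (d k) 0)) :=
      (continuous_const.min continuous_id).tendsto 0
    rw [min_eq_right (hd0 k)] at hmin
    exact hmin.mono_left nhdsWithin_le_nhds
  · filter_upwards [self_mem_nhdsWithin] with ρ hρ k
    rw [Real.norm_eq_abs, abs_of_nonneg (le_min (hd0 k) hρ)]
    exact min_le_left _ _

lemma tendsto_tsum_mul_sqrt_min_zero {d : ℕ → ℝ} (hd0 : ∀ k, 0 ≤ d k) (hd : Summable d) :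
    Tendsto (fun L : ℕ => ∑' k : ℕ, d k * √(min 1 ((k : ℝ) / L))) atTop (𝓝 0) := by
  have hlim := tendsto_tsum_of_dominated_convergence (𝓕 := (atTop : Filter ℕ))
    (f := fun L k => d k * √(min 1 ((k : ℝ) / L))) (g := fun _ => (0 : ℝ)) hd (fun k => ?_) ?_
  · simpa using hlim
  · have hsqrt : Tendsto (fun L : ℕ => √(min 1 ((k : ℝ) / L))) atTop (𝓝 (√(min 1 0))) :=
      (Real.continuous_sqrt.tendsto _).comp
        (tendsto_const_nhds.min (tendsto_const_div_atTop_nhds_zero_nat _))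
    simpa using hsqrt.const_mul (d k)
  · filter_upwards with L k
    rw [Real.norm_eq_abs, abs_of_nonneg (mul_nonneg (hd0 k) (Real.sqrt_nonneg _))]
    exact mul_le_of_le_one_right (hd0 k) (Real.sqrt_le_one.2 (min_le_left _ _))

lemma abs_sum_mul_shift_le {T : Finset ℤ} {w : ℤ → ℝ} (hw : ∀ t, w t ≠ 0 → t ∈ T) (h : ℤ) :
    |∑ t ∈ T, w t * w (t + h)| ≤ ∑ t ∈ T, w t ^ 2 := by
  have hshift : ∑ t ∈ T, w (t + h) ^ 2 ≤ ∑ t ∈ T, w t ^ 2 := by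
    calc _ = ∑ t ∈ T.map (addRightEmbedding h), w t ^ 2 := by rw [Finset.sum_map]; rfl
      _ = ∑ t ∈ T.map (addRightEmbedding h) with w t ≠ 0, w t ^ 2 :=
          (Finset.sum_filter_of_ne fun t _ ht => by simpa using ht).symm
      _ ≤ _ := Finset.sum_le_sum_of_subset_of_nonneg
          (fun t ht => hw t (Finset.mem_filter.1 ht).2) fun t _ _ => sq_nonneg _
  calc _ ≤ ∑ t ∈ T, |w t * w (t + h)| := Finset.abs_sum_le_sum_abs _ _
    _ ≤ ∑ t ∈ T, (w t ^ 2 + w (t + h) ^ 2) / 2 := by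
        refine Finset.sum_le_sum fun t _ => ?_
        rw [abs_mul, ← sq_abs (w t), ← sq_abs (w (t + h))]
        linarith [two_mul_le_add_sq |w t| |w (t + h)|]
    _ ≤ _ := by
        rw [← Finset.sum_div, Finset.sum_add_distrib]
        linarith

lemma norm_sq_sum_smul_eq_tsum {T : Finset ℤ} {w : ℤ → ℝ} (hw : ∀ t, w t ≠ 0 → t ∈ T)
    {x : ℤ → E} {γ : ℤ → ℝ} (hx : ∀ s t, ⟪x s, x t⟫ = γ (t - s)) :
    ‖∑ t ∈ T, w t • x t‖ ^ 2 = ∑' h, (∑ t ∈ T, w t * w (t + h)) * γ h := by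
  have hzero : ∀ s h : ℤ, h ∉ T.map (addRightEmbedding (-s)) → w s * w (s + h) * γ h = 0 := by
    intro s h hh
    have hsh : w (s + h) = 0 := by
      by_contra h0
      exact hh (Finset.mem_map.2 ⟨s + h, hw _ h0, by simp⟩)
    simp [hsh]
  simp_rw [Finset.sum_mul]
  rw [Summable.tsum_finsetSum fun s _ => summable_of_ne_finset_zero (hzero s),
    ← real_inner_self_eq_norm_sq, sum_inner]
  refine Finset.sum_congr rfl fun s _ => ?_
  rw [tsum_eq_sum fun h hh => hzero s h hh, Finset.sum_map, inner_sum]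
  refine Finset.sum_congr rfl fun t _ => ?_
  rw [real_inner_smul_left, real_inner_smul_right, hx, addRightEmbedding_apply,
    show s + (t + -s) = t by ring, ← sub_eq_add_neg, mul_assoc]

namespace LocalWeights

variable {w : ℕ → ℤ → ℝ} {κ u α : ℝ}

lemma eventually_sum_sq_le (hw : LocalWeights w κ u α) :
    ∀ᶠ n : ℕ in atTop, ∑ t ∈ Finset.Icc (1 : ℤ) n, w n t ^ 2 ≤ κ + 1 := by
  filter_upwards [(hw.corr 0).eventually_le_const (lt_add_one κ)] with n hn
  simpa only [add_zero, ← sq] using hn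

lemma tendsto_norm_sq_sum (hw : LocalWeights w κ u α) {x : ℤ → E} {γ : ℤ → ℝ} (hγ : Summable γ)
    (hx : ∀ s t, ⟪x s, x t⟫ = γ (t - s)) :
    Tendsto (fun n : ℕ => ‖∑ t ∈ Finset.Icc (1 : ℤ) n, w n t • x t‖ ^ 2) atTop
      (𝓝 (κ * ∑' h, γ h)) := by
  have hsupp : ∀ᶠ n : ℕ in atTop, ∀ t, w n t ≠ 0 → t ∈ Finset.Icc (1 : ℤ) n :=
    (hw.support 1).mono fun n hn t ht => Finset.mem_Icc.2 (hn t ht)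
  rw [← tsum_mul_left]
  refine Tendsto.congr' (hsupp.mono fun n hn => (norm_sq_sum_smul_eq_tsum hn hx).symm) ?_
  refine tendsto_tsum_of_dominated_convergence (hγ.norm.mul_left (κ + 1))
    (fun h => (hw.corr h).mul_const _) ?_
  filter_upwards [hsupp, hw.eventually_sum_sq_le] with n hn hC h
  rw [norm_mul]
  gcongr
  exact (abs_sum_mul_shift_le hn h).trans hC

end LocalWeights

end WeightedSums

/-! ### Functionals of the past with summable dependence -/

section Truncation

/-- Truncation of a real number at the levels `-c` and `c`. Unlike
`ProbabilityTheory.truncation` it is Lipschitz, so that it preserves dependence bounds. -/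
def trunc (c x : ℝ) : ℝ := max (-c) (min c x)

lemma measurable_trunc (c : ℝ) : Measurable (trunc c) := by
  unfold trunc; fun_prop

lemma abs_trunc_le {c : ℝ} (hc : 0 ≤ c) (x : ℝ) : |trunc c x| ≤ c :=
  abs_le.2 ⟨le_max_left _ _, max_le (by linarith) (min_le_left _ _)⟩

lemma abs_trunc_sub_trunc_le (c x y : ℝ) : |trunc c x - trunc c y| ≤ |x - y| := by
  have hmax := abs_max_sub_max_le_max (-c) (min c x) (-c) (min c y)
  have hmin := abs_min_sub_min_le_max c x c y
  rw [sub_self, abs_zero, max_eq_right (abs_nonneg (min c x - min c y))] at hmax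
  rw [sub_self, abs_zero, max_eq_right (abs_nonneg (x - y))] at hmin
  exact hmax.trans hmin

lemma trunc_of_abs_le {c x : ℝ} (hx : |x| ≤ c) : trunc c x = x := by
  rw [abs_le] at hx
  rw [trunc, min_eq_right hx.2, max_eq_right hx.1]

lemma abs_sub_trunc_le {c : ℝ} (hc : 0 ≤ c) (x : ℝ) : |x - trunc c x| ≤ 2 * |x| := by
  have hle := abs_trunc_sub_trunc_le c x 0
  rw [trunc_of_abs_le (x := 0) (by simpa using hc), sub_zero, sub_zero] at hle
  linarith [abs_sub x (trunc c x)]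

variable {Ω : Type*} [MeasurableSpace Ω] {P : Measure Ω}

lemma tendsto_integral_sub_trunc_sq {Y : Ω → ℝ} (hY : MemLp Y 2 P) :
    Tendsto (fun c : ℕ => ∫ ω, (Y ω - trunc c (Y ω)) ^ 2 ∂P) atTop (𝓝 0) := by
  have hlim := tendsto_integral_of_dominated_convergence (μ := P)
    (F := fun (c : ℕ) ω => (Y ω - trunc c (Y ω)) ^ 2) (f := fun _ => (0 : ℝ))
    (fun ω => (2 * Y ω) ^ 2) (fun c => (hY.aestronglyMeasurable.sub ((measurable_trunc
      c).comp_aemeasurable hY.aestronglyMeasurable.aemeasurable).aestronglyMeasurable).pow 2)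
    (hY.const_mul 2).integrable_sq (fun c => .of_forall fun ω => ?_) (.of_forall fun ω => ?_)
  · simpa using hlim
  · rw [Real.norm_eq_abs, abs_pow, ← sq_abs (2 * Y ω), abs_mul, abs_two]
    exact pow_le_pow_left₀ (abs_nonneg _) (abs_sub_trunc_le (Nat.cast_nonneg c) _) 2
  · refine tendsto_const_nhds.congr' ?_
    filter_upwards [eventually_ge_atTop ⌈|Y ω|⌉₊] with c hc
    rw [trunc_of_abs_le ((Nat.le_ceil _).trans (by exact_mod_cast hc)), sub_self, sq, zero_mul]

lemma tendsto_eLpNorm_sub_trunc {Y : Ω → ℝ} (hY : MemLp Y 2 P) :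
    Tendsto (fun c : ℕ => eLpNorm (fun ω => Y ω - trunc c (Y ω)) 2 P) atTop (𝓝 0) := by
  have hmem : ∀ c : ℕ, MemLp (fun ω => Y ω - trunc c (Y ω)) 2 P := fun c =>
    (hY.const_mul 2).mono (hY.aestronglyMeasurable.sub ((measurable_trunc c).comp_aemeasurable
      hY.aestronglyMeasurable.aemeasurable).aestronglyMeasurable) (.of_forall fun ω => by
      simpa using abs_sub_trunc_le (Nat.cast_nonneg c) (Y ω))
  have heq : ∀ c : ℕ, eLpNorm (fun ω => Y ω - trunc c (Y ω)) 2 P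
      = ENNReal.ofReal (√(∫ ω, (Y ω - trunc c (Y ω)) ^ 2 ∂P)) := fun c => by
    rw [(hmem c).eLpNorm_eq_integral_rpow_norm two_ne_zero ENNReal.ofNat_ne_top, Real.sqrt_eq_rpow]
    simp
  simp only [heq]
  have hsqrt := (Real.continuous_sqrt.tendsto 0).comp (tendsto_integral_sub_trunc_sq hY)
  rw [Real.sqrt_zero] at hsqrt
  simpa using ENNReal.tendsto_ofReal hsqrt

end Truncation

section Dependence

variable {Ω : Type*} [MeasurableSpace Ω] {P : Measure Ω} {ε ε' : ℤ → Ω → ℝ}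

lemma Innovations.measurable_past (hε : Innovations P ε ε') (t : ℤ) : Measurable (past ε t) :=
  (LocStat.measurable_past t).mono (sigmaOf_le hε.measurable _) le_rfl

lemma Innovations.measurable_coupledPast (hε : Innovations P ε ε') (t a : ℤ) :
    Measurable (coupledPast ε ε' t a) :=
  (LocStat.measurable_coupledPast t a).mono (sup_le (sigmaOf_le hε.measurable _)
    (sup_le (sigmaOf_le hε.measurable _) (hε.measurable_copy a).comap_le)) le_rfl

lemma Innovations.identDistrib_shift (hε : Innovations P ε ε') (t : ℤ) :
    IdentDistrib (fun ω s => ε (s + t) ω) (fun ω s => ε s ω) P P where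
  aemeasurable_fst := (measurable_pi_lambda _ fun s => hε.measurable (s + t)).aemeasurable
  aemeasurable_snd := (measurable_pi_lambda _ hε.measurable).aemeasurable
  map_eq := by
    rw [(hε.indep.precomp (add_left_injective t)).map_fun_eq_infinitePi_map
      fun s => hε.measurable (s + t), hε.indep.map_fun_eq_infinitePi_map hε.measurable]
    exact congrArg Measure.infinitePi (funext fun s =>
      ((hε.identDistrib (s + t)).trans (hε.identDistrib s).symm).map_eq)

lemma Innovations.identDistrib_past_prodMk (hε : Innovations P ε ε') (r s t : ℤ) :
    IdentDistrib (fun ω => (past ε (s + r) ω, past ε (t + r) ω))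
      (fun ω => (past ε s ω, past ε t ω)) P P := by
  let pastAt (a : ℤ) (x : ℤ → ℝ) : ℕ → ℝ := fun j => x (a - j)
  have hmeas : ∀ a, Measurable (pastAt a) := fun a => by fun_prop
  have hshift : ∀ a ω, past ε (a + r) ω = pastAt a fun i => ε (i + r) ω := fun a ω => by
    funext j
    simp only [past, pastAt, add_sub_right_comm]
  simp only [hshift]
  exact (hε.identDistrib_shift r).comp ((hmeas s).prodMk (hmeas t))

lemma Innovations.identDistrib_past (hε : Innovations P ε ε') (s t : ℤ) :
    IdentDistrib (past ε s) (past ε t) P P := by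
  have hpast := (hε.identDistrib_past_prodMk (s - t) t t).comp measurable_fst
  rwa [add_sub_cancel] at hpast

/-- A functional of the past with functional dependence measure bounded by `d` in `L²`. -/
structure Dependence (P : Measure Ω) (ε ε' : ℤ → Ω → ℝ) (H : (ℕ → ℝ) → ℝ) (d : ℕ → ℝ) :
    Prop where
  measurable : Measurable H
  memLp : ∀ t, MemLp (fun ω => H (past ε t ω)) 2 P
  nonneg : ∀ k, 0 ≤ d k
  coupled : ∀ (t : ℤ) (k : ℕ),
    eLpNorm (fun ω => H (past ε t ω) - H (coupledPast ε ε' t (t - k) ω)) 2 P ≤ ENNReal.ofReal (d k)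

namespace Dependence

variable {H : (ℕ → ℝ) → ℝ} {d : ℕ → ℝ}

lemma adapted (hH : Dependence P ε ε' H d) (t : ℤ) :
    Measurable[sigmaOf ε (Set.Iic t)] (fun ω => H (past ε t ω)) :=
  hH.measurable.comp (measurable_past t)

/-- The value `H (past ε t)` of the functional at time `t` as an element of `L²`. -/
def vec (hH : Dependence P ε ε' H d) (t : ℤ) : Lp ℝ 2 P := (hH.memLp t).toLp _

lemma norm_vec_sub_vec {H' : (ℕ → ℝ) → ℝ} {d' : ℕ → ℝ} (hH : Dependence P ε ε' H d)
    (hH' : Dependence P ε ε' H' d') (t : ℤ) : ‖hH.vec t - hH'.vec t‖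
      = (eLpNorm (fun ω => H (past ε t ω) - H' (past ε t ω)) 2 P).toReal := by
  rw [vec, vec, ← MemLp.toLp_sub, Lp.norm_toLp]
  rfl

lemma truncate (hH : Dependence P ε ε' H d) (hε : Innovations P ε ε') [IsFiniteMeasure P] {c : ℝ}
    (hc : 0 ≤ c) : Dependence P ε ε' (fun x => trunc c (H x)) d where
  measurable := (measurable_trunc c).comp hH.measurable
  memLp t := MemLp.of_bound (((measurable_trunc c).comp hH.measurable).comp
    (hε.measurable_past t)).aestronglyMeasurable c (.of_forall fun _ => abs_trunc_le hc _)
  nonneg := hH.nonneg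
  coupled t k := (eLpNorm_mono fun ω => by
    simpa using abs_trunc_sub_trunc_le c (H (past ε t ω)) (H (coupledPast ε ε' t (t - k) ω))).trans
    (hH.coupled t k)

lemma identDistrib (hH : Dependence P ε ε' H d) (hε : Innovations P ε ε') (t : ℤ) :
    IdentDistrib (fun ω => H (past ε t ω)) (fun ω => H (past ε 0 ω)) P P :=
  (hε.identDistrib_past t 0).comp hH.measurable

lemma cov_eq (hH : Dependence P ε ε' H d) (hε : Innovations P ε ε') (s t : ℤ) :
    cov[fun ω => H (past ε s ω), fun ω => H (past ε t ω); P]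
      = cov[fun ω => H (past ε 0 ω), fun ω => H (past ε (t - s) ω); P] := by
  have hpast := hε.identDistrib_past_prodMk s 0 (t - s)
  rw [zero_add, sub_add_cancel] at hpast
  have hcov : ∀ a b, cov[fun ω => H (past ε a ω), fun ω => H (past ε b ω); P]
      = cov[fun x => H x.1, fun x => H x.2; P.map fun ω => (past ε a ω, past ε b ω)] := fun a b =>
    (covariance_map_fun (hH.measurable.comp measurable_fst).aestronglyMeasurable
      (hH.measurable.comp measurable_snd).aestronglyMeasurable
      ((hε.measurable_past a).prodMk (hε.measurable_past b)).aemeasurable).symm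
  rw [hcov, hcov, hpast.map_eq]

variable [IsProbabilityMeasure P]

lemma exhausted_vec (hH : Dependence P ε ε' H d) (hε : Innovations P ε ε') (t : ℤ) :
    Exhausted (futureProj P hε.measurable) (hH.vec t) :=
  exhausted_futureProj hε.measurable (hH.adapted t) (hH.memLp t)

lemma norm_increment_vec_le (hH : Dependence P ε ε' H d) (hε : Innovations P ε ε') (t : ℤ)
    (k : ℕ) : ‖increment (futureProj P hε.measurable) (t - k) (hH.vec t)‖ ≤ d k := by
  have hmem : MemLp (fun ω => H (past ε t ω) - H (coupledPast ε ε' t (t - k) ω)) 2 P :=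
    ⟨((hH.measurable.comp (hε.measurable_past t)).sub
      (hH.measurable.comp (hε.measurable_coupledPast t _))).aestronglyMeasurable,
      (hH.coupled t k).trans_lt ENNReal.ofReal_lt_top⟩
  exact (hε.norm_increment_le_of_coupled hH.measurable (hH.memLp t) hmem).trans
    (ENNReal.toReal_le_of_le_ofReal (hH.nonneg k) (hH.coupled t k))

lemma inner_center_vec (hH : Dependence P ε ε' H d) (hε : Innovations P ε ε') (s t : ℤ) :
    ⟪center (futureProj P hε.measurable) s (hH.vec s),
      center (futureProj P hε.measurable) t (hH.vec t)⟫
      = cov[fun ω => H (past ε s ω), fun ω => H (past ε t ω); P] := by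
  rw [L2.inner_def, covariance]
  refine integral_congr_ae ?_
  filter_upwards [hε.center_toLp_ae_eq (hH.adapted s) (hH.memLp s),
    hε.center_toLp_ae_eq (hH.adapted t) (hH.memLp t)] with ω hs ht
  rw [vec, vec, hs, ht]
  exact mul_comm _ _

lemma summable_cov (hH : Dependence P ε ε' H d) (hε : Innovations P ε ε') (hd : Summable d) :
    Summable fun t => cov[fun ω => H (past ε 0 ω), fun ω => H (past ε t ω); P] := by
  simp only [← hH.inner_center_vec hε]
  exact (decreasingProjections_futureProj hε.measurable).summable_inner_center hd
    (hH.exhausted_vec hε) (hH.norm_increment_vec_le hε)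

lemma norm_increment_vec_sub_truncate_le (hH : Dependence P ε ε' H d) (hε : Innovations P ε ε')
    {c : ℝ} (hc : 0 ≤ c) (t : ℤ) (k : ℕ) :
    ‖increment (futureProj P hε.measurable) (t - k) (hH.vec t - (hH.truncate hε hc).vec t)‖
      ≤ min (2 * d k)
        (eLpNorm (fun ω => H (past ε 0 ω) - trunc c (H (past ε 0 ω))) 2 P).toReal := by
  refine le_min ?_ ?_
  · rw [map_sub]
    linarith [norm_sub_le (increment (futureProj P hε.measurable) (t - k) (hH.vec t))
        (increment (futureProj P hε.measurable) (t - k) ((hH.truncate hε hc).vec t)),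
      hH.norm_increment_vec_le hε t k, (hH.truncate hε hc).norm_increment_vec_le hε t k]
  · refine ((decreasingProjections_futureProj hε.measurable).norm_increment_le _ _).trans_eq ?_
    rw [norm_vec_sub_vec]
    exact congrArg ENNReal.toReal (((hH.identDistrib hε t).comp (u := fun x => x - trunc c x)
      (measurable_id.sub (measurable_trunc c))).eLpNorm_eq 2)

variable {w : ℕ → ℤ → ℝ} {κ u α : ℝ}

lemma exists_truncate_norm_sum_le (hH : Dependence P ε ε' H d) (hε : Innovations P ε ε')
    (hd : Summable d) (hw : LocalWeights w κ u α) {η : ℝ} (hη : 0 < η) :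
    ∃ (c : ℝ) (hc : 0 ≤ c), ∀ᶠ n : ℕ in atTop,
      ‖∑ t ∈ Finset.Icc (1 : ℤ) n, w n t • center (futureProj P hε.measurable) t
        (hH.vec t - (hH.truncate hε hc).vec t)‖ ≤ η := by
  let ρ : ℕ → ℝ := fun c =>
    (eLpNorm (fun ω => H (past ε 0 ω) - trunc c (H (past ε 0 ω))) 2 P).toReal
  have hd2 : Summable fun k => 2 * d k := hd.mul_left 2
  have hd20 : ∀ k, 0 ≤ 2 * d k := fun k => mul_nonneg two_pos.le (hH.nonneg k)
  have hρ : Tendsto ρ atTop (𝓝[≥] 0) :=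
    tendsto_nhdsWithin_iff.2 ⟨(ENNReal.tendsto_toReal ENNReal.zero_ne_top).comp
      (tendsto_eLpNorm_sub_trunc (hH.memLp 0)), .of_forall fun c => ENNReal.toReal_nonneg⟩
  have hbound := ((tendsto_tsum_min_zero hd20 hd2).comp hρ).const_mul √(κ + 1)
  rw [mul_zero] at hbound
  obtain ⟨c, hc⟩ := (hbound.eventually_le_const hη).exists
  have hmin : ∀ k, 0 ≤ min (2 * d k) (ρ c) := fun k => le_min (hd20 k) ENNReal.toReal_nonneg
  refine ⟨c, c.cast_nonneg, ?_⟩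
  filter_upwards [hw.eventually_sum_sq_le] with n hn
  exact ((decreasingProjections_futureProj hε.measurable).norm_sum_smul_center_le_sqrt_mul_tsum
    (fun t _ => (hH.exhausted_vec hε t).sub ((hH.truncate hε c.cast_nonneg).exhausted_vec hε t))
    hn hmin (hd2.of_nonneg_of_le hmin fun k => min_le_left _ _)
    fun t _ _ k => hH.norm_increment_vec_sub_truncate_le hε c.cast_nonneg t k).trans hc

lemma sum_mul_norm_increment_vec_sub_block_sq_le (hH : Dependence P ε ε' H d)
    (hε : Innovations P ε ε') (L : ℕ) (T : Finset ℤ) (a : ℤ → ℝ) (k : ℕ) :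
    ∑ t ∈ T, a t ^ 2 * ‖increment (futureProj P hε.measurable) (t - k)
        (hH.vec t - futureProj P hε.measurable (L * (t / L)) (hH.vec t))‖ ^ 2
      ≤ (∑ t ∈ T.filter (fun t : ℤ => t % L < k), a t ^ 2) * d k ^ 2 := by
  have hD := decreasingProjections_futureProj (P := P) hε.measurable
  rw [Finset.sum_mul, Finset.sum_filter]
  refine Finset.sum_le_sum fun t _ => ?_
  have hdiv := Int.mul_ediv_add_emod t L
  split_ifs with h
  · rw [map_sub, hD.increment_proj_of_lt (by lia), sub_zero]
    gcongr
    exact hH.norm_increment_vec_le hε t k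
  · rw [map_sub, hD.increment_proj_of_le (by lia), sub_self, norm_zero, sq 0, mul_zero, mul_zero]

lemma exists_block_norm_sum_le (hH : Dependence P ε ε' H d) (hε : Innovations P ε ε')
    (hd : Summable d) (hw : LocalWeights w κ u α) {η : ℝ} (hη : 0 < η) :
    ∃ L : ℕ, 0 < L ∧ ∀ᶠ n : ℕ in atTop,
      ‖∑ t ∈ Finset.Icc (1 : ℤ) n, w n t • center (futureProj P hε.measurable) t
        (hH.vec t - futureProj P hε.measurable (L * (t / L)) (hH.vec t))‖ ≤ η := by
  have hD := decreasingProjections_futureProj (P := P) hε.measurable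
  obtain ⟨C, hC0, hC⟩ := hw.residue
  have hlim := (tendsto_tsum_mul_sqrt_min_zero hH.nonneg hd).const_mul √C
  rw [mul_zero] at hlim
  obtain ⟨L, hL, hL0⟩ := ((hlim.eventually_le_const hη).and (eventually_gt_atTop 0)).exists
  refine ⟨L, hL0, ?_⟩
  filter_upwards [hC L hL0] with n hn
  refine le_trans ?_ hL
  rw [← tsum_mul_left]
  have hB0 : ∀ k : ℕ, 0 ≤ √C * (d k * √(min 1 ((k : ℝ) / L))) := fun k =>
    mul_nonneg (Real.sqrt_nonneg _) (mul_nonneg (hH.nonneg k) (Real.sqrt_nonneg _))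
  refine hD.norm_sum_smul_center_le
    (fun t _ => (hH.exhausted_vec hε t).sub (hD.exhausted_proj _ _)) hB0 ?_ fun k => ?_
  · refine (hd.mul_left √C).of_nonneg_of_le hB0 fun k => ?_
    gcongr
    exact mul_le_of_le_one_right (hH.nonneg k) (Real.sqrt_le_one.2 (min_le_left _ _))
  · have hmin : 0 ≤ min 1 ((k : ℝ) / L) := le_min zero_le_one (by positivity)
    rw [mul_pow, mul_pow, Real.sq_sqrt hC0, Real.sq_sqrt hmin, mul_comm (d k ^ 2), ← mul_assoc]
    refine (hH.sum_mul_norm_increment_vec_sub_block_sq_le hε L _ _ k).trans ?_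
    gcongr
    exact hn k

end Dependence

end Dependence

section GaussianDefect

lemma abs_mul_exp_neg_sq_div_two_le_one (x : ℝ) : |x * Real.exp (-(x ^ 2 / 2))| ≤ 1 := by
  have hx : |x| ≤ Real.exp (x ^ 2 / 2) := by
    nlinarith [Real.add_one_le_exp (x ^ 2 / 2), sq_abs x, sq_nonneg (|x| - 1)]
  rw [abs_mul, Real.abs_exp, Real.exp_neg, ← div_eq_mul_inv]
  exact (div_le_one (Real.exp_pos _)).2 hx

lemma abs_exp_neg_sq_div_two_sub_le (x y : ℝ) :
    |Real.exp (-(x ^ 2 / 2)) - Real.exp (-(y ^ 2 / 2))| ≤ |x - y| := by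
  have hderiv : ∀ z : ℝ, HasDerivAt (fun z : ℝ => Real.exp (-(z ^ 2 / 2)))
      (Real.exp (-(z ^ 2 / 2)) * -z) z := fun z => by
    simpa using (((hasDerivAt_pow 2 z).div_const 2).neg).exp
  simpa using convex_univ.norm_image_sub_le_of_norm_hasDerivWithin_le
    (fun z _ => (hderiv z).hasDerivWithinAt) (C := 1)
    (fun z _ => by simpa [mul_comm] using abs_mul_exp_neg_sq_div_two_le_one z)
    (Set.mem_univ y) (Set.mem_univ x)

variable {Ω : Type*} [MeasurableSpace Ω] {P : Measure Ω}

/-- Deviation of the characteristic function of `S` from that of the centered Gaussian law with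
variance `‖S‖ ^ 2`. -/
def gaussianDefect (s : ℝ) (S : Lp ℝ 2 P) : ℂ :=
  charFun (P.map S) s - Real.exp (-(s ^ 2 / 2 * ‖S‖ ^ 2))

variable [IsProbabilityMeasure P]

lemma norm_charFun_map_coe_sub_le (S T : Lp ℝ 2 P) (s : ℝ) :
    ‖charFun (P.map S) s - charFun (P.map T) s‖ ≤ |s| * ‖S - T‖ := by
  simpa only [Lp.toLp_coeFn] using norm_charFun_map_sub_le (Lp.memLp S) (Lp.memLp T) s

lemma norm_gaussianDefect_sub_le (s : ℝ) (S T : Lp ℝ 2 P) :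
    ‖gaussianDefect s S - gaussianDefect s T‖ ≤ 2 * |s| * ‖S - T‖ := by
  have hexp : |Real.exp (-(s ^ 2 / 2 * ‖S‖ ^ 2)) - Real.exp (-(s ^ 2 / 2 * ‖T‖ ^ 2))|
      ≤ |s| * ‖S - T‖ := by
    have hle := abs_exp_neg_sq_div_two_sub_le (s * ‖S‖) (s * ‖T‖)
    rw [mul_pow, mul_pow, mul_div_right_comm, mul_div_right_comm, ← mul_sub, abs_mul] at hle
    exact hle.trans (mul_le_mul_of_nonneg_left (abs_norm_sub_norm_le S T) (abs_nonneg s))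
  rw [gaussianDefect, gaussianDefect, sub_sub_sub_comm, ← Complex.ofReal_sub]
  refine (norm_sub_le _ _).trans ?_
  rw [Complex.norm_real, Real.norm_eq_abs]
  linarith [norm_charFun_map_coe_sub_le S T s]

lemma tendsto_gaussianDefect_zero (s : ℝ) {S : ℕ → Lp ℝ 2 P} {C : ℝ}
    (hC : ∀ᶠ n in atTop, ‖S n‖ ≤ C)
    (happrox : ∀ θ > 0, ∃ δ : ℕ → ℝ, Tendsto δ atTop (𝓝 0) ∧ ∀ᶠ n in atTop, ∃ T : Lp ℝ 2 P,
      ‖S n - T‖ ≤ θ ∧ ‖gaussianDefect s T‖ ≤ δ n * ‖T‖ ^ 2) :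
    Tendsto (fun n => gaussianDefect s (S n)) atTop (𝓝 0) := by
  rw [tendsto_zero_iff_norm_tendsto_zero, Metric.tendsto_nhds]
  intro η hη
  obtain ⟨θ, hθ0, hθ1, hθη⟩ : ∃ θ, 0 < θ ∧ θ ≤ 1 ∧ 2 * |s| * θ ≤ η / 2 := by
    refine ⟨min 1 (η / 2 / (2 * |s| + 1)), by positivity, min_le_left _ _, ?_⟩
    calc 2 * |s| * min 1 (η / 2 / (2 * |s| + 1))
        ≤ (2 * |s| + 1) * (η / 2 / (2 * |s| + 1)) := by
          gcongr
          exacts [by linarith, min_le_right _ _]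
      _ = η / 2 := by field_simp
  obtain ⟨δ, hδ, hT⟩ := happrox θ hθ0
  have hlim := hδ.abs.mul_const ((C + 1) ^ 2)
  rw [abs_zero, zero_mul] at hlim
  filter_upwards [hC, hT, hlim.eventually_lt_const (half_pos hη)] with n hSC ⟨T, hST, hdef⟩ hsmall
  have hTC : ‖T‖ ≤ C + 1 := by linarith [norm_le_norm_add_norm_sub (S n) T]
  have hdefT : ‖gaussianDefect s T‖ < η / 2 := by
    refine (hdef.trans ?_).trans_lt hsmall
    gcongr
    exact le_abs_self _
  have hdiff : ‖gaussianDefect s (S n) - gaussianDefect s T‖ ≤ η / 2 :=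
    (norm_gaussianDefect_sub_le s (S n) T).trans
      ((mul_le_mul_of_nonneg_left hST (by positivity)).trans hθη)
  rw [Real.dist_eq, sub_zero, abs_norm]
  linarith [norm_le_norm_add_norm_sub (gaussianDefect s T) (gaussianDefect s (S n)),
    norm_sub_rev (gaussianDefect s T) (gaussianDefect s (S n))]

end GaussianDefect

namespace Dependence

variable {Ω : Type*} [MeasurableSpace Ω] {P : Measure Ω} [IsProbabilityMeasure P]
  {ε ε' : ℤ → Ω → ℝ} {H : (ℕ → ℝ) → ℝ} {d : ℕ → ℝ} {w : ℕ → ℤ → ℝ} {κ u α : ℝ}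

/-- The weighted sum of the centered process `H (past ε t)`, `1 ≤ t ≤ n`, as an element of `L²`. -/
def centeredSum (hH : Dependence P ε ε' H d) (hε : Innovations P ε ε') (w : ℕ → ℤ → ℝ) (n : ℕ) :
    Lp ℝ 2 P :=
  ∑ t ∈ Finset.Icc (1 : ℤ) n, w n t • center (futureProj P hε.measurable) t (hH.vec t)

lemma tendsto_norm_sq_centeredSum (hH : Dependence P ε ε' H d) (hε : Innovations P ε ε')
    (hd : Summable d) (hw : LocalWeights w κ u α) :
    Tendsto (fun n => ‖hH.centeredSum hε w n‖ ^ 2) atTop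
      (𝓝 (κ * ∑' k, cov[fun ω => H (past ε 0 ω), fun ω => H (past ε k ω); P])) :=
  hw.tendsto_norm_sq_sum (hH.summable_cov hε hd) fun s t =>
    (hH.inner_center_vec hε s t).trans (hH.cov_eq hε s t)

lemma exists_block_approx (hH : Dependence P ε ε' H d) (hε : Innovations P ε ε') (hd : Summable d)
    (hw : LocalWeights w κ u α) (s : ℝ) {θ : ℝ} (hθ : 0 < θ) :
    ∃ δ : ℕ → ℝ, Tendsto δ atTop (𝓝 0) ∧ ∀ᶠ n in atTop, ∃ T : Lp ℝ 2 P,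
      ‖hH.centeredSum hε w n - T‖ ≤ θ ∧ ‖gaussianDefect s T‖ ≤ δ n * ‖T‖ ^ 2 := by
  obtain ⟨c, hc, htrunc⟩ := hH.exists_truncate_norm_sum_le hε hd hw (half_pos hθ)
  have hHc := hH.truncate hε hc
  obtain ⟨L, hL, hblock⟩ := hHc.exists_block_norm_sum_le hε hd hw (half_pos hθ)
  obtain ⟨e, he, hwe⟩ := hw.sup_tendsto
  have hlim : Tendsto (fun n => L * (e n * (2 * c))) atTop (𝓝 0) := by
    simpa using (he.mul_const (2 * c)).const_mul (L : ℝ)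
  have hlim1 : Tendsto (fun n => |s| * (L * (e n * (2 * c)))) atTop (𝓝 0) := by
    simpa using hlim.const_mul |s|
  refine ⟨fun n => |s| ^ 3 * (L * (e n * (2 * c))), by simpa using hlim.const_mul (|s| ^ 3), ?_⟩
  filter_upwards [htrunc, hblock, hwe, hlim1.eventually_le_const one_pos]
    with n htrunc hblock hwe hsmall
  refine ⟨∑ t ∈ Finset.Icc (1 : ℤ) n, w n t • center (futureProj P hε.measurable) t
    (futureProj P hε.measurable (L * (t / L)) (hHc.vec t)), ?_,
    norm_charFun_block_sub_exp_le hε hHc.adapted (fun t ω => abs_trunc_le hc _) hHc.memLp hL _ hwe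
      hsmall rfl⟩
  have hsplit := norm_add_le_of_le htrunc hblock
  rw [add_halves, ← Finset.sum_add_distrib] at hsplit
  simpa only [centeredSum, ← smul_add, ← map_add, sub_add_sub_cancel, map_sub, smul_sub,
    Finset.sum_sub_distrib] using hsplit

lemma tendsto_charFun_centeredSum (hH : Dependence P ε ε' H d) (hε : Innovations P ε ε')
    (hd : Summable d) (hw : LocalWeights w κ u α) (s : ℝ) :
    Tendsto (fun n => charFun (P.map (hH.centeredSum hε w n)) s) atTop
      (𝓝 (Real.exp (-(s ^ 2 / 2 *
        (κ * ∑' k, cov[fun ω => H (past ε 0 ω), fun ω => H (past ε k ω); P]))) : ℝ)) := by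
  have hv := hH.tendsto_norm_sq_centeredSum hε hd hw
  have hbound : ∀ᶠ n in atTop, ‖hH.centeredSum hε w n‖ ≤ √(_ + 1) :=
    (hv.eventually_le_const (lt_add_one _)).mono fun n => Real.le_sqrt_of_sq_le
  have hdefect := tendsto_gaussianDefect_zero s hbound
    fun θ hθ => hH.exists_block_approx hε hd hw s hθ
  have hexp := (Complex.continuous_ofReal.tendsto _).comp
    ((Real.continuous_exp.tendsto _).comp ((hv.const_mul (s ^ 2 / 2)).neg))
  simpa [gaussianDefect] using hdefect.add hexp

end Dependence

/-! ### Locally stationary arrays -/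

section SubIntegral

variable {Ω : Type*} [MeasurableSpace Ω] {P : Measure Ω} [IsProbabilityMeasure P] {p : ℝ≥0∞}

lemma eLpNorm_sub_integral_le (hp : 1 ≤ p) {f : Ω → ℝ} (hf : AEStronglyMeasurable f P) :
    eLpNorm (fun ω => f ω - ∫ ω', f ω' ∂P) p P ≤ 2 * eLpNorm f p P := by
  have hconst : eLpNorm (fun _ : Ω => ∫ ω', f ω' ∂P) p P ≤ eLpNorm f p P := by
    rw [eLpNorm_const _ (one_pos.trans_le hp).ne' (IsProbabilityMeasure.ne_zero P), measure_univ,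
      ENNReal.one_rpow, mul_one]
    refine (enorm_integral_le_lintegral_enorm f).trans ?_
    rw [← eLpNorm_one_eq_lintegral_enorm]
    exact eLpNorm_le_eLpNorm_of_exponent_le hp hf
  rw [two_mul]
  exact (eLpNorm_sub_le (g := fun _ : Ω => ∫ ω', f ω' ∂P) hf aestronglyMeasurable_const hp).trans
    (add_le_add_right hconst _)

lemma eLpNorm_sub_integral_sub_le (hp : 1 ≤ p) {f g : Ω → ℝ} (hf : AEStronglyMeasurable f P)
    (hg : MemLp g p P) :
    eLpNorm (fun ω => (f ω - ∫ ω', f ω' ∂P) - (g ω - ∫ ω', g ω' ∂P)) p P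
      ≤ 2 * eLpNorm (fun ω => f ω - g ω) p P := by
  rcases eq_top_or_lt_top (eLpNorm (fun ω => f ω - g ω) p P) with htop | hlt
  · rw [htop, ENNReal.mul_top two_ne_zero]
    exact le_top
  have hfg : MemLp (fun ω => f ω - g ω) p P := ⟨hf.sub hg.aestronglyMeasurable, hlt⟩
  have hf1 : Integrable f P := by
    simpa only [Pi.add_def, sub_add_cancel] using (hfg.integrable hp).add (hg.integrable hp)
  simp only [sub_sub_sub_comm, ← integral_sub hf1 (hg.integrable hp)]
  exact eLpNorm_sub_integral_le hp hfg.aestronglyMeasurable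

end SubIntegral

section LocallyStationary

variable {Ω : Type*} [MeasurableSpace Ω] {P : Measure Ω} {ε ε' : ℤ → Ω → ℝ}

/-- The array `X t n` is approximated in `L^p` by the functionals `H v (past ε t)` at `v = t / n`,
which have moments bounded by `A` and functional dependence measures bounded by `δ` uniformly in
`v`, and are Hölder continuous in `v` with exponent `α`. The approximation holds from time `t₀` on,
since a lagged array is only controlled after its initial values; and `v` ranges over all of `ℝ`,
since a functional given on `[0, 1]` extends by clamping. -/
structure LocallyStationary (P : Measure Ω) (ε ε' : ℤ → Ω → ℝ) (X : ℤ → ℕ → Ω → ℝ)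
    (H : ℝ → (ℕ → ℝ) → ℝ) (p : ℝ≥0∞) (δ : ℕ → ℝ≥0) (A c : ℝ≥0) (α : ℝ) (t₀ : ℤ) : Prop where
  measurable_array : ∀ t n, Measurable (X t n)
  measurable : ∀ v, Measurable (H v)
  summable : Summable δ
  moment : ∀ v t, eLpNorm (fun ω => H v (past ε t ω)) p P ≤ A
  coupled : ∀ v t (k : ℕ),
    eLpNorm (fun ω => H v (past ε t ω) - H v (coupledPast ε ε' t (t - k) ω)) p P ≤ δ k
  holder : ∀ t v v', eLpNorm (fun ω => H v (past ε t ω) - H v' (past ε t ω)) p P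
    ≤ c * ENNReal.ofReal (|v - v'| ^ α)
  approx : ∀ (n : ℕ) (t : ℤ), t₀ ≤ t → t ≤ n →
    eLpNorm (fun ω => X t n ω - H (t / n) (past ε t ω)) p P ≤ c * ENNReal.ofReal (n ^ (-α))

namespace LocallyStationary

section Basic

variable {X : ℤ → ℕ → Ω → ℝ} {H : ℝ → (ℕ → ℝ) → ℝ} {p : ℝ≥0∞} {δ : ℕ → ℝ≥0} {A c : ℝ≥0} {α : ℝ}
  {t₀ : ℤ}

lemma measurable_comp_past (hX : LocallyStationary P ε ε' X H p δ A c α t₀)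
    (hε : Innovations P ε ε') (v : ℝ) (t : ℤ) : Measurable fun ω => H v (past ε t ω) :=
  (hX.measurable v).comp (hε.measurable_past t)

lemma measurable_comp_coupledPast (hX : LocallyStationary P ε ε' X H p δ A c α t₀)
    (hε : Innovations P ε ε') (v : ℝ) (t s : ℤ) :
    Measurable fun ω => H v (coupledPast ε ε' t s ω) :=
  (hX.measurable v).comp (hε.measurable_coupledPast t s)

lemma mono_exponent [IsProbabilityMeasure P] (hX : LocallyStationary P ε ε' X H p δ A c α t₀)
    (hε : Innovations P ε ε') {p' : ℝ≥0∞} (hp : p' ≤ p) :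
    LocallyStationary P ε ε' X H p' δ A c α t₀ where
  measurable_array := hX.measurable_array
  measurable := hX.measurable
  summable := hX.summable
  moment v t := (eLpNorm_le_eLpNorm_of_exponent_le hp
    (hX.measurable_comp_past hε v t).aestronglyMeasurable).trans (hX.moment v t)
  coupled v t k := (eLpNorm_le_eLpNorm_of_exponent_le hp ((hX.measurable_comp_past hε v t).sub
    (hX.measurable_comp_coupledPast hε v t _)).aestronglyMeasurable).trans (hX.coupled v t k)
  holder t v v' := (eLpNorm_le_eLpNorm_of_exponent_le hp ((hX.measurable_comp_past hε v t).sub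
    (hX.measurable_comp_past hε v' t)).aestronglyMeasurable).trans (hX.holder t v v')
  approx n t h₀ hn := (eLpNorm_le_eLpNorm_of_exponent_le hp ((hX.measurable_array t n).sub
    (hX.measurable_comp_past hε _ t)).aestronglyMeasurable).trans (hX.approx n t h₀ hn)

end Basic

variable {X : ℤ → ℕ → Ω → ℝ} {H : ℝ → (ℕ → ℝ) → ℝ} {δ : ℕ → ℝ≥0} {A c : ℝ≥0} {α : ℝ} {t₀ : ℤ}

lemma dependence (hX : LocallyStationary P ε ε' X H 2 δ A c α t₀) (hε : Innovations P ε ε')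
    (v : ℝ) : Dependence P ε ε' (H v) (fun k => δ k) where
  measurable := hX.measurable v
  memLp t := ⟨(hX.measurable_comp_past hε v t).aestronglyMeasurable,
    (hX.moment v t).trans_lt ENNReal.coe_lt_top⟩
  nonneg k := (δ k).coe_nonneg
  coupled t k := (hX.coupled v t k).trans_eq (ENNReal.ofReal_coe_nnreal).symm

variable [IsProbabilityMeasure P] {w : ℕ → ℤ → ℝ} {κ u : ℝ}

/-- The weighted sum of the centered approximations `H (t / n) (past ε t)`, as an element of `L²`.
-/
def movingSum (hX : LocallyStationary P ε ε' X H 2 δ A c α t₀) (hε : Innovations P ε ε')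
    (w : ℕ → ℤ → ℝ) (n : ℕ) : Lp ℝ 2 P :=
  ∑ t ∈ Finset.Icc (1 : ℤ) n,
    w n t • center (futureProj P hε.measurable) t ((hX.dependence hε (t / n)).vec t)

lemma coeFn_movingSum (hX : LocallyStationary P ε ε' X H 2 δ A c α t₀) (hε : Innovations P ε ε')
    (n : ℕ) : hX.movingSum hε w n =ᵐ[P] fun ω => ∑ t ∈ Finset.Icc (1 : ℤ) n,
      w n t * (H (t / n) (past ε t ω) - ∫ ω', H (t / n) (past ε t ω') ∂P) :=
  coeFn_sum_smul _ _ _ fun t _ =>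
    hε.center_toLp_ae_eq ((hX.dependence hε _).adapted t) ((hX.dependence hε _).memLp t)

lemma norm_increment_vec_sub_vec_le (hX : LocallyStationary P ε ε' X H 2 δ A c α t₀)
    (hε : Innovations P ε ε') (hα : 0 ≤ α) {v v' θ : ℝ} (hv : |v - v'| ≤ θ) (t : ℤ) (k : ℕ) :
    ‖increment (futureProj P hε.measurable) (t - k)
      ((hX.dependence hε v).vec t - (hX.dependence hε v').vec t)‖
      ≤ min (2 * (δ k : ℝ)) (c * θ ^ α) := by
  have hθ : 0 ≤ θ := (abs_nonneg _).trans hv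
  refine le_min ?_ ?_
  · rw [map_sub, two_mul]
    exact norm_sub_le_of_le ((hX.dependence hε v).norm_increment_vec_le hε t k)
      ((hX.dependence hε v').norm_increment_vec_le hε t k)
  · refine ((decreasingProjections_futureProj hε.measurable).norm_increment_le _ _).trans ?_
    rw [Dependence.norm_vec_sub_vec]
    refine ENNReal.toReal_le_of_le_ofReal (by positivity) ((hX.holder t v v').trans ?_)
    rw [ENNReal.ofReal_mul c.coe_nonneg, ENNReal.ofReal_coe_nnreal]
    gcongr

lemma eventually_norm_movingSum_sub_centeredSum_le
    (hX : LocallyStationary P ε ε' X H 2 δ A c α t₀) (hε : Innovations P ε ε') (hα : 0 < α)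
    (hw : LocalWeights w κ u α) {η : ℝ} (hη : 0 < η) :
    ∀ᶠ n in atTop,
      ‖hX.movingSum hε w n - (hX.dependence hε u).centeredSum hε w n‖ ≤ η := by
  have hδ : Summable fun k => 2 * (δ k : ℝ) := (NNReal.summable_coe.2 hX.summable).mul_left 2
  have hδ0 : ∀ k, 0 ≤ 2 * (δ k : ℝ) := fun k => by positivity
  have hmod : Tendsto (fun θ : ℝ => c * θ ^ α) (𝓝[>] 0) (𝓝[≥] 0) := by
    refine tendsto_nhdsWithin_iff.2 ⟨?_, ?_⟩
    · have hcont := ((Real.continuous_rpow_const hα.le).tendsto 0).const_mul (c : ℝ)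
      rw [Real.zero_rpow hα.ne', mul_zero] at hcont
      exact hcont.mono_left nhdsWithin_le_nhds
    · filter_upwards [self_mem_nhdsWithin] with θ hθ
      exact mul_nonneg c.coe_nonneg (Real.rpow_nonneg (le_of_lt hθ) α)
  have hbound := ((tendsto_tsum_min_zero hδ0 hδ).comp hmod).const_mul √(κ + 1)
  rw [mul_zero] at hbound
  obtain ⟨θ, hθ, hθ0 : 0 < θ⟩ :=
    ((hbound.eventually_le_const hη).and self_mem_nhdsWithin).exists
  have hmin : ∀ k, 0 ≤ min (2 * (δ k : ℝ)) (c * θ ^ α) := fun k =>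
    le_min (hδ0 k) (by positivity)
  filter_upwards [hw.eventually_sum_sq_le, hw.localized θ hθ0] with n hsq hloc
  simp only [movingSum, Dependence.centeredSum, ← Finset.sum_sub_distrib, ← smul_sub, ← map_sub]
  exact ((decreasingProjections_futureProj hε.measurable).norm_sum_smul_center_le_sqrt_mul_tsum
    (fun t _ => ((hX.dependence hε _).exhausted_vec hε t).sub
      ((hX.dependence hε u).exhausted_vec hε t))
    hsq hmin (hδ.of_nonneg_of_le hmin fun k => min_le_left _ _)
    fun t _ hwt k => hX.norm_increment_vec_sub_vec_le hε hα.le (hloc t hwt) t k).trans hθ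

lemma eLpNorm_sub_movingSum_le (hX : LocallyStationary P ε ε' X H 2 δ A c α t₀)
    (hε : Innovations P ε ε') {n : ℕ} (hw : ∀ t, w n t ≠ 0 → t₀ ≤ t ∧ t ≤ n) :
    eLpNorm (fun ω => ∑ t ∈ Finset.Icc (1 : ℤ) n, w n t * (X t n ω - ∫ ω', X t n ω' ∂P)
        - hX.movingSum hε w n ω) 2 P
      ≤ ENNReal.ofReal (2 * c * ((∑ t ∈ Finset.Icc (1 : ℤ) n, |w n t|) * (n : ℝ) ^ (-α))) := by
  let D : ℤ → Ω → ℝ := fun t ω => (X t n ω - ∫ ω', X t n ω' ∂P)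
    - (H (t / n) (past ε t ω) - ∫ ω', H (t / n) (past ε t ω') ∂P)
  have hD : ∀ t, AEStronglyMeasurable (D t) P := fun t =>
    (((hX.measurable_array t n).sub_const _).sub
      ((hX.measurable_comp_past hε _ t).sub_const _)).aestronglyMeasurable
  have hterm : ∀ t, eLpNorm (w n t • D t) 2 P
      ≤ ENNReal.ofReal (|w n t| * (2 * c * (n : ℝ) ^ (-α))) := fun t => by
    rcases eq_or_ne (w n t) 0 with h0 | h0
    · simp [h0]
    rw [eLpNorm_const_smul, Real.enorm_eq_ofReal_abs, ENNReal.ofReal_mul (abs_nonneg _),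
      mul_assoc 2, ENNReal.ofReal_mul two_pos.le, ENNReal.ofReal_mul c.coe_nonneg,
      ENNReal.ofReal_ofNat, ENNReal.ofReal_coe_nnreal]
    gcongr
    exact (eLpNorm_sub_integral_sub_le one_le_two (hX.measurable_array t n).aestronglyMeasurable
      ((hX.dependence hε _).memLp t)).trans (by gcongr; exact hX.approx n t (hw t h0).1 (hw t h0).2)
  have hae : (fun ω => ∑ t ∈ Finset.Icc (1 : ℤ) n, w n t * (X t n ω - ∫ ω', X t n ω' ∂P)
      - hX.movingSum hε w n ω) =ᵐ[P] ∑ t ∈ Finset.Icc (1 : ℤ) n, w n t • D t := by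
    filter_upwards [hX.coeFn_movingSum hε (w := w) n] with ω hω
    rw [hω, ← Finset.sum_sub_distrib, Finset.sum_apply]
    exact Finset.sum_congr rfl fun t _ => (mul_sub _ _ _).symm
  rw [eLpNorm_congr_ae hae]
  refine (eLpNorm_sum_le (fun t _ => (hD t).const_smul _) one_le_two).trans
    ((Finset.sum_le_sum fun t _ => hterm t).trans_eq ?_)
  rw [← ENNReal.ofReal_sum_of_nonneg fun t _ => by positivity, ← Finset.sum_mul]
  ring_nf

lemma eventually_norm_toLp_sub_centeredSum_le (hX : LocallyStationary P ε ε' X H 2 δ A c α t₀)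
    (hε : Innovations P ε ε') (hα : 0 < α) (hw : LocalWeights w κ u α) {η : ℝ} (hη : 0 < η) :
    ∀ᶠ n : ℕ in atTop, ∃ h : MemLp (fun ω => ∑ t ∈ Finset.Icc (1 : ℤ) n,
        w n t * (X t n ω - ∫ ω', X t n ω' ∂P)) 2 P,
      ‖h.toLp _ - (hX.dependence hε u).centeredSum hε w n‖ ≤ η := by
  have hlim := hw.sum_abs.const_mul (2 * c : ℝ)
  rw [mul_zero] at hlim
  filter_upwards [hX.eventually_norm_movingSum_sub_centeredSum_le hε hα hw (half_pos hη),
    hw.support t₀, hlim.eventually_le_const (half_pos hη)] with n hfreeze hsupp hsmall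
  have hdiff := (hX.eLpNorm_sub_movingSum_le hε hsupp).trans (ENNReal.ofReal_le_ofReal hsmall)
  have hmeas : Measurable fun ω => ∑ t ∈ Finset.Icc (1 : ℤ) n,
      w n t * (X t n ω - ∫ ω', X t n ω' ∂P) :=
    Finset.measurable_fun_sum _ fun t _ => ((hX.measurable_array t n).sub_const _).const_mul _
  have hmem : MemLp (fun ω => ∑ t ∈ Finset.Icc (1 : ℤ) n,
      w n t * (X t n ω - ∫ ω', X t n ω' ∂P)) 2 P := by
    have hsub : MemLp _ 2 P := ⟨hmeas.aestronglyMeasurable.sub (Lp.aestronglyMeasurable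
      (hX.movingSum hε w n)), hdiff.trans_lt ENNReal.ofReal_lt_top⟩
    simpa only [Pi.add_def, sub_add_cancel] using hsub.add (Lp.memLp (hX.movingSum hε w n))
  have hnorm : ‖hmem.toLp _ - hX.movingSum hε w n‖ ≤ η / 2 := by
    conv_lhs => rw [← Lp.toLp_coeFn (hX.movingSum hε w n) (Lp.memLp _), ← MemLp.toLp_sub,
      Lp.norm_toLp]
    exact ENNReal.toReal_le_of_le_ofReal (half_pos hη).le hdiff
  refine ⟨hmem, (norm_sub_le_norm_sub_add_norm_sub _ (hX.movingSum hε w n) _).trans ?_⟩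
  linarith

lemma tendsto_charFun_sum (hX : LocallyStationary P ε ε' X H 2 δ A c α t₀)
    (hε : Innovations P ε ε') (hα : 0 < α) (hw : LocalWeights w κ u α) (s : ℝ) :
    Tendsto (fun n : ℕ => charFun (P.map fun ω => ∑ t ∈ Finset.Icc (1 : ℤ) n,
        w n t * (X t n ω - ∫ ω', X t n ω' ∂P)) s) atTop
      (𝓝 (Real.exp (-(s ^ 2 / 2 *
        (κ * ∑' k, cov[fun ω => H u (past ε 0 ω), fun ω => H u (past ε k ω); P]))) : ℝ)) := by
  refine ((hX.dependence hε u).tendsto_charFun_centeredSum hε (NNReal.summable_coe.2 hX.summable)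
    hw s).congr_dist (Metric.tendsto_nhds.2 fun η hη => ?_)
  have hη' : 0 < η / (|s| + 1) := by positivity
  filter_upwards [hX.eventually_norm_toLp_sub_centeredSum_le hε hα hw (half_pos hη')]
    with n ⟨hmem, hle⟩
  have hchar := norm_charFun_map_sub_le hmem
    (Lp.memLp ((hX.dependence hε u).centeredSum hε w n)) s
  rw [Lp.toLp_coeFn] at hchar
  rw [Real.dist_eq, sub_zero, abs_of_nonneg dist_nonneg, dist_comm, dist_eq_norm]
  calc _ ≤ |s| * (η / (|s| + 1) / 2) := hchar.trans (by gcongr)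
    _ ≤ (|s| + 1) * (η / (|s| + 1) / 2) := by gcongr; linarith
    _ = η / 2 := by field_simp
    _ < η := half_lt_self hη

end LocallyStationary

end LocallyStationary

section LocalLimit

lemma LocalizingKernel.integrable_sq {K : ℝ → ℝ} (hK : LocalizingKernel K) :
    Integrable (fun x => K x ^ 2) := by
  obtain ⟨B, hB⟩ := hK.bounded
  obtain ⟨v, V, -, hKv⟩ := exists_variation_bound hK.boundedVariation
  rw [← integrableOn_iff_integrable_of_support_subset
    ((Function.support_pow K two_ne_zero).trans_subset hK.support_subset)]
  exact Measure.integrableOn_of_bounded (M := B ^ 2) (by simp)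
    ((measurable_of_abs_sub_le hKv).pow_const 2).aestronglyMeasurable (.of_forall fun x => by
      simpa using pow_le_pow_left₀ (abs_nonneg _) (hB x) 2)

lemma LocalizingKernel.integral_sq_pos {K : ℝ → ℝ} (hK : LocalizingKernel K) :
    0 < ∫ x, K x ^ 2 := by
  rw [integral_pos_iff_support_of_nonneg (fun x => sq_nonneg _) hK.integrable_sq,
    Function.support_pow K two_ne_zero, pos_iff_ne_zero]
  intro hnull
  have hzero : K =ᵐ[volume] 0 := by
    rw [Filter.EventuallyEq, ae_iff]
    simpa [Function.support] using hnull
  simpa [integral_congr_ae hzero] using hK.integral_eq_one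

variable {Ω : Type*} [MeasurableSpace Ω] {P : Measure Ω} {ε ε' : ℤ → Ω → ℝ}

lemma autocov_congr_ae {Xs : ℤ → ℝ → Ω → ℝ} {u : ℝ} {Y : ℤ → Ω → ℝ}
    (h : ∀ t, Xs t u =ᵐ[P] Y t) (k : ℤ) : autocov P Xs u k = cov[Y 0, Y k; P] := by
  rw [autocov, covariance, covariance, integral_congr_ae (h 0), integral_congr_ae (h k)]
  refine integral_congr_ae ?_
  filter_upwards [h 0, h k] with ω h0 hk
  rw [h0, hk]

theorem LocallyStationary.localCLT [IsProbabilityMeasure P] {X : ℤ → ℕ → Ω → ℝ}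
    {H : ℝ → (ℕ → ℝ) → ℝ} {δ : ℕ → ℝ≥0} {A c : ℝ≥0} {α : ℝ} {t₀ : ℤ}
    (hX : LocallyStationary P ε ε' X H 2 δ A c α t₀) (hε : Innovations P ε ε') (hα : 0 < α)
    {K : ℝ → ℝ} (hK : LocalizingKernel K) {b : ℕ → ℝ} (hb : Tendsto b atTop (𝓝 0))
    (hnb : Tendsto (fun n : ℕ => (n : ℝ) * b n) atTop atTop)
    (hbα : Tendsto (fun n : ℕ => √((n : ℝ) * b n) * (n : ℝ) ^ (-α)) atTop (𝓝 0))
    {u : ℝ} (hu : u ∈ Set.Ioo (0 : ℝ) 1) {Xs : ℤ → ℝ → Ω → ℝ}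
    (hXs : ∀ t, Xs t u =ᵐ[P] fun ω => H u (past ε t ω)) : LocalCLT P K X Xs b u := by
  have hw := localWeights_kernelWeight hK hb hnb hbα hu
  have hH := hX.dependence hε u
  have hδ := NNReal.summable_coe.2 hX.summable
  have hcov := autocov_congr_ae hXs
  have hvar := hH.tendsto_norm_sq_centeredSum hε hδ hw
  have hchar := hX.tendsto_charFun_sum hε hα hw
  have hlong : longRunVar P Xs u = _ := tsum_congr hcov
  simp only [← hlong] at hvar hchar
  have hnonneg : 0 ≤ (∫ x, K x ^ 2) * longRunVar P Xs u := ge_of_tendsto' hvar fun n => sq_nonneg _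
  have hsum : ∀ n : ℕ, localSum P K X (b n) u n = fun ω => ∑ t ∈ Finset.Icc (1 : ℤ) n,
      kernelWeight K b u n t * (X t n ω - ∫ ω', X t n ω' ∂P) := fun n => by
    ext ω
    simp only [localSum, kernelWeight, Finset.mul_sum, mul_assoc]
  have hmeas : ∀ n : ℕ, AEMeasurable (localSum P K X (b n) u n) P := fun n => by
    rw [hsum n]
    exact (Finset.measurable_fun_sum _ fun t _ =>
      ((hX.measurable_array t n).sub_const _).const_mul _).aemeasurable
  refine ⟨(hH.summable_cov hε hδ).congr fun k => (hcov k).symm,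
    nonneg_of_mul_nonneg_right hnonneg hK.integral_sq_pos, hmeas, aemeasurable_id,
    ProbabilityMeasure.tendsto_iff_tendsto_charFun.2 fun s => ?_⟩
  have hgauss : charFun ((gaussianReal 0 ((∫ x, K x ^ 2) * longRunVar P Xs u).toNNReal).map id) s
      = (Real.exp (-(s ^ 2 / 2 * ((∫ x, K x ^ 2) * longRunVar P Xs u))) : ℝ) := by
    rw [Measure.map_id, charFun_gaussianReal, Complex.ofReal_exp, Real.coe_toNNReal _ hnonneg]
    push_cast
    ring_nf
  change Tendsto (fun n : ℕ => charFun (P.map (localSum P K X (b n) u n)) s) atTop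
    (𝓝 (charFun ((gaussianReal 0 ((∫ x, K x ^ 2) * longRunVar P Xs u).toNNReal).map id) s))
  simpa only [hsum, hgauss] using hchar s

end LocalLimit

/-! ### Locally Lipschitz transforms of lagged values -/

section PolynomialLipschitz

variable {r : ℕ} {M C : ℝ} {g : (Fin r → ℝ) → ℝ}

lemma ClassL.abs_sub_le (hg : ClassL r M C g) (y y' : Fin r → ℝ) :
    |g y - g y'| ≤ 3 * C.toNNReal * (∑ i, |y i - y' i|) * (1 + ∑ i, |y i| + ∑ i, |y' i|) ^ M := by
  rcases eq_or_ne y y' with rfl | hne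
  · simp
  set a := ∑ i, |y i|
  set a' := ∑ i, |y' i|
  have ha : 0 ≤ a := Finset.sum_nonneg fun i _ => abs_nonneg _
  have ha' : 0 ≤ a' := Finset.sum_nonneg fun i _ => abs_nonneg _
  have hdist : 0 < ∑ i, |y i - y' i| := by
    obtain ⟨i, hi⟩ := Function.ne_iff.1 hne
    exact Finset.sum_pos' (fun i _ => abs_nonneg _)
      ⟨i, Finset.mem_univ i, abs_pos.2 (sub_ne_zero.2 hi)⟩
  have hlip := hg.2 y y' hne
  rw [div_le_iff₀ (by positivity)] at hlip
  have hgrowth : 1 + a ^ M + a' ^ M ≤ 3 * (1 + a + a') ^ M := by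
    linarith [Real.one_le_rpow (by linarith : 1 ≤ 1 + a + a') hg.1,
      Real.rpow_le_rpow ha (by linarith : a ≤ 1 + a + a') hg.1,
      Real.rpow_le_rpow ha' (by linarith : a' ≤ 1 + a + a') hg.1]
  calc |g y - g y'| ≤ C * ((∑ i, |y i - y' i|) * (1 + a ^ M + a' ^ M)) := hlip
    _ ≤ C.toNNReal * ((∑ i, |y i - y' i|) * (3 * (1 + a + a') ^ M)) := by
        gcongr
        exact Real.le_coe_toNNReal C
    _ = _ := by ring

lemma ClassL.continuous (hg : ClassL r M C g) : Continuous g := by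
  refine continuous_iff_continuousAt.2 fun y => tendsto_iff_norm_sub_tendsto_zero.2 ?_
  have hbound : Continuous fun x : Fin r → ℝ =>
      3 * C.toNNReal * (∑ i, |x i - y i|) * (1 + ∑ i, |x i| + ∑ i, |y i|) ^ M :=
    Continuous.mul (by fun_prop) (Continuous.rpow_const (by fun_prop) fun x => .inr hg.1)
  exact squeeze_zero (fun _ => norm_nonneg _) (fun x => hg.abs_sub_le x y)
    (by simpa using hbound.tendsto y)

variable {Ω : Type*} [MeasurableSpace Ω] {P : Measure Ω}

lemma eLpNorm_mul_rpow_le {q : ℝ} (hq : 0 < q) (hM : 0 ≤ M) {D S : Ω → ℝ}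
    (hD : AEStronglyMeasurable D P) (hS : AEStronglyMeasurable S P) (hS0 : ∀ ω, 0 ≤ S ω) :
    eLpNorm (fun ω => D ω * S ω ^ M) (ENNReal.ofReal q) P
      ≤ eLpNorm D (ENNReal.ofReal (q * (M + 1))) P
        * eLpNorm S (ENNReal.ofReal (q * (M + 1))) P ^ M := by
  rcases hM.eq_or_lt with rfl | hM
  · simp
  have hholder : ENNReal.HolderTriple (ENNReal.ofReal (q * (M + 1)))
      (ENNReal.ofReal (q * (M + 1) / M)) (ENNReal.ofReal q) := by
    constructor
    rw [← ENNReal.ofReal_inv_of_pos (by positivity), ← ENNReal.ofReal_inv_of_pos (by positivity),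
      ← ENNReal.ofReal_add (by positivity) (by positivity), ← ENNReal.ofReal_inv_of_pos hq]
    congr 1
    field_simp
    ring
  have hrpow : (fun ω => S ω ^ M) = fun ω => ‖S ω‖ ^ M := by
    simp only [Real.norm_eq_abs, abs_of_nonneg (hS0 _)]
  refine (eLpNorm_smul_le_mul_eLpNorm (p := ENNReal.ofReal (q * (M + 1)))
    (q := ENNReal.ofReal (q * (M + 1) / M))
    (hS.aemeasurable.pow_const M).aestronglyMeasurable hD).trans_eq ?_
  rw [hrpow, eLpNorm_norm_rpow S hM, ← ENNReal.ofReal_mul (by positivity),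
    div_mul_cancel₀ _ hM.ne']

lemma eLpNorm_sum_abs_le {p : ℝ≥0∞} (hp : 1 ≤ p) {Y : Fin r → Ω → ℝ}
    (hY : ∀ j, AEStronglyMeasurable (Y j) P) :
    eLpNorm (fun ω => ∑ j, |Y j ω|) p P ≤ ∑ j, eLpNorm (Y j) p P := by
  have hsum : (fun ω => ∑ j, |Y j ω|) = ∑ j, fun ω => ‖Y j ω‖ := by
    ext ω; simp
  rw [hsum]
  exact (eLpNorm_sum_le (fun j _ => (hY j).norm) hp).trans_eq
    (Finset.sum_congr rfl fun j _ => eLpNorm_norm _)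

lemma eLpNorm_one_add_sum_abs_add_sum_abs_le [IsProbabilityMeasure P] {p : ℝ≥0∞} (hp : 1 ≤ p)
    {Y Y' : Fin r → Ω → ℝ} (hY : ∀ j, AEStronglyMeasurable (Y j) P)
    (hY' : ∀ j, AEStronglyMeasurable (Y' j) P) {B : ℝ≥0} (hB : ∀ j, eLpNorm (Y j) p P ≤ B)
    (hB' : ∀ j, eLpNorm (Y' j) p P ≤ B) :
    eLpNorm (fun ω => 1 + ∑ j, |Y j ω| + ∑ j, |Y' j ω|) p P ≤ (1 + 2 * r * B : ℝ≥0) := by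
  have hsum : ∀ {W : Fin r → Ω → ℝ}, (∀ j, AEStronglyMeasurable (W j) P) →
      AEStronglyMeasurable (fun ω => ∑ j, |W j ω|) P := fun hW =>
    (Finset.aemeasurable_fun_sum _ fun j _ => (hW j).norm.aemeasurable).aestronglyMeasurable
  have hone : eLpNorm (fun _ : Ω => (1 : ℝ)) p P = 1 := by
    simp [eLpNorm_const _ (one_pos.trans_le hp).ne' (IsProbabilityMeasure.ne_zero P)]
  have hbound : ∀ {W : Fin r → Ω → ℝ}, (∀ j, AEStronglyMeasurable (W j) P) →
      (∀ j, eLpNorm (W j) p P ≤ B) → eLpNorm (fun ω => ∑ j, |W j ω|) p P ≤ r * B := fun hW hWB =>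
    (eLpNorm_sum_abs_le hp hW).trans ((Finset.sum_le_sum fun j _ => hWB j).trans_eq (by simp))
  calc eLpNorm (fun ω => 1 + ∑ j, |Y j ω| + ∑ j, |Y' j ω|) p P ≤ 1 + r * B + r * B :=
        (eLpNorm_add_le (aestronglyMeasurable_const.add (hsum hY)) (hsum hY') hp).trans
          (add_le_add ((eLpNorm_add_le aestronglyMeasurable_const (hsum hY) hp).trans
            (add_le_add hone.le (hbound hY hB))) (hbound hY' hB'))
    _ = (1 + 2 * r * B : ℝ≥0) := by
        push_cast
        ring

/-- Lipschitz constant of a function in `L_r(M, C)` as a map from `L^{q(M+1)}` to `L^q`, on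
arguments with components of norm at most `B`. -/
def lipConst (r : ℕ) (M C : ℝ) (B : ℝ≥0) : ℝ≥0 :=
  3 * C.toNNReal * (1 + 2 * r * B) ^ M

lemma ClassL.eLpNorm_sub_le [IsProbabilityMeasure P] (hg : ClassL r M C g) {q : ℝ} (hq : 1 ≤ q)
    {Y Y' : Fin r → Ω → ℝ} (hY : ∀ j, AEStronglyMeasurable (Y j) P)
    (hY' : ∀ j, AEStronglyMeasurable (Y' j) P) {B : ℝ≥0}
    (hB : ∀ j, eLpNorm (Y j) (ENNReal.ofReal (q * (M + 1))) P ≤ B)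
    (hB' : ∀ j, eLpNorm (Y' j) (ENNReal.ofReal (q * (M + 1))) P ≤ B) :
    eLpNorm (fun ω => g (fun j => Y j ω) - g fun j => Y' j ω) (ENNReal.ofReal q) P
      ≤ lipConst r M C B
        * ∑ j, eLpNorm (fun ω => Y j ω - Y' j ω) (ENNReal.ofReal (q * (M + 1))) P := by
  have hp : 1 ≤ ENNReal.ofReal (q * (M + 1)) := by
    rw [ENNReal.one_le_ofReal]
    nlinarith [hg.1]
  let D : Ω → ℝ := fun ω => ∑ j, |Y j ω - Y' j ω|
  let S : Ω → ℝ := fun ω => 1 + ∑ j, |Y j ω| + ∑ j, |Y' j ω|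
  have hD : AEStronglyMeasurable D P :=
    (Finset.aemeasurable_fun_sum _ fun j _ =>
      ((hY j).sub (hY' j)).norm.aemeasurable).aestronglyMeasurable
  have hS : AEStronglyMeasurable S P :=
    ((aemeasurable_const.add (Finset.aemeasurable_fun_sum _ fun j _ =>
      (hY j).norm.aemeasurable)).add (Finset.aemeasurable_fun_sum _ fun j _ =>
      (hY' j).norm.aemeasurable)).aestronglyMeasurable
  have hpointwise : ∀ ω, ‖g (fun j => Y j ω) - g fun j => Y' j ω‖
      ≤ ‖(((3 * C.toNNReal : ℝ≥0) : ℝ) • fun ω => D ω * S ω ^ M) ω‖ := fun ω => by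
    refine (hg.abs_sub_le _ _).trans ((le_of_eq ?_).trans (le_abs_self _))
    simp only [Pi.smul_apply, smul_eq_mul, D, S]
    push_cast
    ring
  calc eLpNorm (fun ω => g (fun j => Y j ω) - g fun j => Y' j ω) (ENNReal.ofReal q) P
      ≤ (3 * C.toNNReal : ℝ≥0) * eLpNorm (fun ω => D ω * S ω ^ M) (ENNReal.ofReal q) P :=
        (eLpNorm_mono hpointwise).trans_eq (by
          rw [eLpNorm_const_smul, Real.enorm_of_nonneg NNReal.zero_le_coe,
            ENNReal.ofReal_coe_nnreal])
    _ ≤ (3 * C.toNNReal : ℝ≥0) * (eLpNorm D (ENNReal.ofReal (q * (M + 1))) P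
          * eLpNorm S (ENNReal.ofReal (q * (M + 1))) P ^ M) := by
        gcongr
        exact eLpNorm_mul_rpow_le (one_pos.trans_le hq) hg.1 hD hS fun ω => by positivity
    _ ≤ (3 * C.toNNReal : ℝ≥0) *
          ((∑ j, eLpNorm (fun ω => Y j ω - Y' j ω) (ENNReal.ofReal (q * (M + 1))) P)
            * (1 + 2 * r * B : ℝ≥0) ^ M) := by
        gcongr
        · exact eLpNorm_sum_abs_le hp fun j => (hY j).sub (hY' j)
        · exact hg.1
        · exact eLpNorm_one_add_sum_abs_add_sum_abs_le hp hY hY' hB hB'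
    _ = _ := by
        rw [lipConst, ENNReal.coe_mul (3 * C.toNNReal), ENNReal.coe_rpow_of_nonneg _ hg.1]
        ring

end PolynomialLipschitz

section Shift

variable {Ω : Type*}

lemma past_add (ε : ℤ → Ω → ℝ) (t : ℤ) (ω : Ω) (j : ℕ) :
    (fun i => past ε t ω (i + j)) = past ε (t - j) ω := by
  ext i
  simp only [past, Nat.cast_add, sub_sub, add_comm (i : ℤ)]

lemma coupledPast_add (ε ε' : ℤ → Ω → ℝ) (t s : ℤ) (ω : Ω) (j : ℕ) :
    (fun i => coupledPast ε ε' t s ω (i + j)) = coupledPast ε ε' (t - j) s ω := by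
  ext i
  simp only [coupledPast, Nat.cast_add, sub_sub, add_comm (i : ℤ)]

lemma coupledPast_of_lt (ε ε' : ℤ → Ω → ℝ) {t s : ℤ} (h : t < s) (ω : Ω) :
    coupledPast ε ε' t s ω = past ε t ω := by
  ext i
  rw [coupledPast, if_neg (by lia), past]

/-- The sequence `δ` delayed by `j` steps and preceded by zeros, which bounds the dependence
measures of a process lagged by `j`. -/
def delay (δ : ℕ → ℝ≥0) (j k : ℕ) : ℝ≥0 :=
  if j ≤ k then δ (k - j) else 0

lemma summable_delay {δ : ℕ → ℝ≥0} (hδ : Summable δ) (j : ℕ) : Summable (delay δ j) :=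
  (NNReal.summable_nat_add_iff j).1 (by simpa [delay] using hδ)

variable {r : ℕ}

/-- The functional of the past that represents `g(W_t, …, W_{t-r+1})` when `W_t = H(v, F_t)`. -/
def lagFunctional (g : (Fin r → ℝ) → ℝ) (H : ℝ → (ℕ → ℝ) → ℝ) (v : ℝ) (x : ℕ → ℝ) : ℝ :=
  g fun j : Fin r => H v fun i => x (i + j)

lemma lagFunctional_past (g : (Fin r → ℝ) → ℝ) (H : ℝ → (ℕ → ℝ) → ℝ) (v : ℝ) (ε : ℤ → Ω → ℝ)
    (t : ℤ) (ω : Ω) :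
    lagFunctional g H v (past ε t ω) = g fun j => H v (past ε (t - (j : ℕ)) ω) := by
  simp only [lagFunctional, past_add]

lemma lagFunctional_coupledPast (g : (Fin r → ℝ) → ℝ) (H : ℝ → (ℕ → ℝ) → ℝ) (v : ℝ)
    (ε ε' : ℤ → Ω → ℝ) (t s : ℤ) (ω : Ω) :
    lagFunctional g H v (coupledPast ε ε' t s ω)
      = g fun j => H v (coupledPast ε ε' (t - (j : ℕ)) s ω) := by
  simp only [lagFunctional, coupledPast_add]

end Shift

section Lag

lemma abs_lag_div_sub_div_rpow_le {α : ℝ} (hα : 0 ≤ α) {j r : ℕ} (hj : j ≤ r) (t : ℤ) (n : ℕ) :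
    |((t - j : ℤ) : ℝ) / n - t / n| ^ α ≤ r ^ α * (n : ℝ) ^ (-α) := by
  have habs : |((t - j : ℤ) : ℝ) / n - t / n| = j / n := by
    rw [← abs_of_nonneg (by positivity : (0 : ℝ) ≤ j / n), ← abs_neg]
    congr 1
    push_cast
    ring
  rw [habs, Real.div_rpow (by positivity) (by positivity), Real.rpow_neg (by positivity),
    ← div_eq_mul_inv]
  gcongr

variable {Ω : Type*} [MeasurableSpace Ω] {P : Measure Ω} {ε ε' : ℤ → Ω → ℝ}
  {X : ℤ → ℕ → Ω → ℝ} {H : ℝ → (ℕ → ℝ) → ℝ} {p : ℝ≥0∞} {δ : ℕ → ℝ≥0} {A c : ℝ≥0} {α : ℝ} {t₀ : ℤ}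

namespace LocallyStationary

lemma eLpNorm_lag_sub_coupledPast_le (hX : LocallyStationary P ε ε' X H p δ A c α t₀) (v : ℝ)
    (t : ℤ) (j k : ℕ) :
    eLpNorm (fun ω => H v (past ε (t - j) ω) - H v (coupledPast ε ε' (t - j) (t - k) ω)) p P
      ≤ delay δ j k := by
  unfold delay
  split_ifs with hjk
  · have hcast : t - (k : ℤ) = t - j - ((k - j : ℕ) : ℤ) := by lia
    rw [hcast]
    exact hX.coupled v _ _
  · simp [coupledPast_of_lt ε ε' (by lia : t - (j : ℤ) < t - k)]

lemma eLpNorm_lag_sub_le (hX : LocallyStationary P ε ε' X H p δ A c α t₀)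
    (hε : Innovations P ε ε') (hp : 1 ≤ p) (hα : 0 ≤ α) {n : ℕ} {t : ℤ} {j r : ℕ} (hj : j ≤ r)
    (h₀ : t₀ + r ≤ t) (hn : t ≤ n) :
    eLpNorm (fun ω => X (t - j) n ω - H (t / n) (past ε (t - j) ω)) p P
      ≤ c * (1 + (r : ℝ≥0) ^ α : ℝ≥0) * ENNReal.ofReal (n ^ (-α)) := by
  let v : ℝ := (t - j : ℤ) / n
  have hmeas := fun v' => hX.measurable_comp_past hε v' (t - j)
  calc eLpNorm (fun ω => X (t - j) n ω - H (t / n) (past ε (t - j) ω)) p P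
      ≤ eLpNorm (fun ω => X (t - j) n ω - H v (past ε (t - j) ω)) p P
        + eLpNorm (fun ω => H v (past ε (t - j) ω) - H (t / n) (past ε (t - j) ω)) p P := by
        simpa only [Pi.add_def, Pi.sub_def, sub_add_sub_cancel] using
          eLpNorm_add_le ((hX.measurable_array (t - j) n).sub (hmeas v)).aestronglyMeasurable
            ((hmeas v).sub (hmeas (t / n))).aestronglyMeasurable hp
    _ ≤ c * ENNReal.ofReal (n ^ (-α)) + c * ENNReal.ofReal (r ^ α * (n : ℝ) ^ (-α)) :=
        add_le_add (hX.approx n (t - j) (by lia) (by lia))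
          ((hX.holder _ _ _).trans (by gcongr; exact abs_lag_div_sub_div_rpow_le hα hj t n))
    _ = c * (1 + (r : ℝ≥0) ^ α : ℝ≥0) * ENNReal.ofReal (n ^ (-α)) := by
        have hr : ENNReal.ofReal ((r : ℝ) ^ α) = ((r : ℝ≥0) ^ α : ℝ≥0) := by
          rw [← ENNReal.ofReal_coe_nnreal, NNReal.coe_rpow, NNReal.coe_natCast]
        rw [ENNReal.ofReal_mul (by positivity), hr]
        push_cast
        ring

/-- A common bound for the `L^p` norms of the array, of its approximations, and of their coupled
versions. -/
def momentBound (δ : ℕ → ℝ≥0) (A c : ℝ≥0) : ℝ≥0 :=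
  A + ∑' k, δ k + c

lemma eLpNorm_past_le (hX : LocallyStationary P ε ε' X H p δ A c α t₀) (v : ℝ) (t : ℤ) :
    eLpNorm (fun ω => H v (past ε t ω)) p P ≤ momentBound δ A c :=
  (hX.moment v t).trans (ENNReal.coe_le_coe.2 (le_add_right le_self_add))

lemma eLpNorm_coupledPast_le (hX : LocallyStationary P ε ε' X H p δ A c α t₀)
    (hε : Innovations P ε ε') (hp : 1 ≤ p) (v : ℝ) (t s : ℤ) :
    eLpNorm (fun ω => H v (coupledPast ε ε' t s ω)) p P ≤ momentBound δ A c := by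
  rcases lt_or_ge t s with hlt | hle
  · simpa only [coupledPast_of_lt ε ε' hlt] using hX.eLpNorm_past_le v t
  obtain ⟨k, rfl⟩ : ∃ k : ℕ, s = t - k := ⟨(t - s).toNat, by lia⟩
  have hpast := hX.measurable_comp_past hε v t
  have hsub := eLpNorm_sub_le (μ := P) hpast.aestronglyMeasurable
    (hpast.sub (hX.measurable_comp_coupledPast hε v t (t - k))).aestronglyMeasurable hp
  simp only [Pi.sub_def, sub_sub_cancel] at hsub
  calc _ ≤ (A + δ k : ℝ≥0∞) := hsub.trans (add_le_add (hX.moment v t) (hX.coupled v t k))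
    _ ≤ momentBound δ A c := by
        rw [← ENNReal.coe_add, ENNReal.coe_le_coe]
        exact le_add_right (add_le_add_right (hX.summable.le_tsum k fun _ _ => zero_le) A)

lemma eLpNorm_array_le (hX : LocallyStationary P ε ε' X H p δ A c α t₀)
    (hε : Innovations P ε ε') (hp : 1 ≤ p) (hα : 0 ≤ α) {n : ℕ} {t : ℤ} (h₀ : t₀ ≤ t)
    (hn : t ≤ n) : eLpNorm (X t n) p P ≤ momentBound δ A c := by
  have hpast := hX.measurable_comp_past hε (t / n) t
  have hadd := eLpNorm_add_le (μ := P) hpast.aestronglyMeasurable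
    ((hX.measurable_array t n).sub hpast).aestronglyMeasurable hp
  simp only [Pi.add_def, Pi.sub_def, add_sub_cancel] at hadd
  have hpow : (n : ℝ) ^ (-α) ≤ 1 := by
    rcases n.eq_zero_or_pos with rfl | hpos
    · simpa using Real.zero_rpow_le_one (-α)
    · exact Real.rpow_le_one_of_one_le_of_nonpos (by exact_mod_cast hpos) (neg_nonpos.2 hα)
  calc eLpNorm (X t n) p P ≤ A + c * ENNReal.ofReal (n ^ (-α)) :=
        hadd.trans (add_le_add (hX.moment _ t) (hX.approx n t h₀ hn))
    _ ≤ A + c * 1 := by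
        gcongr
        exact ENNReal.ofReal_le_one.2 hpow
    _ ≤ momentBound δ A c := by
        rw [mul_one, ← ENNReal.coe_add, ENNReal.coe_le_coe]
        exact add_le_add_left le_self_add c

end LocallyStationary

end Lag

section LagTransform

variable {Ω : Type*} [MeasurableSpace Ω] {P : Measure Ω} {ε ε' : ℤ → Ω → ℝ}
  {X : ℤ → ℕ → Ω → ℝ} {Xs : ℤ → ℝ → Ω → ℝ} {H : ℝ → (ℕ → ℝ) → ℝ} {δ : ℕ → ℝ≥0} {A c : ℝ≥0}
  {q α M C : ℝ} {t₀ : ℤ} {r : ℕ} {g : (Fin r → ℝ) → ℝ}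

lemma lagTransform_ae_eq_lagFunctional (g : (Fin r → ℝ) → ℝ) {u : ℝ}
    (hXs : ∀ t, Xs t u =ᵐ[P] fun ω => H u (past ε t ω)) (t : ℤ) :
    lagTransform g Xs t u =ᵐ[P] fun ω => lagFunctional g H u (past ε t ω) := by
  filter_upwards [ae_all_iff.2 fun j : Fin r => hXs (t - (j : ℕ))] with ω hω
  simp only [lagFunctional_past, lagTransform, hω]

lemma ClassL.one_le_ofReal_mul_add_one (hg : ClassL r M C g) (hq : 1 ≤ q) :
    1 ≤ ENNReal.ofReal (q * (M + 1)) :=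
  ENNReal.one_le_ofReal.2 (one_le_mul_of_one_le_of_one_le hq (by linarith [hg.1]))

variable [IsProbabilityMeasure P]

namespace LocallyStationary

lemma eLpNorm_lagFunctional_le
    (hX : LocallyStationary P ε ε' X H (ENNReal.ofReal (q * (M + 1))) δ A c α t₀)
    (hε : Innovations P ε ε') (hg : ClassL r M C g) (hq : 1 ≤ q) (v : ℝ) (t : ℤ) :
    eLpNorm (fun ω => lagFunctional g H v (past ε t ω)) (ENNReal.ofReal q) P
      ≤ (lipConst r M C (momentBound δ A c) * (r * A) + ‖g 0‖₊ : ℝ≥0) := by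
  have hmeas := fun j : Fin r => hX.measurable_comp_past hε v (t - (j : ℕ))
  have hq1 : 1 ≤ ENNReal.ofReal q := ENNReal.one_le_ofReal.2 hq
  have hlip := hg.eLpNorm_sub_le hq (Y' := fun _ _ => 0) (fun j => (hmeas j).aestronglyMeasurable)
    (fun _ => aestronglyMeasurable_const) (fun j => hX.eLpNorm_past_le v _) (by simp)
  simp only [sub_zero] at hlip
  have hg0 : eLpNorm (fun _ : Ω => g 0) (ENNReal.ofReal q) P = ‖g 0‖₊ := by
    simp [eLpNorm_const _ (one_pos.trans_le hq1).ne' (IsProbabilityMeasure.ne_zero P),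
      enorm_eq_nnnorm]
  have hadd := eLpNorm_add_le (μ := P)
    (((hg.continuous.measurable.comp (measurable_pi_lambda _ hmeas)).sub_const
      (g 0)).aestronglyMeasurable) (aestronglyMeasurable_const (b := g 0)) hq1
  simp only [lagFunctional_past]
  simp only [Pi.add_def, Function.comp_def, sub_add_cancel, hg0] at hadd
  push_cast
  refine hadd.trans (add_le_add_left (hlip.trans ?_) _)
  gcongr
  exact (Finset.sum_le_sum fun j _ => hX.moment v _).trans_eq (by simp)

lemma eLpNorm_lagFunctional_sub_coupledPast_le
    (hX : LocallyStationary P ε ε' X H (ENNReal.ofReal (q * (M + 1))) δ A c α t₀)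
    (hε : Innovations P ε ε') (hg : ClassL r M C g) (hq : 1 ≤ q) (v : ℝ) (t : ℤ) (k : ℕ) :
    eLpNorm (fun ω => lagFunctional g H v (past ε t ω)
        - lagFunctional g H v (coupledPast ε ε' t (t - k) ω)) (ENNReal.ofReal q) P
      ≤ (lipConst r M C (momentBound δ A c) * ∑ j : Fin r, delay δ j k : ℝ≥0) := by
  simp only [lagFunctional_past, lagFunctional_coupledPast]
  refine (hg.eLpNorm_sub_le hq
    (fun j => (hX.measurable_comp_past hε v _).aestronglyMeasurable)
    (fun j => (hX.measurable_comp_coupledPast hε v _ _).aestronglyMeasurable)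
    (fun j => hX.eLpNorm_past_le v _)
    fun j => hX.eLpNorm_coupledPast_le hε (hg.one_le_ofReal_mul_add_one hq) v _ _).trans ?_
  push_cast
  gcongr with j
  exact hX.eLpNorm_lag_sub_coupledPast_le v t j k

lemma eLpNorm_lagFunctional_sub_le
    (hX : LocallyStationary P ε ε' X H (ENNReal.ofReal (q * (M + 1))) δ A c α t₀)
    (hε : Innovations P ε ε') (hg : ClassL r M C g) (hq : 1 ≤ q) (t : ℤ) (v v' : ℝ) :
    eLpNorm (fun ω => lagFunctional g H v (past ε t ω) - lagFunctional g H v' (past ε t ω))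
        (ENNReal.ofReal q) P
      ≤ (lipConst r M C (momentBound δ A c) * (r * c) : ℝ≥0)
        * ENNReal.ofReal (|v - v'| ^ α) := by
  simp only [lagFunctional_past]
  refine (hg.eLpNorm_sub_le hq
    (fun j => (hX.measurable_comp_past hε v _).aestronglyMeasurable)
    (fun j => (hX.measurable_comp_past hε v' _).aestronglyMeasurable)
    (fun j => hX.eLpNorm_past_le v _) fun j => hX.eLpNorm_past_le v' _).trans
    ((mul_le_mul_right (Finset.sum_le_sum fun j _ => hX.holder _ v v') _).trans_eq ?_)
  simp only [Finset.sum_const, Finset.card_univ, Fintype.card_fin, nsmul_eq_mul]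
  push_cast
  ring

lemma eLpNorm_lagTransform_sub_lagFunctional_le
    (hX : LocallyStationary P ε ε' X H (ENNReal.ofReal (q * (M + 1))) δ A c α t₀)
    (hε : Innovations P ε ε') (hg : ClassL r M C g) (hq : 1 ≤ q) (hα : 0 ≤ α) {n : ℕ} {t : ℤ}
    (h₀ : t₀ + r ≤ t) (hn : t ≤ n) :
    eLpNorm (fun ω => lagTransform g X t n ω - lagFunctional g H (t / n) (past ε t ω))
        (ENNReal.ofReal q) P
      ≤ (lipConst r M C (momentBound δ A c) * (r * (c * (1 + (r : ℝ≥0) ^ α))) : ℝ≥0)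
        * ENNReal.ofReal (n ^ (-α)) := by
  have hp := hg.one_le_ofReal_mul_add_one hq
  simp only [lagFunctional_past, lagTransform]
  refine (hg.eLpNorm_sub_le hq (fun j => (hX.measurable_array _ n).aestronglyMeasurable)
    (fun j => (hX.measurable_comp_past hε _ _).aestronglyMeasurable)
    (fun j => hX.eLpNorm_array_le hε hp hα (by have := j.2; lia) (by lia))
    fun j => hX.eLpNorm_past_le _ _).trans
    ((mul_le_mul_right (Finset.sum_le_sum fun j _ =>
      hX.eLpNorm_lag_sub_le hε hp hα j.2.le h₀ hn) _).trans_eq ?_)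
  simp only [Finset.sum_const, Finset.card_univ, Fintype.card_fin, nsmul_eq_mul]
  push_cast
  ring

theorem exists_lagTransform
    (hX : LocallyStationary P ε ε' X H (ENNReal.ofReal (q * (M + 1))) δ A c α t₀)
    (hε : Innovations P ε ε') (hg : ClassL r M C g) (hq : 1 ≤ q) (hα : 0 ≤ α) :
    ∃ δ' A' c', LocallyStationary P ε ε' (lagTransform g X) (lagFunctional g H)
      (ENNReal.ofReal q) δ' A' c' α (t₀ + r) := by
  have hgm := hg.continuous.measurable
  set Λ := lipConst r M C (momentBound δ A c)
  have hδ : Summable fun k => Λ * ∑ j : Fin r, delay δ j k :=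
    (summable_sum fun (j : Fin r) _ => summable_delay hX.summable j).mul_left Λ
  exact ⟨fun k => Λ * ∑ j : Fin r, delay δ j k, Λ * (r * A) + ‖g 0‖₊,
    Λ * (r * (c * (1 + (r : ℝ≥0) ^ α))),
    { measurable_array := fun t n =>
        hgm.comp (measurable_pi_lambda _ fun j => hX.measurable_array _ n)
      measurable := fun v => hgm.comp (measurable_pi_lambda _ fun j => (hX.measurable v).comp
        (measurable_pi_lambda _ fun i => measurable_pi_apply _))
      summable := hδ
      moment := hX.eLpNorm_lagFunctional_le hε hg hq
      coupled := hX.eLpNorm_lagFunctional_sub_coupledPast_le hε hg hq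
      holder := fun t v v' => (hX.eLpNorm_lagFunctional_sub_le hε hg hq t v v').trans (by
        gcongr
        exact le_mul_of_one_le_right' le_self_add)
      approx := fun n t => hX.eLpNorm_lagTransform_sub_lagFunctional_le hε hg hq hα }⟩

end LocallyStationary

end LagTransform

section Conditions

variable {Ω : Type*} [MeasurableSpace Ω] {P : Measure Ω} {ε ε' : ℤ → Ω → ℝ}
  {X : ℤ → ℕ → Ω → ℝ} {Xs : ℤ → ℝ → Ω → ℝ} {q α : ℝ}

lemma eLpNorm_comp_past_eq (hε : Innovations P ε ε') {H : (ℕ → ℝ) → ℝ} (hH : Measurable H)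
    {Y : Ω → ℝ} {s : ℤ} (hY : Y =ᵐ[P] fun ω => H (past ε s ω)) (p : ℝ≥0∞) (t : ℤ) :
    eLpNorm (fun ω => H (past ε t ω)) p P = eLpNorm Y p P :=
  (((hε.identDistrib_past t s).comp hH).eLpNorm_eq p).trans (eLpNorm_congr_ae hY).symm

theorem exists_locallyStationary (hε : Innovations P ε ε') (hX : ∀ t n, Measurable (X t n))
    (hα : 0 ≤ α) (hS : CondS1 P X Xs q α) (hM : CondM1 P ε ε' Xs q) :
    ∃ H δ A c, LocallyStationary P ε ε' X H (ENNReal.ofReal q) δ A c α 1 ∧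
      ∀ u ∈ Set.Icc (0 : ℝ) 1, ∀ t, Xs t u =ᵐ[P] fun ω => H u (past ε t ω) := by
  obtain ⟨H, hH, hXs, hsum⟩ := hM
  obtain ⟨c, hc, happrox⟩ := hS.approx
  let clamp : ℝ → Set.Icc (0 : ℝ) 1 := Set.projIcc 0 1 zero_le_one
  have hclamp : ∀ v ∈ Set.Icc (0 : ℝ) 1, (clamp v : ℝ) = v := fun v hv =>
    congrArg Subtype.val (Set.projIcc_of_mem _ hv)
  have hmeas : ∀ v, Measurable (H (clamp v)) := fun v => hH _ (clamp v).2
  refine ⟨fun v => H (clamp v),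
    fun k => (⨆ u ∈ Set.Icc (0 : ℝ) 1, depMeasure P ε ε' (H u) q k).toNNReal,
    (⨆ u ∈ Set.Icc (0 : ℝ) 1, lqNorm P q (Xs 0 u)).toNNReal, c.toNNReal,
    ⟨hX, hmeas, ENNReal.summable_toNNReal_of_tsum_ne_top hsum.ne, fun v t => ?_, fun v t k => ?_,
      fun t v v' => ?_, fun n t ht htn => ?_⟩, fun u hu t => ?_⟩
  · rw [ENNReal.coe_toNNReal (hS.moment 0).ne]
    exact (eLpNorm_comp_past_eq hε (hmeas v) (hXs _ (clamp v).2 0) _ t).trans_le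
      (le_iSup₂ (f := fun u _ => lqNorm P q (Xs 0 u)) _ (clamp v).2)
  · rw [ENNReal.coe_toNNReal (ENNReal.ne_top_of_tsum_ne_top hsum.ne k)]
    exact (le_iSup (fun t : ℤ => lqNorm P q fun ω => H (clamp v) (past ε t ω)
      - H (clamp v) (coupledPast ε ε' t (t - k) ω)) t).trans
      (le_iSup₂ (f := fun u _ => depMeasure P ε ε' (H u) q k) _ (clamp v).2)
  · refine (eLpNorm_comp_past_eq hε ((hmeas v).sub (hmeas v'))
      ((hXs _ (clamp v).2 1).sub (hXs _ (clamp v').2 1)) _ t).trans_le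
      (((happrox 1 1 le_rfl le_rfl).1 _ (clamp v).2 _ (clamp v').2).trans ?_)
    rw [ENNReal.ofReal_mul hc.le]
    exact mul_le_mul_right (ENNReal.ofReal_le_ofReal
      (Real.rpow_le_rpow (abs_nonneg _) (Set.abs_projIcc_sub_projIcc _) hα)) _
  · have hmem : (t : ℝ) / n ∈ Set.Icc (0 : ℝ) 1 :=
      ⟨div_nonneg (by exact_mod_cast zero_le_one.trans ht) n.cast_nonneg,
        div_le_one_of_le₀ (by exact_mod_cast htn) n.cast_nonneg⟩
    rw [hclamp _ hmem]
    exact (eLpNorm_congr_ae ((ae_eq_refl (X t n)).sub (hXs _ hmem t).symm)).trans_le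
      ((happrox n t ht htn).2.trans_eq (ENNReal.ofReal_mul hc.le))
  · simpa only [hclamp u hu] using hXs u hu t

end Conditions

end LocStat

end

theorem theorem2p10_general {Ω : Type*} [MeasurableSpace Ω] (P : Measure Ω)
    [IsProbabilityMeasure P] (K : ℝ → ℝ) (hK : LocStat.LocalizingKernel K)
    (X : ℤ → ℕ → Ω → ℝ) (hX : ∀ t n, Measurable (X t n)) (Xs : ℤ → ℝ → Ω → ℝ)
    (ε ε' : ℤ → Ω → ℝ) (hε : LocStat.Innovations P ε ε')
    (q : ℝ) (hq : 2 ≤ q) (α : ℝ) (hα : 0 < α)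
    (b : ℕ → ℝ) (hb : Tendsto b atTop (𝓝 0))
    (hnb : Tendsto (fun n : ℕ => (n : ℝ) * b n) atTop atTop)
    (hbα : Tendsto (fun n : ℕ => √((n : ℝ) * b n) * (n : ℝ) ^ (-α)) atTop (𝓝 0))
    (u : ℝ) (hu : u ∈ Set.Ioo (0 : ℝ) 1) :
    (LocStat.CondS1 P X Xs q α → LocStat.CondM1 P ε ε' Xs q → LocStat.LocalCLT P K X Xs b u) ∧
    (∀ (r : ℕ) (M C : ℝ) (g : (Fin r → ℝ) → ℝ), LocStat.ClassL r M C g →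
      LocStat.CondS1 P X Xs (q * (M + 1)) α → LocStat.CondM1 P ε ε' Xs (q * (M + 1)) →
      LocStat.LocalCLT P K (LocStat.lagTransform g X) (LocStat.lagTransform g Xs) b u) := by
  have hu' : u ∈ Set.Icc (0 : ℝ) 1 := Set.Ioo_subset_Icc_self hu
  have h2q : 2 ≤ ENNReal.ofReal q := ENNReal.ofNat_le_ofReal.2 hq
  refine ⟨fun hS hM => ?_, fun r M C g hg hS hM => ?_⟩ <;>
    obtain ⟨H, δ, A, c, hH, hXs⟩ := LocStat.exists_locallyStationary hε hX hα.le hS hM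
  · exact (hH.mono_exponent hε h2q).localCLT hε hα hK hb hnb hbα hu (hXs u hu')
  · obtain ⟨δ', A', c', hG⟩ := hH.exists_lagTransform hε hg (one_le_two.trans hq) hα.le
    exact (hG.mono_exponent hε h2q).localCLT hε hα hK hb hnb hbα hu
      (LocStat.lagTransform_ae_eq_lagFunctional g (hXs u hu'))

theorem theorem2p10 {Ω : Type*} [MeasurableSpace Ω] (P : Measure Ω) [IsProbabilityMeasure P]
    (K : ℝ → ℝ) (hK : LocStat.LocalizingKernel K)
    -- the array and its stationary approximation
    (X : ℤ → ℕ → Ω → ℝ) (hX : ∀ t n, Measurable (X t n))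
    (Xs : ℤ → ℝ → Ω → ℝ) (hXs : ∀ t, ∀ u ∈ Set.Icc (0 : ℝ) 1, Measurable (Xs t u))
    (hstat : ∀ u ∈ Set.Icc (0 : ℝ) 1, LocStat.StationaryErgodic P (fun t => Xs t u))
    -- i.i.d. innovations and their independent copies
    (ε ε' : ℤ → Ω → ℝ) (hε : LocStat.Innovations P ε ε')
    (q : ℝ) (hq : 2 ≤ q) (α : ℝ) (hα : 0 < α) (hα' : α ≤ 1)
    -- bandwidths
    (b : ℕ → ℝ) (hb : Tendsto b atTop (𝓝 0))
    (hnb : Tendsto (fun n : ℕ => (n : ℝ) * b n) atTop atTop)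
    (hbα : Tendsto (fun n : ℕ => √((n : ℝ) * b n) * (n : ℝ) ^ (-α)) atTop (𝓝 0))
    (u : ℝ) (hu : u ∈ Set.Ioo (0 : ℝ) 1) :
    (LocStat.CondS1 P X Xs q α → LocStat.CondS2 P Xs q → LocStat.CondM1 P ε ε' Xs q →
      LocStat.LocalCLT P K X Xs b u) ∧
    (∀ (r : ℕ) (M C : ℝ) (g : (Fin r → ℝ) → ℝ), LocStat.ClassL r M C g →
      LocStat.CondS1 P X Xs (q * (M + 1)) α → LocStat.CondS2 P Xs (q * (M + 1)) →
      LocStat.CondM1 P ε ε' Xs (q * (M + 1)) →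
      LocStat.LocalCLT P K (LocStat.lagTransform g X) (LocStat.lagTransform g Xs) b u) := by
  have h := theorem2p10_general P K hK X hX Xs ε ε' hε q hq α hα b hb hnb hbα u hu
  exact ⟨fun hS _ => h.1 hS, fun r M C g hg hS _ => h.2 r M C g hg hS⟩
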